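/- Let $n\in\mathbb N$, $1<p<\infty$, $p'=p/(p-1)$, and let $\Omega\subset\mathbb R^n$ be a bounded open set. Let $W:\Omega\times\mathbb R^{n\times n}\to\mathbb R$ be such that $W(\cdot,\xi)$ is measurable for every $\xi$, and for a.e. $x\in\Omega$ the function $W(x,\cdot)$ is differentiable, is quasiconvex, i.e. $$|U|\,W(x,\xi)\le\int_U W(x,\xi+\nabla\varphi(y))\,dy$$ for every $\xi\in\mathbb R^{n\times n}$, every bounded open $U\subset\mathbb R^n$ and every $\varphi\in C_c^\infty(U;\mathbb R^n)$, and satisfies the coerciveness and growth conditions $$a_0|\xi|^p-b_0(x)\le W(x,\xi)\le a_1|\xi|^p+b_1(x)\qquad\text{for every }\xi\in\mathbb R^{n\times n},$$ with constants $a_0>0$, $a_1\in\mathbb R$ and functions $b_0,b_1\in L^1(\Omega)$. Let $\partial_\xi W(x,\xi)$ denote the $n\times n$ matrix of the partial derivatives of $W(x,\xi)$ with respect to the components of $\xi$. Suppose that $u_k\rightharpoonup u$ weakly in $W^{1,p}(\Omega;\mathbb R^n)$ (that is, $u_k\rightharpoonup u$ and $\nabla u_k\rightharpoonup\nabla u$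 weakly in $L^p$), and that $$\int_\Omega W(x,\nabla u_k(x))\,dx\longrightarrow\int_\Omega W(x,\nabla u(x))\,dx .$$ Then the functions $\partial_\xi W(x,\nabla u_k(x))$ and $\partial_\xi W(x,\nabla u(x))$ belong to $L^{p'}(\Omega;\mathbb R^{n\times n})$, and $$\partial_\xi W(x,\nabla u_k(x))\rightharpoonup\partial_\xi W(x,\nabla u(x))\qquad\text{weakly in }L^{p'}(\Omega;\mathbb R^{n\times n}).$$ It is not assumed that $\nabla u_k$ converges to $\nabla u$ in measure. -/

import Mathlib

open MeasureTheory Filter Topology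
open scoped ContDiff

/-- Euclidean space of dimension `n`. -/
abbrev Vec (n : ℕ) : Type := EuclideanSpace ℝ (Fin n)

/-- Real `n × n` matrices with the Euclidean (Frobenius) norm and inner product
`⟪A, B⟫ = ∑ i j, A (i, j) * B (i, j)`; the entry in row `i` and column `j` is `A (i, j)`. -/
abbrev Mat (n : ℕ) : Type := EuclideanSpace ℝ (Fin n × Fin n)

/-- The Jacobian matrix of `φ` at `x`, with entries `∂ⱼ φᵢ(x)`. -/
noncomputable def jacobian {n : ℕ} (φ : Vec n → Vec n) (x : Vec n) : Mat n :=
  WithLp.toLp 2 fun ij => (fderiv ℝ φ x (EuclideanSpace.single ij.2 1)) ij.1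

/-- The matrix `∂_ξ W(x, ξ)` of the partial derivatives of `W(x, ·)` at `ξ` with respect to the
entries of `ξ`. -/
noncomputable def partialXi {n : ℕ} (W : Vec n → Mat n → ℝ) (x : Vec n) (ξ : Mat n) : Mat n :=
  WithLp.toLp 2 fun ij => lineDeriv ℝ (W x) ξ (EuclideanSpace.single ij 1)

/-- Quasiconvexity in the sense of Morrey (for continuous `f`): affine maps minimize
`∫_U f(∇v)` among their smooth compactly supported perturbations in a bounded open set `U`. -/
def IsQuasiconvex {n : ℕ} (f : Mat n → ℝ) : Prop :=
  ∀ (ξ : Mat n) (U : Set (Vec n)), IsOpen U → Bornology.IsBounded U →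
    ∀ φ : Vec n → Vec n, ContDiff ℝ ∞ φ → HasCompactSupport φ → tsupport φ ⊆ U →
      (volume U).toReal * f ξ ≤ ∫ x in U, f (ξ + jacobian φ x)

/-- `G` is the weak (distributional) gradient of `u` in the open set `Ω`. -/
def IsWeakGradient {n : ℕ} (Ω : Set (Vec n)) (u : Vec n → Vec n) (G : Vec n → Mat n) : Prop :=
  ∀ φ : Vec n → ℝ, ContDiff ℝ ∞ φ → HasCompactSupport φ → tsupport φ ⊆ Ω →
    ∀ i j : Fin n,
      ∫ x in Ω, u x i * fderiv ℝ φ x (EuclideanSpace.single j 1) = -∫ x in Ω, G x (i, j) * φ x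

/-- `u ∈ W^{1,p}(Ω; ℝⁿ)` with weak gradient `∇u = G`. -/
structure IsSobolev {n : ℕ} (p : ℝ) (Ω : Set (Vec n)) (u : Vec n → Vec n) (G : Vec n → Mat n) :
    Prop where
  memLp : MemLp u (ENNReal.ofReal p) (volume.restrict Ω)
  memLp_grad : MemLp G (ENNReal.ofReal p) (volume.restrict Ω)
  isWeakGradient : IsWeakGradient Ω u G

/-- Weak convergence `f k ⇀ g` in `L^r(Ω; F)`, `1 < r < ∞`: all functions lie in `L^r`, and the
integrals against every function in `L^{r'}`, `r' = r / (r - 1)`, converge. -/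
structure WeakLpTendsto {n : ℕ} {F : Type*} [NormedAddCommGroup F] [InnerProductSpace ℝ F]
    (r : ℝ) (Ω : Set (Vec n)) (f : ℕ → Vec n → F) (g : Vec n → F) : Prop where
  memLp : ∀ k, MemLp (f k) (ENNReal.ofReal r) (volume.restrict Ω)
  memLp_lim : MemLp g (ENNReal.ofReal r) (volume.restrict Ω)
  tendsto : ∀ ψ : Vec n → F, MemLp ψ (ENNReal.ofReal (r / (r - 1))) (volume.restrict Ω) →
    Tendsto (fun k => ∫ x in Ω, inner ℝ (f k x) (ψ x)) atTop (𝓝 (∫ x in Ω, inner ℝ (g x) (ψ x)))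

/-- Weak convergence `u k ⇀ v` in `W^{1,p}(Ω; ℝⁿ)`, where `∇(u k) = Du k` and `∇v = Dv`: the
functions and their weak gradients converge weakly in `L^p`. -/
structure WeakSobolevTendsto {n : ℕ} (p : ℝ) (Ω : Set (Vec n)) (u : ℕ → Vec n → Vec n)
    (Du : ℕ → Vec n → Mat n) (v : Vec n → Vec n) (Dv : Vec n → Mat n) : Prop where
  isSobolev : ∀ k, IsSobolev p Ω (u k) (Du k)
  isSobolev_lim : IsSobolev p Ω v Dv
  tendsto : WeakLpTendsto p Ω u v
  tendsto_grad : WeakLpTendsto p Ω Du Dv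

/-- The standing assumptions on the bulk energy density: `W` is measurable in `x`, and for almost
every `x ∈ Ω` the function `W(x, ·)` is differentiable and quasiconvex, and satisfies coerciveness
and growth conditions of order `p`. -/
structure IsBulkEnergy {n : ℕ} (p : ℝ) (Ω : Set (Vec n)) (W : Vec n → Mat n → ℝ) : Prop where
  aemeasurable : ∀ ξ, AEMeasurable (fun x => W x ξ) (volume.restrict Ω)
  differentiable : ∀ᵐ x ∂volume.restrict Ω, Differentiable ℝ (W x)
  isQuasiconvex : ∀ᵐ x ∂volume.restrict Ω, IsQuasiconvex (W x)
  growth : ∃ (a₀ a₁ : ℝ) (b₀ b₁ : Vec n → ℝ), 0 < a₀ ∧ IntegrableOn b₀ Ω ∧ IntegrableOn b₁ Ω ∧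
    ∀ᵐ x ∂volume.restrict Ω, ∀ ξ : Mat n,
      a₀ * ‖ξ‖ ^ p - b₀ x ≤ W x ξ ∧ W x ξ ≤ a₁ * ‖ξ‖ ^ p + b₁ x

/-! Write `I(ζ) = ∫_Ω W(x, ζ(x))`. Fix `Ψ ∈ L^p` and `t > 0`. Lower semicontinuity of `I` along `Du
k + tΨ`, together with `I(Du k) → I(Dv)`, gives `liminf (I(Du k + tΨ) - I(Du k)) ≥ I(Dv + tΨ) -
I(Dv)`. If difference quotients can be replaced by derivatives with an error that is uniform in `k`,
then `liminf ∫⟪∂W(Du k), Ψ⟫ ≥ ∫⟪∂W(Dv), Ψ⟫`, and the same inequality for `-Ψ` yields the limit. No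
convergence of `Du k` in measure enters.

Uniform differentiability (`IsBulkEnergy.exists_forall_abs_integral_sub_le`). Quasiconvexity implies
convexity along each matrix entry. A differentiable function with this property has continuous
partial derivatives, and growth of order `p` passes to growth of order `p - 1` of the gradient.
Coercivity bounds `Du k` in `L^p`, so off a set of small measure the matrices `Du k(x)` stay in a
fixed ball, where continuity in `ξ` applies; on the small set Young's inequality controls the
remainder.

Lower semicontinuity (`IsBulkEnergy.eventually_le_integral_add`). The shift `ζ = Dv + tΨ` is in
general not a gradient, so it is treated as part of the `x`-dependence of the integrand. For smooth
perturbations `g m → 0` uniformly with bounded gradients, the integrand is a function in `L¹(ℝⁿ;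
C(K))`; averaging over small translations freezes `x`, and quasiconvexity on one ball finishes
(`IsBulkEnergy.eventually_le_integral_add_jacobian`). General `w k ⇀ 0` are replaced by Lipschitz
truncations at height `λ` that agree with them, up to a small error, off a set of measure at most `τ
/ λ^p` (`exists_truncation_frequently`). On this set the truncation costs little, and the original
energy is bounded below by a fixed integrable function, so concentrations can only help. The
truncation combines a weak-type maximal inequality with a dyadic choice of level. -/

/-! ### Jacobians -/

/-- The matrix of a linear map, as a continuous linear map. -/
noncomputable def matrixOf (n : ℕ) : (Vec n →L[ℝ] Vec n) →L[ℝ] Mat n :=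
  LinearMap.toContinuousLinearMap
    { toFun := fun L => WithLp.toLp 2 fun ij => (L (EuclideanSpace.single ij.2 1)) ij.1
      map_add' := fun _ _ => by ext; simp
      map_smul' := fun _ _ => by ext; simp }

theorem matrixOf_apply {n : ℕ} (L : Vec n →L[ℝ] Vec n) (ij : Fin n × Fin n) :
    matrixOf n L ij = (L (EuclideanSpace.single ij.2 1)) ij.1 := rfl

theorem jacobian_eq_matrixOf {n : ℕ} (φ : Vec n → Vec n) (x : Vec n) :
    jacobian φ x = matrixOf n (fderiv ℝ φ x) := rfl

theorem matrixOf_injective (n : ℕ) : Function.Injective (matrixOf n) := by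
  intro L L' h
  have : (L : Vec n →ₗ[ℝ] Vec n) = L' := by
    refine (EuclideanSpace.basisFun (Fin n) ℝ).toBasis.ext fun j => ?_
    ext i
    have := congrArg (fun A : Mat n => A (i, j)) h
    simpa [matrixOf_apply] using this
  exact ContinuousLinearMap.coe_injective this

theorem exists_norm_le_matrixOf (n : ℕ) :
    ∃ c : ℝ, 0 < c ∧ ∀ L : Vec n →L[ℝ] Vec n, ‖L‖ ≤ c * ‖matrixOf n L‖ := by
  obtain ⟨K, hK, h⟩ := (matrixOf n).toLinearMap.exists_antilipschitzWith
    (LinearMap.ker_eq_bot.2 (matrixOf_injective n))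
  refine ⟨K, hK, fun L => ?_⟩
  simpa using h.le_mul_dist L 0

theorem norm_jacobian_le {n : ℕ} (φ : Vec n → Vec n) (x : Vec n) :
    ‖jacobian φ x‖ ≤ ‖matrixOf n‖ * ‖fderiv ℝ φ x‖ :=
  (matrixOf n).le_opNorm _

theorem ContDiff.continuous_jacobian {n : ℕ} {φ : Vec n → Vec n} (h : ContDiff ℝ ∞ φ) :
    Continuous (jacobian φ) :=
  (matrixOf n).continuous.comp (h.continuous_fderiv (by simp))

theorem jacobian_comp_add_left {n : ℕ} (φ : Vec n → Vec n) (a x : Vec n) :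
    jacobian (fun y => φ (a + y)) x = jacobian φ (a + x) := by
  rw [jacobian_eq_matrixOf, jacobian_eq_matrixOf, fderiv_comp_add_left]

/-! ### Quasiconvexity tested on small oscillations -/

theorem exists_lt_volume_ball_sub_le {n : ℕ} {r ε : ℝ} (hr : 0 < r) (hε : 0 < ε) :
    ∃ t, 0 < t ∧ t < r ∧
      volume.real (Metric.ball (0 : Vec n) r) - volume.real (Metric.ball (0 : Vec n) t) ≤ ε := by
  have key : ∀ t : ℝ, 0 < t → volume.real (Metric.ball (0 : Vec n) t)
      = t ^ n * volume.real (Metric.ball (0 : Vec n) 1) := fun t ht => by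
    have := Measure.addHaar_ball_of_pos (volume : Measure (Vec n)) 0 ht
    simp only [measureReal_def, this, ENNReal.toReal_mul, finrank_euclideanSpace_fin]
    rw [ENNReal.toReal_ofReal (by positivity)]
  have hc : Continuous fun t : ℝ => r ^ n * volume.real (Metric.ball (0 : Vec n) 1)
      - t ^ n * volume.real (Metric.ball (0 : Vec n) 1) := by fun_prop
  have h1 : ∀ᶠ t in 𝓝[<] r, r ^ n * volume.real (Metric.ball (0 : Vec n) 1)
      - t ^ n * volume.real (Metric.ball (0 : Vec n) 1) < ε :=
    (hc.continuousAt.eventually_lt_const (by simpa using hε)).filter_mono nhdsWithin_le_nhds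
  have h2 : ∀ᶠ t in 𝓝[<] r, t ∈ Set.Ioo 0 r := Ioo_mem_nhdsLT hr
  obtain ⟨t, ht, h0⟩ := (h1.and h2).exists
  exact ⟨t, h0.1, h0.2, by rw [key r hr, key t h0.1]; exact ht.le⟩

theorem Continuous.integrableOn_ball {n : ℕ} {f : Vec n → ℝ} (hf : Continuous f) (a : Vec n)
    (r : ℝ) : IntegrableOn f (Metric.ball a r) :=
  (hf.continuousOn.integrableOn_compact (isCompact_closedBall a r)).mono_set
    Metric.ball_subset_closedBall

/-- Multiplying `g` by a cutoff makes it admissible in the definition. Since `g` is uniformly small,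
the term `g ⊗ ∇ζ` adds at most `1` to the gradient, and the integrand changes only in a thin shell.
The threshold `s` depends on the Lipschitz bound but not on `g`. -/
theorem IsQuasiconvex.le_integral_ball {n : ℕ} {f : Mat n → ℝ} (hf : IsQuasiconvex f)
    (hc : Continuous f) (ξ : Mat n) (lam : ℝ) {r ε : ℝ} (hr : 0 < r) (hε : 0 < ε) :
    ∃ s > 0, ∀ g : Vec n → Vec n, ContDiff ℝ ∞ g → (∀ x, ‖jacobian g x‖ ≤ lam) →
      (∀ x, ‖g x‖ ≤ s) →
      volume.real (Metric.ball (0 : Vec n) r) * f ξ - ε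
        ≤ ∫ x in Metric.ball (0 : Vec n) r, f (ξ + jacobian g x) := by
  obtain ⟨M, hM⟩ := (isCompact_closedBall ξ (lam + 1)).exists_bound_of_continuousOn
    hc.continuousOn
  have hM' : ∀ η : Mat n, ‖η‖ ≤ lam + 1 → |f (ξ + η)| ≤ |M| := fun η h =>
    (hM _ (by simpa using h)).trans (le_abs_self M)
  -- In the shell between radii `t` and `r` the two integrands differ by at most `2|M|`.
  obtain ⟨t, ht, htr, hvol⟩ := exists_lt_volume_ball_sub_le (n := n) hr
    (show 0 < ε / (2 * |M| + 1) by positivity)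
  let ζ : ContDiffBump (0 : Vec n) := ⟨t, (t + r) / 2, ht, by linarith⟩
  have hζ : ContDiff ℝ ∞ ζ := ζ.contDiff
  obtain ⟨C, hC⟩ := (ζ.hasCompactSupport.fderiv ℝ).exists_bound_of_continuous
    (hζ.continuous_fderiv (by simp))
  have hC0 : 0 ≤ C := (norm_nonneg _).trans (hC 0)
  refine ⟨1 / (‖matrixOf n‖ * C + 1), by positivity, fun g hg hgl hgs => ?_⟩
  let φ : Vec n → Vec n := fun x => ζ x • g x
  have hφ : ContDiff ℝ ∞ φ := hζ.smul hg
  have hsupp : tsupport φ ⊆ Metric.closedBall 0 ((t + r) / 2) := by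
    refine (tsupport_smul_subset_left ζ g).trans ?_
    rw [ζ.tsupport_eq]
  have hJ : ∀ x, ‖jacobian φ x‖ ≤ lam + 1 := by
    intro x
    have hd : fderiv ℝ φ x = ζ x • fderiv ℝ g x + (fderiv ℝ ζ x).smulRight (g x) :=
      fderiv_fun_smul (hζ.differentiable (by simp) x) (hg.differentiable (by simp) x)
    rw [jacobian_eq_matrixOf, hd, map_add, map_smul, ← jacobian_eq_matrixOf]
    refine (norm_add_le _ _).trans (add_le_add ?_ ?_)
    · rw [norm_smul, Real.norm_of_nonneg ζ.nonneg]
      exact (mul_le_of_le_one_left (norm_nonneg _) ζ.le_one).trans (hgl x)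
    · refine ((matrixOf n).le_opNorm _).trans ?_
      rw [ContinuousLinearMap.norm_smulRight_apply]
      calc ‖matrixOf n‖ * (‖fderiv ℝ ζ x‖ * ‖g x‖)
          ≤ ‖matrixOf n‖ * (C * (1 / (‖matrixOf n‖ * C + 1))) := by
            gcongr
            · exact hC x
            · exact hgs x
        _ = (‖matrixOf n‖ * C) / (‖matrixOf n‖ * C + 1) := by ring
        _ ≤ 1 := by rw [div_le_one (by positivity)]; linarith
  have hEq : ∀ x ∈ Metric.ball (0 : Vec n) t, jacobian φ x = jacobian g x := by
    intro x hx
    have : φ =ᶠ[𝓝 x] g := by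
      filter_upwards [Metric.isOpen_ball.mem_nhds hx] with y hy
      simp [φ, ζ.one_of_mem_closedBall (Metric.ball_subset_closedBall hy)]
    rw [jacobian_eq_matrixOf, jacobian_eq_matrixOf, this.fderiv_eq]
  have hq := hf ξ (Metric.ball 0 r) Metric.isOpen_ball Metric.isBounded_ball φ hφ
    (HasCompactSupport.of_support_subset_isCompact (isCompact_closedBall 0 ((t + r) / 2))
      (subset_closure.trans hsupp))
    (hsupp.trans (Metric.closedBall_subset_ball (by linarith)))
  have hcφ : Continuous fun x => f (ξ + jacobian φ x) := by
    have := hφ.continuous_jacobian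
    fun_prop
  have hcg : Continuous fun x => f (ξ + jacobian g x) := by
    have := hg.continuous_jacobian
    fun_prop
  have hi1 := hcφ.integrableOn_ball 0 r
  have hi2 := hcg.integrableOn_ball 0 r
  have hdiff : ∫ x in Metric.ball (0 : Vec n) r, (f (ξ + jacobian φ x) - f (ξ + jacobian g x))
      ≤ ε := by
    have hint : IntegrableOn ((Metric.ball (0 : Vec n) t)ᶜ.indicator fun _ => 2 * |M|)
        (Metric.ball (0 : Vec n) r) :=
      (integrableOn_const (by simpa using measure_ball_lt_top.ne)).indicator
        Metric.isOpen_ball.measurableSet.compl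
    calc _ ≤ ∫ x in Metric.ball (0 : Vec n) r,
          (Metric.ball (0 : Vec n) t)ᶜ.indicator (fun _ => 2 * |M|) x := by
          refine integral_mono (hi1.sub hi2) hint fun x => ?_
          by_cases hx : x ∈ Metric.ball (0 : Vec n) t
          · simp [hEq x hx, hx]
          · rw [Set.indicator_of_mem hx]
            have h1 := abs_le.1 (hM' _ (hJ x))
            have h2 := abs_le.1 (hM' _ ((hgl x).trans (by linarith)))
            simp only []
            linarith [h1.2, h2.1]
      _ = 2 * |M| * (volume.real (Metric.ball (0 : Vec n) r)
            - volume.real (Metric.ball (0 : Vec n) t)) := by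
          rw [setIntegral_indicator Metric.isOpen_ball.measurableSet.compl, setIntegral_const,
            smul_eq_mul, mul_comm, ← Set.sdiff_eq,
            measureReal_sdiff (Metric.ball_subset_ball htr.le) Metric.isOpen_ball.measurableSet]
      _ ≤ 2 * |M| * (ε / (2 * |M| + 1)) := by gcongr
      _ = ε * ((2 * |M|) / (2 * |M| + 1)) := by ring
      _ ≤ ε * 1 := by
          gcongr
          rw [div_le_one (by positivity)]; linarith
      _ = ε := mul_one ε
  rw [integral_sub hi1 hi2] at hdiff
  rw [measureReal_def]
  linarith

/-! ### Quasiconvex functions are convex along the coordinate directions -/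

/-- A smooth bounded periodic profile; its slope tends to a square wave as `c → 1`. -/
noncomputable def wave (c θ : ℝ) : ℝ := Real.arcsin (c * Real.sin θ)

/-- The slope of `wave`. -/
noncomputable def waveSlope (c θ : ℝ) : ℝ :=
  c * Real.cos θ / √(1 - (c * Real.sin θ) ^ 2)

theorem abs_mul_sin_lt_one {c : ℝ} (hc : c ∈ Set.Ioo (0 : ℝ) 1) (θ : ℝ) :
    |c * Real.sin θ| < 1 := by
  rw [abs_mul, abs_of_pos hc.1]
  exact (mul_le_of_le_one_right hc.1.le (Real.abs_sin_le_one θ)).trans_lt hc.2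

theorem one_sub_sq_mul_sin_pos {c : ℝ} (hc : c ∈ Set.Ioo (0 : ℝ) 1) (θ : ℝ) :
    0 < 1 - (c * Real.sin θ) ^ 2 := by
  have := (sq_lt_one_iff_abs_lt_one _).2 (abs_mul_sin_lt_one hc θ)
  linarith

theorem contDiff_wave {c : ℝ} (hc : c ∈ Set.Ioo (0 : ℝ) 1) : ContDiff ℝ ∞ (wave c) := by
  refine contDiff_iff_contDiffAt.2 fun θ => ?_
  have h := abs_lt.1 (abs_mul_sin_lt_one hc θ)
  exact (Real.contDiffAt_arcsin h.1.ne' h.2.ne).comp θ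
    ((contDiff_const.mul Real.contDiff_sin).contDiffAt)

theorem hasDerivAt_wave {c : ℝ} (hc : c ∈ Set.Ioo (0 : ℝ) 1) (θ : ℝ) :
    HasDerivAt (wave c) (waveSlope c θ) θ := by
  have h := abs_lt.1 (abs_mul_sin_lt_one hc θ)
  have := (Real.hasDerivAt_arcsin h.1.ne' h.2.ne).comp θ ((Real.hasDerivAt_sin θ).const_mul c)
  refine this.congr_deriv ?_
  rw [waveSlope]; ring

theorem abs_waveSlope_le_one {c : ℝ} (hc : c ∈ Set.Ioo (0 : ℝ) 1) (θ : ℝ) :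
    |waveSlope c θ| ≤ 1 := by
  rw [waveSlope, abs_div, abs_of_nonneg (Real.sqrt_nonneg _),
    div_le_one (Real.sqrt_pos.2 (one_sub_sq_mul_sin_pos hc θ))]
  refine Real.le_sqrt_of_sq_le ?_
  rw [sq_abs, mul_pow, mul_pow]
  have h1 := Real.sin_sq_add_cos_sq θ
  have h2 : c ^ 2 ≤ 1 := by nlinarith [hc.1, hc.2]
  nlinarith

theorem continuous_waveSlope {c : ℝ} (hc : c ∈ Set.Ioo (0 : ℝ) 1) :
    Continuous (waveSlope c) := by
  unfold waveSlope
  refine Continuous.div (by fun_prop) (by fun_prop) fun θ => ?_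
  exact (Real.sqrt_pos.2 (one_sub_sq_mul_sin_pos hc θ)).ne'

theorem waveSlope_add_pi (c θ : ℝ) : waveSlope c (θ + Real.pi) = -waveSlope c θ := by
  simp [waveSlope, neg_div]

theorem waveSlope_periodic (c : ℝ) : Function.Periodic (waveSlope c) (2 * Real.pi) := by
  intro θ; simp [waveSlope]

theorem tendsto_waveSlope {θ : ℝ} (hθ : Real.cos θ ≠ 0) {u : ℕ → ℝ}
    (hu : Tendsto u atTop (𝓝 1)) :
    Tendsto (fun m => waveSlope (u m) θ) atTop (𝓝 (Real.cos θ / |Real.cos θ|)) := by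
  have h : Real.cos θ / |Real.cos θ| = waveSlope 1 θ := by
    rw [waveSlope, one_mul, one_mul, ← Real.cos_sq', Real.sqrt_sq_eq_abs]
  rw [h]
  have hc : ContinuousAt (fun c => waveSlope c θ) 1 := by
    unfold waveSlope
    refine ContinuousAt.div (by fun_prop) (by fun_prop) ?_
    rw [one_mul, ← Real.cos_sq', Real.sqrt_sq_eq_abs]
    simpa using hθ
  exact hc.tendsto.comp hu

theorem countable_cos_eq_zero : {θ : ℝ | Real.cos θ = 0}.Countable := by
  refine (Set.countable_range fun k : ℤ => (2 * (k : ℝ) + 1) * Real.pi / 2).mono ?_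
  intro θ hθ
  obtain ⟨k, hk⟩ := Real.cos_eq_zero_iff.1 hθ
  exact ⟨k, hk.symm⟩

theorem norm_single_one {ι : Type*} [Fintype ι] [DecidableEq ι] (i : ι) :
    ‖(EuclideanSpace.single i 1 : EuclideanSpace ℝ ι)‖ = 1 := by simp

theorem jacobian_smul_single {n : ℕ} {q : Vec n → ℝ} {x : Vec n} {i j : Fin n} {d : ℝ}
    (hq : HasFDerivAt q (d • (EuclideanSpace.proj j : Vec n →L[ℝ] ℝ)) x) :
    jacobian (fun y => q y • (EuclideanSpace.single i 1 : Vec n)) x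
      = d • EuclideanSpace.single (i, j) 1 := by
  rw [jacobian_eq_matrixOf, (hq.smul_const _).fderiv]
  ext ⟨a, b⟩
  by_cases h1 : a = i <;> by_cases h2 : b = j <;> simp [matrixOf_apply, h1, h2, Ne.symm]

/-- Averaging over the phase replaces the Riemann–Lebesgue lemma: by periodicity the inner average
is exact for every frequency. -/
theorem integral_waveSlope_phase {F : ℝ → ℝ} (hF : Continuous F) {c : ℝ}
    (hc : c ∈ Set.Ioo (0 : ℝ) 1) {α : Type*} [TopologicalSpace α]
    [SecondCountableTopology α] [MeasurableSpace α] [BorelSpace α] (μ : Measure α)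
    [IsFiniteMeasure μ] {l : α → ℝ} (hl : Continuous l) :
    ∫ θ in (0)..(2 * Real.pi), ∫ x, F (waveSlope c (l x + θ)) ∂μ
      = μ.real Set.univ * ∫ θ in (0)..(2 * Real.pi), F (waveSlope c θ) := by
  have h2 : (0 : ℝ) ≤ 2 * Real.pi := by positivity
  obtain ⟨M, hM⟩ := (isCompact_Icc (a := (-1 : ℝ)) (b := 1)).exists_bound_of_continuousOn
    hF.continuousOn
  have hcw := continuous_waveSlope hc
  have hint : Integrable (Function.uncurry fun θ x => F (waveSlope c (l x + θ)))
      ((volume.restrict (Set.Ioc 0 (2 * Real.pi))).prod μ) := by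
    refine Integrable.of_bound (C := M) ?_ (ae_of_all _ fun z => ?_)
    · refine Continuous.aestronglyMeasurable ?_
      unfold Function.uncurry
      fun_prop
    · exact hM _ (abs_le.1 (abs_waveSlope_le_one hc _))
  rw [intervalIntegral.integral_of_le h2, integral_integral_swap hint]
  have : ∀ x, ∫ θ in Set.Ioc 0 (2 * Real.pi), F (waveSlope c (l x + θ))
      = ∫ θ in (0)..(2 * Real.pi), F (waveSlope c θ) := fun x => by
    rw [← intervalIntegral.integral_of_le h2,
      intervalIntegral.integral_comp_add_left (fun θ => F (waveSlope c θ)) (l x), add_zero]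
    have hp : Function.Periodic (fun θ => F (waveSlope c θ)) (2 * Real.pi) := fun θ => by
      simp only [waveSlope_periodic c θ]
    rw [hp.intervalIntegral_add_eq (l x) 0, zero_add]
  simp only [this, integral_const, smul_eq_mul]

/-- The test field `(a/k) wave(k xⱼ + θ) eᵢ` is small in sup norm for large `k`, while its Jacobian
is `a · waveSlope` in the single entry `(i, j)`. The bound is averaged over `θ`. -/
theorem IsQuasiconvex.le_integral_waveSlope {n : ℕ} {f : Mat n → ℝ} (hf : IsQuasiconvex f)
    (hc : Continuous f) (ξ : Mat n) (i j : Fin n) (a : ℝ) {c : ℝ} (hcc : c ∈ Set.Ioo (0 : ℝ) 1) :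
    4 * Real.pi * f ξ ≤ ∫ θ in (0)..(2 * Real.pi),
      (f (ξ + (a * waveSlope c θ) • EuclideanSpace.single (i, j) 1)
        + f (ξ - (a * waveSlope c θ) • EuclideanSpace.single (i, j) 1)) := by
  set E : Mat n := EuclideanSpace.single (i, j) 1 with hE
  set B := Metric.ball (0 : Vec n) 1
  have hV : 0 < volume.real B :=
    ENNReal.toReal_pos (Metric.measure_ball_pos volume 0 one_pos).ne' measure_ball_lt_top.ne
  have hcw := continuous_waveSlope hcc
  have hF : Continuous fun τ : ℝ => f (ξ + (a * τ) • E) + f (ξ - (a * τ) • E) := by fun_prop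
  refine le_of_forall_pos_le_add fun ε hε => ?_
  obtain ⟨s, hs, H⟩ := hf.le_integral_ball hc ξ |a| one_pos
    (show 0 < volume.real B * ε / (4 * Real.pi) by positivity)
  -- Since `|wave| ≤ π`, this frequency makes the field at most `s` in norm.
  obtain ⟨k, hk⟩ := exists_nat_gt (|a| * Real.pi / s)
  have hk0 : (0 : ℝ) < k := lt_of_le_of_lt (by positivity) hk
  have key : ∀ θ, volume.real B * f ξ - volume.real B * ε / (4 * Real.pi)
      ≤ ∫ x in B, f (ξ + (a * waveSlope c (k * x j + θ)) • E) := by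
    intro θ
    let q : Vec n → ℝ := fun x => a / k * wave c (k * x j + θ)
    have hq : ∀ x, HasFDerivAt q ((a * waveSlope c (k * x j + θ)) •
        (EuclideanSpace.proj j : Vec n →L[ℝ] ℝ)) x := by
      intro x
      have h1 : HasFDerivAt (fun x : Vec n => (k : ℝ) * x j + θ)
          ((k : ℝ) • (EuclideanSpace.proj j : Vec n →L[ℝ] ℝ)) x :=
        (((EuclideanSpace.proj j : Vec n →L[ℝ] ℝ).hasFDerivAt).const_mul (k : ℝ)).add_const θ
      have h2 := ((hasDerivAt_wave hcc (k * x j + θ)).comp_hasFDerivAt x h1).const_mul (a / k)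
      refine h2.congr_fderiv ?_
      rw [smul_smul, smul_smul]
      congr 1
      field_simp
    have hJ : ∀ x, jacobian (fun y => q y • (EuclideanSpace.single i 1 : Vec n)) x
        = (a * waveSlope c (k * x j + θ)) • E := fun x => jacobian_smul_single (hq x)
    have := H (fun y => q y • (EuclideanSpace.single i 1 : Vec n)) ?_ ?_ ?_
    · simpa only [hJ] using this
    · refine ContDiff.smul (?_ : ContDiff ℝ ∞ q) contDiff_const
      have h1 : ContDiff ℝ ∞ fun x : Vec n => (k : ℝ) * x j + θ :=
        (contDiff_const.mul (EuclideanSpace.proj j : Vec n →L[ℝ] ℝ).contDiff).add contDiff_const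
      exact contDiff_const.mul ((contDiff_wave hcc).comp h1)
    · intro x
      rw [hJ, norm_smul, hE, norm_single_one, mul_one, Real.norm_eq_abs, abs_mul]
      exact mul_le_of_le_one_right (abs_nonneg a) (abs_waveSlope_le_one hcc _)
    · intro x
      rw [norm_smul, norm_single_one, mul_one, Real.norm_eq_abs, abs_mul, abs_div,
        abs_of_pos hk0]
      have hw : |wave c (k * x j + θ)| ≤ Real.pi :=
        abs_le.2 ⟨by linarith [Real.neg_pi_div_two_le_arcsin (c * Real.sin (k * x j + θ)),
            Real.pi_pos, show wave c (k * x j + θ) = Real.arcsin _ from rfl],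
          (Real.arcsin_le_pi_div_two _).trans (by linarith [Real.pi_pos])⟩
      calc |a| / k * |wave c (k * x j + θ)| ≤ |a| / k * Real.pi := by gcongr
        _ = |a| * Real.pi / k := by ring
        _ ≤ s := by
          rw [div_le_iff₀ hk0]
          rw [div_lt_iff₀ hs] at hk
          linarith
  have hcont : ∀ θ, Continuous fun x : Vec n => f (ξ + (a * waveSlope c (k * x j + θ)) • E) :=
    fun θ => by fun_prop
  have hcont' : ∀ θ, Continuous fun x : Vec n => f (ξ - (a * waveSlope c (k * x j + θ)) • E) :=
    fun θ => by fun_prop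
  have hsum : ∀ θ, 2 * (volume.real B * f ξ - volume.real B * ε / (4 * Real.pi)) ≤
      ∫ x in B, (f (ξ + (a * waveSlope c (k * x j + θ)) • E)
        + f (ξ - (a * waveSlope c (k * x j + θ)) • E)) := by
    intro θ
    rw [integral_add ((hcont θ).integrableOn_ball 0 1) ((hcont' θ).integrableOn_ball 0 1)]
    have h1 := key θ
    -- A half-period shift reverses the sign of the slope, which produces the `-` term.
    have h2 := key (θ + Real.pi)
    simp only [← add_assoc, waveSlope_add_pi, mul_neg, neg_smul, ← sub_eq_add_neg] at h2
    linarith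
  have : IsFiniteMeasure (volume.restrict B) := ⟨by simpa [B] using measure_ball_lt_top⟩
  have hph := integral_waveSlope_phase hF hcc (volume.restrict B)
    (l := fun x : Vec n => (k : ℝ) * x j) (by fun_prop)
  have hpos : (0 : ℝ) ≤ 2 * Real.pi := by positivity
  have hcθ : Continuous fun θ => ∫ x in B, (f (ξ + (a * waveSlope c (k * x j + θ)) • E)
        + f (ξ - (a * waveSlope c (k * x j + θ)) • E)) := by
    obtain ⟨M, hM⟩ := (isCompact_Icc (a := (-1 : ℝ)) (b := 1)).exists_bound_of_continuousOn
      hF.continuousOn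
    refine continuous_of_dominated (bound := fun _ => M) (fun θ => ?_)
      (fun θ => ae_of_all _ fun x => hM _ (abs_le.1 (abs_waveSlope_le_one hcc _)))
      (integrable_const _) (ae_of_all _ fun x => by fun_prop)
    exact ((hcont θ).add (hcont' θ)).aestronglyMeasurable
  have hmono := intervalIntegral.integral_mono_on hpos
    (intervalIntegrable_const (μ := volume) (c :=
      2 * (volume.real B * f ξ - volume.real B * ε / (4 * Real.pi))))
    (hcθ.intervalIntegrable (μ := volume) 0 (2 * Real.pi)) (fun θ _ => hsum θ)
  simp only [measureReal_restrict_apply_univ] at hph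
  rw [hph, intervalIntegral.integral_const, smul_eq_mul, sub_zero] at hmono
  have hrew : 2 * Real.pi * (2 * (volume.real B * f ξ - volume.real B * ε / (4 * Real.pi)))
      = volume.real B * (4 * Real.pi * f ξ - ε) := by
    have := Real.pi_pos
    field_simp
    ring
  rw [hrew] at hmono
  linarith [le_of_mul_le_mul_left hmono hV]

/-- As `c → 1` the slope tends to `±1` wherever `cos θ ≠ 0`, and the symmetrized integrand `F` takes
the same value at `1` and `-1`. -/
theorem IsQuasiconvex.le_midpoint {n : ℕ} {f : Mat n → ℝ} (hf : IsQuasiconvex f)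
    (hc : Continuous f) (ξ : Mat n) (i j : Fin n) (a : ℝ) :
    2 * f ξ ≤ f (ξ + a • EuclideanSpace.single (i, j) 1)
      + f (ξ - a • EuclideanSpace.single (i, j) 1) := by
  set E : Mat n := EuclideanSpace.single (i, j) 1
  set F : ℝ → ℝ := fun τ => f (ξ + (a * τ) • E) + f (ξ - (a * τ) • E) with hFdef
  have hF : Continuous F := by fun_prop
  let u : ℕ → ℝ := fun m => 1 - 1 / ((m : ℝ) + 2)
  have hu : ∀ m, u m ∈ Set.Ioo (0 : ℝ) 1 := fun m => by
    have h1 : (0 : ℝ) < (m : ℝ) + 2 := by positivity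
    have h2 : 1 / ((m : ℝ) + 2) < 1 := by
      rw [div_lt_one h1]; linarith [Nat.cast_nonneg (α := ℝ) m]
    have h3 : 0 < 1 / ((m : ℝ) + 2) := by positivity
    constructor <;> simp only [u] <;> linarith
  have hu1 : Tendsto u atTop (𝓝 1) := by
    have h : Tendsto (fun m : ℕ => 1 / ((m : ℝ) + 2)) atTop (𝓝 0) :=
      tendsto_const_nhds.div_atTop (tendsto_natCast_atTop_atTop.atTop_add tendsto_const_nhds)
    simpa [u] using h.const_sub 1
  obtain ⟨M, hM⟩ := (isCompact_Icc (a := (-1 : ℝ)) (b := 1)).exists_bound_of_continuousOn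
    hF.continuousOn
  have hlim : Tendsto (fun m => ∫ θ in (0)..(2 * Real.pi), F (waveSlope (u m) θ)) atTop
      (𝓝 (∫ _ in (0)..(2 * Real.pi), F 1)) := by
    refine intervalIntegral.tendsto_integral_filter_of_dominated_convergence (fun _ => M)
      (Eventually.of_forall fun m =>
        (hF.comp (continuous_waveSlope (hu m))).aestronglyMeasurable)
      (Eventually.of_forall fun m => ae_of_all _ fun θ _ =>
        hM _ (abs_le.1 (abs_waveSlope_le_one (hu m) θ)))
      intervalIntegrable_const ?_
    have hnull : ∀ᵐ θ : ℝ, Real.cos θ ≠ 0 := by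
      rw [ae_iff]
      simpa using countable_cos_eq_zero.measure_zero volume
    filter_upwards [hnull] with θ hθ _
    have hval : F (Real.cos θ / |Real.cos θ|) = F 1 := by
      rcases lt_or_gt_of_ne hθ with h | h
      · rw [abs_of_neg h, div_neg, div_self hθ]
        simp only [hFdef, mul_neg, mul_one, neg_smul, sub_neg_eq_add, ← sub_eq_add_neg]
        ring
      · rw [abs_of_pos h, div_self hθ]
    rw [← hval]
    exact (hF.tendsto _).comp (tendsto_waveSlope hθ hu1)
  have hge := ge_of_tendsto' hlim fun m => hf.le_integral_waveSlope hc ξ i j a (hu m)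
  rw [intervalIntegral.integral_const, smul_eq_mul, sub_zero] at hge
  have h2 : (2 * Real.pi) * (2 * f ξ) ≤ 2 * Real.pi * F 1 := by linarith
  have := le_of_mul_le_mul_left h2 (by positivity)
  simpa [hFdef] using this

/-- Iterated midpoint convexity bounds the increment for step `2⁻ᵐh` by `2⁻ᵐ` times that for `h`;
dividing by `2⁻ᵐ` and letting `m → ∞` gives the tangent inequality. -/
theorem IsQuasiconvex.fderiv_le {n : ℕ} {f : Mat n → ℝ} (hf : IsQuasiconvex f)
    (hd : Differentiable ℝ f) (ξ : Mat n) (i j : Fin n) (h : ℝ) :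
    h * fderiv ℝ f ξ (EuclideanSpace.single (i, j) 1)
      ≤ f (ξ + h • EuclideanSpace.single (i, j) 1) - f ξ := by
  set E : Mat n := EuclideanSpace.single (i, j) 1
  have hind : ∀ m : ℕ, f (ξ + ((1 / 2 : ℝ) ^ m * h) • E) - f ξ
      ≤ (1 / 2 : ℝ) ^ m * (f (ξ + h • E) - f ξ) := by
    intro m
    induction m with
    | zero => simp
    | succ m ih =>
      have := hf.le_midpoint hd.continuous (ξ + ((1 / 2 : ℝ) ^ (m + 1) * h) • E) i j
        ((1 / 2 : ℝ) ^ (m + 1) * h)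
      rw [add_sub_cancel_right, add_assoc, ← add_smul,
        show (1 / 2 : ℝ) ^ (m + 1) * h + (1 / 2 : ℝ) ^ (m + 1) * h = (1 / 2 : ℝ) ^ m * h by
          ring] at this
      rw [pow_succ (1 / 2 : ℝ) m] at this ⊢
      linarith
  have hder : HasDerivAt (fun t : ℝ => f (ξ + (t * h) • E)) (fderiv ℝ f ξ (h • E)) 0 := by
    have h1 : HasDerivAt (fun t : ℝ => ξ + (t * h) • E) (h • E) 0 := by
      have := (((hasDerivAt_id (0 : ℝ)).mul_const h).smul_const E).const_add ξ
      simpa using this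
    have h2 : HasFDerivAt f (fderiv ℝ f ξ) (ξ + ((0 : ℝ) * h) • E) := by
      simpa using (hd ξ).hasFDerivAt
    exact h2.comp_hasDerivAt 0 h1
  have hseq : Tendsto (fun m : ℕ => (1 / 2 : ℝ) ^ m) atTop (𝓝[≠] 0) :=
    tendsto_nhdsWithin_iff.2 ⟨tendsto_pow_atTop_nhds_zero_of_lt_one (by norm_num) (by norm_num),
      Eventually.of_forall fun m => by simp⟩
  have hlim := hder.tendsto_slope_zero.comp hseq
  rw [map_smul, smul_eq_mul] at hlim
  refine le_of_tendsto' hlim fun m => ?_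
  have hp : (0 : ℝ) < (1 / 2 : ℝ) ^ m := by positivity
  simp only [Function.comp_apply, zero_add, zero_mul, zero_smul, add_zero, smul_eq_mul]
  rw [inv_mul_le_iff₀ hp]
  exact hind m

/-! ### The matrix of partial derivatives: continuity and growth -/

theorem partialXi_apply {n : ℕ} {W : Vec n → Mat n → ℝ} {x : Vec n}
    (hd : Differentiable ℝ (W x)) (ξ : Mat n) (ij : Fin n × Fin n) :
    partialXi W x ξ ij = fderiv ℝ (W x) ξ (EuclideanSpace.single ij 1) :=
  (hd ξ).lineDeriv_eq_fderiv

theorem inner_partialXi {n : ℕ} {W : Vec n → Mat n → ℝ} {x : Vec n}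
    (hd : Differentiable ℝ (W x)) (ξ A : Mat n) :
    inner ℝ (partialXi W x ξ) A = fderiv ℝ (W x) ξ A := by
  have hA : A = ∑ ij, A ij • (EuclideanSpace.single ij 1 : Mat n) := by
    simpa using ((EuclideanSpace.basisFun (Fin n × Fin n) ℝ).sum_repr A).symm
  conv_rhs => rw [hA]
  rw [map_sum, PiLp.inner_apply]
  refine Finset.sum_congr rfl fun ij _ => ?_
  rw [map_smul, smul_eq_mul, partialXi_apply hd]
  simp

/-- For fixed `h` the difference quotient is continuous in the base point and lies above `D` if `h >
0`, below if `h < 0`. Quotients with small `|h|` at `ξ` therefore trap `D` near `ξ` from both sides.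
-/
theorem continuous_of_forall_mul_le_sub {V : Type*} [NormedAddCommGroup V] [NormedSpace ℝ V]
    {f D : V → ℝ} {e : V} (hd : Differentiable ℝ f) (hD : ∀ ξ, D ξ = fderiv ℝ f ξ e)
    (hle : ∀ ξ (h : ℝ), h * D ξ ≤ f (ξ + h • e) - f ξ) : Continuous D := by
  refine continuous_iff_continuousAt.2 fun ξ => ?_
  have hder : HasDerivAt (fun t : ℝ => f (ξ + t • e)) (D ξ) 0 := by
    rw [hD]
    exact (hd ξ).hasFDerivAt.hasLineDerivAt e
  have hslope := hder.tendsto_slope_zero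
  simp only [zero_add, zero_smul, add_zero, smul_eq_mul] at hslope
  have hf := hd.continuous
  refine tendsto_order.2 ⟨fun a ha => ?_, fun a ha => ?_⟩
  · have h1 := (hslope.mono_left (nhdsWithin_mono 0 (fun t ht => ne_of_lt ht : Set.Iio (0 : ℝ) ⊆ {0}ᶜ))).eventually_const_lt ha
    obtain ⟨h, hh, hneg⟩ := (h1.and self_mem_nhdsWithin).exists
    have hneg : h < 0 := hneg
    have hc : Continuous fun η => h⁻¹ * (f (η + h • e) - f η) := by fun_prop
    filter_upwards [hc.continuousAt.eventually_const_lt hh] with η hη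
    have := hle η h
    refine hη.trans_le ?_
    rw [inv_mul_eq_div, div_le_iff_of_neg hneg]
    linarith
  · have h1 := (hslope.mono_left (nhdsWithin_mono 0 (fun t ht => ne_of_gt ht : Set.Ioi (0 : ℝ) ⊆ {0}ᶜ))).eventually_lt_const ha
    obtain ⟨h, hh, hpos⟩ := (h1.and self_mem_nhdsWithin).exists
    have hpos : 0 < h := hpos
    have hc : Continuous fun η => h⁻¹ * (f (η + h • e) - f η) := by fun_prop
    filter_upwards [hc.continuousAt.eventually_lt_const hh] with η hη
    have := hle η h
    refine lt_of_le_of_lt ?_ hη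
    rw [inv_mul_eq_div, le_div_iff₀ hpos]
    linarith

theorem continuous_partialXi {n : ℕ} {W : Vec n → Mat n → ℝ} {x : Vec n}
    (hd : Differentiable ℝ (W x)) (hq : IsQuasiconvex (W x)) : Continuous (partialXi W x) := by
  refine (PiLp.continuous_toLp 2 _).comp (continuous_pi fun ij => ?_)
  exact continuous_of_forall_mul_le_sub hd (fun ξ => partialXi_apply hd ξ ij) fun ξ h => by
    have := hq.fderiv_le hd ξ ij.1 ij.2 h
    rwa [← partialXi_apply hd] at this

theorem norm_le_sum_abs {ι : Type*} [Fintype ι] [DecidableEq ι] (A : EuclideanSpace ℝ ι) :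
    ‖A‖ ≤ ∑ i, |A i| := by
  have hA : A = ∑ i, A i • (EuclideanSpace.single i 1 : EuclideanSpace ℝ ι) := by
    simpa using ((EuclideanSpace.basisFun ι ℝ).sum_repr A).symm
  conv_lhs => rw [hA]
  refine (norm_sum_le _ _).trans (Finset.sum_le_sum fun i _ => ?_)
  rw [norm_smul, norm_single_one, mul_one, Real.norm_eq_abs]

/-- The tangent inequality with step `h = ±(‖ξ‖ + β)` bounds each partial derivative by values of
`W` at points of comparable size, divided by `‖ξ‖ + β`. -/
theorem norm_partialXi_le {n : ℕ} {W : Vec n → Mat n → ℝ} {x : Vec n}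
    (hd : Differentiable ℝ (W x)) (hq : IsQuasiconvex (W x)) {p C : ℝ} {β : ℝ} (hβ : 0 < β)
    (hW : ∀ ξ, |W x ξ| ≤ C * (‖ξ‖ + β) ^ p) (hp : 0 ≤ p) (hC : 0 ≤ C) (ξ : Mat n) :
    ‖partialXi W x ξ‖ ≤ (n * n : ℕ) * (C * (2 ^ p + 1)) * (‖ξ‖ + β) ^ (p - 1) := by
  set ρ := ‖ξ‖ + β
  have hρ : 0 < ρ := by positivity
  have h5 : ρ ^ (p - 1) * ρ = ρ ^ p := by
    rw [← Real.rpow_add_one hρ.ne', sub_add_cancel]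
  have hkey : ∀ (ij : Fin n × Fin n) (h : ℝ), |h| = ρ →
      h * partialXi W x ξ ij ≤ C * (2 ^ p + 1) * ρ ^ (p - 1) * ρ := by
    intro ij h hh
    have h2 := hq.fderiv_le hd ξ ij.1 ij.2 h
    rw [← partialXi_apply hd] at h2
    have hn : ‖ξ + h • (EuclideanSpace.single ij 1 : Mat n)‖ + β ≤ 2 * ρ := by
      have := norm_add_le ξ (h • (EuclideanSpace.single ij 1 : Mat n))
      rw [norm_smul, norm_single_one, mul_one, Real.norm_eq_abs, hh] at this
      linarith
    have h3 := (le_abs_self _).trans ((hW (ξ + h • EuclideanSpace.single ij 1)).trans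
      (mul_le_mul_of_nonneg_left (Real.rpow_le_rpow (by positivity) hn hp) hC))
    have h4 := (neg_le_neg (hW ξ)).trans (neg_abs_le (W x ξ))
    rw [Real.mul_rpow zero_le_two hρ.le] at h3
    rw [mul_assoc, h5]
    have h6 : C * (2 ^ p + 1) * ρ ^ p = C * (2 ^ p * ρ ^ p) + C * ρ ^ p := by ring
    change -(C * ρ ^ p) ≤ W x ξ at h4
    change h * partialXi W x ξ ij ≤ W x (ξ + h • EuclideanSpace.single ij 1) - W x ξ at h2
    linarith
  have h1 : ∀ ij : Fin n × Fin n, |partialXi W x ξ ij| ≤ C * (2 ^ p + 1) * ρ ^ (p - 1) := by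
    intro ij
    refine abs_le'.2 ⟨?_, ?_⟩
    · refine le_of_mul_le_mul_right ?_ hρ
      have := hkey ij ρ (abs_of_pos hρ)
      linarith
    · refine le_of_mul_le_mul_right ?_ hρ
      have := hkey ij (-ρ) (by rw [abs_neg, abs_of_pos hρ])
      linarith
  refine (norm_le_sum_abs _).trans ((Finset.sum_le_sum fun ij _ => h1 ij).trans_eq ?_)
  simp
  ring

/-! ### Superposition operators -/

/-- The Carathéodory argument: clear for simple `ζ`, then by pointwise approximation and continuity
of `f x`. -/
theorem aestronglyMeasurable_superposition {α V F : Type*} [MeasurableSpace α]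
    {μ : Measure α} [NormedAddCommGroup V] [NormedAddCommGroup F]
    {f : α → V → F} (hf : ∀ ξ, AEStronglyMeasurable (fun x => f x ξ) μ)
    (hc : ∀ᵐ x ∂μ, Continuous (f x)) {ζ : α → V} (hζ : AEStronglyMeasurable ζ μ) :
    AEStronglyMeasurable (fun x => f x (ζ x)) μ := by
  let s := hζ.stronglyMeasurable_mk.approx
  have hs : ∀ m, AEStronglyMeasurable (fun x => f x (s m x)) μ := by
    intro m
    have heq : (fun x => f x (s m x)) = fun x => ∑ y ∈ (s m).range,
        (s m ⁻¹' {y}).indicator (fun x => f x y) x := by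
      funext x
      rw [Finset.sum_eq_single (s m x)]
      · simp
      · intro y _ hy
        exact Set.indicator_of_notMem (fun h => hy (by simpa using h.symm)) _
      · intro h
        exact absurd (SimpleFunc.mem_range_self (s m) x) h
    rw [heq]
    exact Finset.aestronglyMeasurable_fun_sum _ fun y _ =>
      (hf y).indicator ((s m).measurableSet_fiber y)
  refine aestronglyMeasurable_of_tendsto_ae atTop hs ?_
  filter_upwards [hc, hζ.ae_eq_mk] with x hx hxζ
  rw [hxζ]
  exact (hx.tendsto _).comp (hζ.stronglyMeasurable_mk.tendsto_approx x)

theorem IsBulkEnergy.aestronglyMeasurable {n : ℕ} {p : ℝ} {Ω : Set (Vec n)}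
    {W : Vec n → Mat n → ℝ} (hW : IsBulkEnergy p Ω W) {ζ : Vec n → Mat n}
    (hζ : AEStronglyMeasurable ζ (volume.restrict Ω)) :
    AEStronglyMeasurable (fun x => W x (ζ x)) (volume.restrict Ω) :=
  aestronglyMeasurable_superposition (fun ξ => (hW.aemeasurable ξ).aestronglyMeasurable)
    (hW.differentiable.mono fun _ h => h.continuous) hζ

theorem IsBulkEnergy.aestronglyMeasurable_partialXi {n : ℕ} {p : ℝ} {Ω : Set (Vec n)}
    {W : Vec n → Mat n → ℝ} (hW : IsBulkEnergy p Ω W) {ζ : Vec n → Mat n}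
    (hζ : AEStronglyMeasurable ζ (volume.restrict Ω)) :
    AEStronglyMeasurable (fun x => partialXi W x (ζ x)) (volume.restrict Ω) := by
  refine aestronglyMeasurable_superposition (fun ξ => ?_) ?_ hζ
  · have hcomp : ∀ ij : Fin n × Fin n, AEMeasurable (fun x => partialXi W x ξ ij)
        (volume.restrict Ω) := by
      intro ij
      let e : Mat n := EuclideanSpace.single ij 1
      let t : ℕ → ℝ := fun m => (1 / 2 : ℝ) ^ m
      have ht : Tendsto t atTop (𝓝[≠] 0) :=
        tendsto_nhdsWithin_iff.2 ⟨tendsto_pow_atTop_nhds_zero_of_lt_one (by norm_num)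
          (by norm_num), Eventually.of_forall fun m => by simp [t]⟩
      refine aemeasurable_of_tendsto_metrizable_ae (u := atTop)
        (f := fun m x => (t m)⁻¹ * (W x (ξ + t m • e) - W x ξ)) (fun m => ?_) ?_
      · exact ((hW.aemeasurable _).sub (hW.aemeasurable _)).const_mul _
      · filter_upwards [hW.differentiable] with x hx
        rw [partialXi_apply hx]
        exact ((hx ξ).hasFDerivAt.hasLineDerivAt e).tendsto_slope_zero.comp ht
    have h := ((WithLp.measurable_toLp 2 (Fin n × Fin n → ℝ)).comp_aemeasurable
      (aemeasurable_pi_iff.2 hcomp))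
    exact h.aestronglyMeasurable
  · filter_upwards [hW.differentiable, hW.isQuasiconvex] with x hd hq
      using continuous_partialXi hd hq

/-! ### Growth bounds with an `L^p` weight -/

/-- A weight absorbing the `x`-dependence of the growth conditions: `W` has growth of order `p`
and its gradient growth of order `p - 1` in `‖ξ‖ + β x`, with `β ∈ L^p`. -/
structure IsGrowthWeight {n : ℕ} (p : ℝ) (Ω : Set (Vec n)) (W : Vec n → Mat n → ℝ) (C : ℝ)
    (β : Vec n → ℝ) : Prop where
  const_nonneg : 0 ≤ C
  pos : ∀ x, 0 < β x
  memLp : MemLp β (ENNReal.ofReal p) (volume.restrict Ω)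
  abs_le : ∀ᵐ x ∂volume.restrict Ω, ∀ ξ, |W x ξ| ≤ C * (‖ξ‖ + β x) ^ p
  neg_le : ∀ᵐ x ∂volume.restrict Ω, ∀ ξ, -(C * β x ^ p) ≤ W x ξ
  norm_partialXi_le : ∀ᵐ x ∂volume.restrict Ω, ∀ ξ,
    ‖partialXi W x ξ‖ ≤ C * (‖ξ‖ + β x) ^ (p - 1)

theorem memLp_ofReal_iff_integrable_rpow {α F : Type*} [MeasurableSpace α] {μ : Measure α}
    [NormedAddCommGroup F] {f : α → F} (hf : AEStronglyMeasurable f μ) {p : ℝ} (hp : 0 < p) :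
    MemLp f (ENNReal.ofReal p) μ ↔ Integrable (fun x => ‖f x‖ ^ p) μ := by
  have := integrable_norm_rpow_iff hf (p := ENNReal.ofReal p) (by simpa using hp)
    ENNReal.ofReal_ne_top
  rw [ENNReal.toReal_ofReal hp.le] at this
  exact this.symm

theorem IsBulkEnergy.exists_isGrowthWeight {n : ℕ} {p : ℝ} (hp : 1 < p) {Ω : Set (Vec n)}
    (hΩ : volume Ω ≠ ⊤) {W : Vec n → Mat n → ℝ} (hW : IsBulkEnergy p Ω W) :
    ∃ C β, IsGrowthWeight p Ω W C β := by
  obtain ⟨a₀, a₁, b₀, b₁, ha₀, hb₀, hb₁, hb⟩ := hW.growth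
  have : IsFiniteMeasure (volume.restrict Ω) := ⟨by simpa using hΩ.lt_top⟩
  have hp0 : 0 < p := by linarith
  -- The summand `1` keeps the weight `β = B^(1/p)` strictly positive.
  let B : Vec n → ℝ := fun x => 1 + |b₀ x| + |b₁ x|
  have hB : ∀ x, 0 < B x := fun x => by positivity
  have hBint : Integrable B (volume.restrict Ω) :=
    ((integrable_const 1).add hb₀.abs).add hb₁.abs
  let β : Vec n → ℝ := fun x => B x ^ (1 / p)
  have hβ : ∀ x, 0 < β x := fun x => Real.rpow_pos_of_pos (hB x) _
  have hβB : ∀ x, β x ^ p = B x := fun x => by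
    rw [← Real.rpow_mul (hB x).le, one_div_mul_cancel hp0.ne', Real.rpow_one]
  have hβm : AEStronglyMeasurable β (volume.restrict Ω) :=
    (hBint.aemeasurable.pow_const _).aestronglyMeasurable
  have habs : ∀ᵐ x ∂volume.restrict Ω, ∀ ξ, |W x ξ| ≤ (|a₁| + 1) * (‖ξ‖ + β x) ^ p := by
    filter_upwards [hb] with x hx ξ
    have h1 : ‖ξ‖ ^ p ≤ (‖ξ‖ + β x) ^ p :=
      Real.rpow_le_rpow (norm_nonneg _) (by linarith [hβ x]) hp0.le
    have h2 : B x ≤ (‖ξ‖ + β x) ^ p := by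
      rw [← hβB]
      exact Real.rpow_le_rpow (hβ x).le (by linarith [norm_nonneg ξ]) hp0.le
    have h3 : a₁ * ‖ξ‖ ^ p ≤ |a₁| * (‖ξ‖ + β x) ^ p :=
      (mul_le_mul_of_nonneg_right (le_abs_self _) (by positivity)).trans
        (mul_le_mul_of_nonneg_left h1 (abs_nonneg _))
    have h4 : 0 ≤ a₀ * ‖ξ‖ ^ p := by positivity
    have h5 : 0 ≤ |a₁| * (‖ξ‖ + β x) ^ p := by have := hβ x; positivity
    have h6 : B x = 1 + |b₀ x| + |b₁ x| := rfl
    have h7 := le_abs_self (b₀ x)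
    have h8 := le_abs_self (b₁ x)
    have h9 := abs_nonneg (b₀ x)
    have h10 := abs_nonneg (b₁ x)
    obtain ⟨l, u⟩ := hx ξ
    refine abs_le.2 ⟨?_, ?_⟩ <;> linarith
  refine ⟨(n * n : ℕ) * ((|a₁| + 1) * (2 ^ p + 1)) + (|a₁| + 1), β, by positivity, hβ, ?_, ?_, ?_,
    ?_⟩
  · rw [memLp_ofReal_iff_integrable_rpow hβm hp0]
    refine hBint.congr (ae_of_all _ fun x => ?_)
    simp only [Real.norm_of_nonneg (hβ x).le, hβB]
  · filter_upwards [habs] with x hx ξ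
    refine (hx ξ).trans (mul_le_mul_of_nonneg_right ?_ ?_)
    · exact le_add_of_nonneg_left (by positivity)
    · have := hβ x; positivity
  · filter_upwards [hb] with x hx ξ
    have h4 : 0 ≤ a₀ * ‖ξ‖ ^ p := by positivity
    have h7 := le_abs_self (b₀ x)
    have h10 := abs_nonneg (b₁ x)
    rw [hβB]
    have h1 : 1 * B x ≤ ((n * n : ℕ) * ((|a₁| + 1) * (2 ^ p + 1)) + (|a₁| + 1)) * B x := by
      refine mul_le_mul_of_nonneg_right ?_ (hB x).le
      have : 0 ≤ ((n * n : ℕ) : ℝ) * ((|a₁| + 1) * (2 ^ p + 1)) := by positivity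
      linarith [abs_nonneg a₁]
    have h6 : B x = 1 + |b₀ x| + |b₁ x| := rfl
    linarith [(hx ξ).1]
  · filter_upwards [habs, hW.differentiable, hW.isQuasiconvex] with x hx hd hq ξ
    refine (_root_.norm_partialXi_le hd hq (hβ x) hx hp0.le (by positivity) ξ).trans
      (mul_le_mul_of_nonneg_right ?_ ?_)
    · exact le_add_of_nonneg_right (by positivity)
    · have := hβ x; positivity

theorem IsGrowthWeight.integrable_rpow {n : ℕ} {p : ℝ} (hp : 1 < p) {Ω : Set (Vec n)}
    {W : Vec n → Mat n → ℝ} {C : ℝ} {β : Vec n → ℝ} (hβ : IsGrowthWeight p Ω W C β)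
    {F : Type*} [NormedAddCommGroup F] {ζ : Vec n → F}
    (hζ : MemLp ζ (ENNReal.ofReal p) (volume.restrict Ω)) :
    Integrable (fun x => (‖ζ x‖ + β x) ^ p) (volume.restrict Ω) := by
  have h := hζ.norm.add hβ.memLp
  rw [memLp_ofReal_iff_integrable_rpow h.1 (by linarith)] at h
  refine h.congr (ae_of_all _ fun x => ?_)
  have := hβ.pos x
  simp only [Pi.add_apply]
  rw [Real.norm_of_nonneg (by positivity)]

theorem IsBulkEnergy.integrable {n : ℕ} {p : ℝ} (hp : 1 < p) {Ω : Set (Vec n)}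
    {W : Vec n → Mat n → ℝ} (hW : IsBulkEnergy p Ω W) {C : ℝ} {β : Vec n → ℝ}
    (hβ : IsGrowthWeight p Ω W C β) {ζ : Vec n → Mat n}
    (hζ : MemLp ζ (ENNReal.ofReal p) (volume.restrict Ω)) :
    Integrable (fun x => W x (ζ x)) (volume.restrict Ω) := by
  refine ((hβ.integrable_rpow hp hζ).const_mul C).mono' (hW.aestronglyMeasurable hζ.1) ?_
  filter_upwards [hβ.abs_le] with x hx using hx _

theorem IsBulkEnergy.memLp_partialXi {n : ℕ} {p : ℝ} (hp : 1 < p) {Ω : Set (Vec n)}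
    {W : Vec n → Mat n → ℝ} (hW : IsBulkEnergy p Ω W) {C : ℝ} {β : Vec n → ℝ}
    (hβ : IsGrowthWeight p Ω W C β) {ζ : Vec n → Mat n}
    (hζ : MemLp ζ (ENNReal.ofReal p) (volume.restrict Ω)) :
    MemLp (fun x => partialXi W x (ζ x)) (ENNReal.ofReal (p / (p - 1)))
      (volume.restrict Ω) := by
  have hp1 : 0 < p - 1 := by linarith
  have hm := hW.aestronglyMeasurable_partialXi hζ.1
  rw [memLp_ofReal_iff_integrable_rpow hm (by positivity)]
  refine ((hβ.integrable_rpow hp hζ).const_mul (C ^ (p / (p - 1)))).mono'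
    (hm.norm.aemeasurable.pow_const _).aestronglyMeasurable ?_
  filter_upwards [hβ.norm_partialXi_le] with x hx
  have h0 : 0 < ‖ζ x‖ + β x := by have := hβ.pos x; positivity
  rw [Real.norm_of_nonneg (by positivity)]
  calc ‖partialXi W x (ζ x)‖ ^ (p / (p - 1))
      ≤ (C * (‖ζ x‖ + β x) ^ (p - 1)) ^ (p / (p - 1)) :=
        Real.rpow_le_rpow (norm_nonneg _) (hx _) (by positivity)
    _ = C ^ (p / (p - 1)) * (‖ζ x‖ + β x) ^ p := by
        rw [Real.mul_rpow hβ.const_nonneg (by positivity), ← Real.rpow_mul h0.le,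
          mul_div_cancel₀ p hp1.ne']

/-! ### Continuity of translations in `L¹` -/

/-- This holds for values in any normed group; it is applied both to mollified functions and to maps
into `C(K, ℝ)`. -/
theorem MeasureTheory.Integrable.exists_translate_sub_le {n : ℕ} {F : Type*}
    [NormedAddCommGroup F] {f : Vec n → F} (hf : Integrable f) {ε : ℝ} (hε : 0 < ε) :
    ∃ r > 0, ∀ h : Vec n, ‖h‖ < r → ∫ x, ‖f (x + h) - f x‖ ≤ ε := by
  have : Fact ((1 : ENNReal) ≤ 1) := ⟨le_rfl⟩
  let τ : Vec n → C(Vec n, Vec n) := fun h => ⟨fun x => x + h, by fun_prop⟩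
  have hτ : Continuous τ :=
    ContinuousMap.continuous_of_continuous_uncurry _ 
      (show Continuous fun z : Vec n × Vec n => z.2 + z.1 by fun_prop)
  have hmp : ∀ h, MeasurePreserving (τ h) (volume : Measure (Vec n)) volume := fun h =>
    measurePreserving_add_right volume h
  let f₁ : Lp F 1 (volume : Measure (Vec n)) := hf.toL1 f
  have hcont : Continuous fun h => Lp.compMeasurePreserving (τ h) (hmp h) f₁ :=
    Continuous.compMeasurePreservingLp (continuous_const) hτ hmp ENNReal.one_ne_top
  have hnorm : ∀ h, ‖Lp.compMeasurePreserving (τ h) (hmp h) f₁ - f₁‖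
      = ∫ x, ‖f (x + h) - f x‖ := by
    intro h
    rw [L1.norm_eq_integral_norm]
    refine integral_congr_ae ?_
    filter_upwards [Lp.coeFn_sub (Lp.compMeasurePreserving (τ h) (hmp h) f₁) f₁,
      Lp.coeFn_compMeasurePreserving f₁ (hmp h), hf.coeFn_toL1,
      (hmp h).quasiMeasurePreserving.ae hf.coeFn_toL1] with x h1 h2 h3 h4
    rw [h1, Pi.sub_apply, h2, Function.comp_apply, h3]
    exact congrArg (fun y => ‖y - f x‖) h4
  have h0 : Lp.compMeasurePreserving (τ 0) (hmp 0) f₁ = f₁ := by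
    rw [← sub_eq_zero, ← norm_eq_zero, hnorm]
    simp
  have hlim : ∀ᶠ h in 𝓝 (0 : Vec n),
      ‖Lp.compMeasurePreserving (τ h) (hmp h) f₁ - f₁‖ < ε := by
    have hc : Continuous fun h => ‖Lp.compMeasurePreserving (τ h) (hmp h) f₁ - f₁‖ :=
      (hcont.sub continuous_const).norm
    exact hc.continuousAt.eventually_lt_const (by
      show ‖Lp.compMeasurePreserving (τ 0) (hmp 0) f₁ - f₁‖ < ε
      rw [h0]; simpa using hε)
  obtain ⟨r, hr, H⟩ := Metric.eventually_nhds_iff.1 hlim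
  exact ⟨r, hr, fun h hh => by rw [← hnorm]; exact (H (by simpa using hh)).le⟩

theorem MeasureTheory.IntegrableOn.indicator_of_normed {α F : Type*} [MeasurableSpace α]
    {μ : Measure α} [NormedAddCommGroup F] {s : Set α} {f : α → F} (hf : IntegrableOn f s μ)
    (hs : MeasurableSet s) : Integrable (s.indicator f) μ :=
  hf.integrable_indicator hs

/-! ### Measurability of maps into spaces of continuous functions -/

/-- Evaluation on a countable dense subset of `K` is a continuous injection of the Polish space
`C(K, ℝ)` into a countable product, hence a measurable embedding, so measurability can be checked
coordinatewise. -/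
theorem aestronglyMeasurable_mkD {α K : Type*} [MeasurableSpace α] {μ : Measure α}
    [MetricSpace K] [CompactSpace K] {f : α → K → ℝ}
    (hf : ∀ y, AEMeasurable (fun x => f x y) μ) (hc : ∀ᵐ x ∂μ, Continuous (f x)) :
    AEStronglyMeasurable (fun x => ContinuousMap.mkD (f x) (0 : C(K, ℝ))) μ := by
  borelize C(K, ℝ)
  obtain ⟨D, hD, hDd⟩ := TopologicalSpace.exists_countable_dense K
  have : Countable D := hD.to_subtype
  let ρ : C(K, ℝ) → D → ℝ := fun g d => g d
  have hρ : Continuous ρ := continuous_pi fun d => continuous_eval_const (d : K)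
  have hinj : Function.Injective ρ := fun g g' h =>
    DFunLike.coe_injective (Continuous.ext_on hDd g.continuous g'.continuous
      fun d hd => congrFun h ⟨d, hd⟩)
  have hemb : MeasurableEmbedding ρ := hρ.measurableEmbedding hinj
  refine AEMeasurable.aestronglyMeasurable ?_
  refine hemb.aemeasurable_comp_iff.1 (aemeasurable_pi_iff.2 fun d => ?_)
  refine (hf d).congr ?_
  filter_upwards [hc] with x hx
  simp [ρ, ContinuousMap.mkD_apply_of_continuous hx]

/-! ### Lower semicontinuity along smooth equi-Lipschitz perturbations -/

/-- After Fubini and a change of variables, replacing `Φ x` by `Φ (x + h)` costs at most the `L¹`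
modulus of continuity of `Φ`, uniformly in `E` because the norm of `C(K, ℝ)` is the sup norm. -/
theorem integral_pairing_translate_le {n : ℕ} {K : Type*} [MetricSpace K] [CompactSpace K]
    {Φ : Vec n → C(K, ℝ)} (hΦ : Integrable Φ) {E : Vec n → K} (hE : Continuous E) {r ε : ℝ}
    (hr : ∀ h : Vec n, ‖h‖ < r → ∫ x, ‖Φ (x + h) - Φ x‖ ≤ ε) :
    Integrable (fun x => ∫ h in Metric.ball (0 : Vec n) r, Φ x (E (x + h))) ∧
    (∫ x, ∫ h in Metric.ball (0 : Vec n) r, Φ x (E (x + h)))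
      ≤ volume.real (Metric.ball (0 : Vec n) r) * ((∫ x, Φ x (E x)) + ε) := by
  set B := Metric.ball (0 : Vec n) r
  have hBfin : volume B ≠ ⊤ := measure_ball_lt_top.ne
  have : IsFiniteMeasure (volume.restrict B) := ⟨by simpa using hBfin.lt_top⟩
  have heval : Continuous fun z : C(K, ℝ) × K => z.1 z.2 := continuous_eval
  have hint : ∀ {F : Vec n → K}, Continuous F → Integrable fun x => Φ x (F x) := fun hF =>
    hΦ.norm.mono' (heval.comp_aestronglyMeasurable (hΦ.1.prodMk hF.aestronglyMeasurable))
      (ae_of_all _ fun x => (Φ x).norm_coe_le_norm _)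
  have hprod : Integrable (Function.uncurry fun x h => Φ x (E (x + h)))
      (volume.prod (volume.restrict B)) := by
    refine (hΦ.norm.comp_fst (volume.restrict B)).mono'
      (heval.comp_aestronglyMeasurable (hΦ.1.comp_fst.prodMk
        (Continuous.aestronglyMeasurable ?_))) (ae_of_all _ fun z => (Φ z.1).norm_coe_le_norm _)
    exact hE.comp (continuous_fst.add continuous_snd)
  refine ⟨hprod.integral_prod_left, ?_⟩
  rw [integral_integral_swap hprod]
  have hb : ∀ h ∈ B, ∫ x, Φ x (E (x + h)) ≤ (∫ x, Φ x (E x)) + ε := by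
    intro h hh
    have h1 : ∫ x, Φ x (E x) = ∫ x, Φ (x + h) (E (x + h)) :=
      (integral_add_right_eq_self (fun x => Φ x (E x)) h).symm
    have hE' : Continuous fun x => E (x + h) := by fun_prop
    have i1 := hint hE'
    have i2 : Integrable fun x => Φ (x + h) (E (x + h)) := (hint hE).comp_add_right h
    have h2 : (∫ x, Φ x (E (x + h))) - ∫ x, Φ (x + h) (E (x + h)) ≤ ε := by
      rw [← integral_sub i1 i2]
      refine le_trans (integral_mono (i1.sub i2) ((hΦ.comp_add_right h).sub hΦ).norm fun x => ?_)
        (hr h (by simpa [B] using hh))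
      have := (Φ (x + h) - Φ x).norm_coe_le_norm (E (x + h))
      rw [ContinuousMap.sub_apply, Real.norm_eq_abs] at this
      have := (abs_le.1 this).1
      simp only [Pi.sub_apply]
      linarith
    linarith
  calc ∫ h in B, ∫ x, Φ x (E (x + h)) ≤ ∫ _ in B, ((∫ x, Φ x (E x)) + ε) :=
        setIntegral_mono_on hprod.integral_prod_right (integrableOn_const hBfin)
          Metric.isOpen_ball.measurableSet hb
    _ = _ := by rw [setIntegral_const, smul_eq_mul]

/-- For fixed `x`, the average of the frozen density `W(x, ζ x + ·)` over the gradients in a ball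
around `x` is asymptotically at least `W(x, ζ x)` by quasiconvexity. Integrating in `x` and undoing
the translations recovers the energy. Neither continuity in `x` nor a gradient structure of `ζ` is
needed. -/
theorem IsBulkEnergy.eventually_le_integral_add_jacobian {n : ℕ} {p : ℝ} (hp : 1 < p)
    {Ω : Set (Vec n)} (hΩ : MeasurableSet Ω) (hΩf : volume Ω ≠ ⊤)
    {W : Vec n → Mat n → ℝ} (hW : IsBulkEnergy p Ω W) {C : ℝ} {β : Vec n → ℝ}
    (hβ : IsGrowthWeight p Ω W C β) {ζ : Vec n → Mat n}
    (hζ : MemLp ζ (ENNReal.ofReal p) (volume.restrict Ω)) {lam : ℝ} {g : ℕ → Vec n → Vec n}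
    (hg : ∀ m, ContDiff ℝ ∞ (g m)) (hlam : ∀ m x, ‖jacobian (g m) x‖ ≤ lam) {s : ℕ → ℝ}
    (hs : Tendsto s atTop (𝓝 0)) (hgs : ∀ m x, ‖g m x‖ ≤ s m) {ε : ℝ} (hε : 0 < ε) :
    ∀ᶠ m in atTop, (∫ x in Ω, W x (ζ x)) - ε ≤ ∫ x in Ω, W x (ζ x + jacobian (g m) x) := by
  have : IsFiniteMeasure (volume.restrict Ω) := ⟨by simpa using hΩf.lt_top⟩
  have hlam0 : 0 ≤ lam := (norm_nonneg _).trans (hlam 0 0)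
  let K := Metric.closedBall (0 : Mat n) lam
  have : CompactSpace K := isCompact_iff_compactSpace.1 (isCompact_closedBall _ _)
  let Ψ : Vec n → C(K, ℝ) := fun x => ContinuousMap.mkD (fun η : K => W x (ζ x + η)) 0
  let Φ : Vec n → C(K, ℝ) := Ω.indicator Ψ
  have hWc : ∀ᵐ x ∂volume.restrict Ω, Continuous fun η : K => W x (ζ x + η) := by
    filter_upwards [hW.differentiable] with x hx
    have := hx.continuous
    fun_prop
  have hΨ : IntegrableOn Ψ Ω := by
    refine ⟨aestronglyMeasurable_mkD (fun η => ?_) hWc, ?_⟩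
    · exact (hW.aestronglyMeasurable (hζ.1.add_const _)).aemeasurable
    · have hadd : MemLp (fun x => ‖ζ x‖ + lam) (ENNReal.ofReal p) (volume.restrict Ω) :=
        hζ.norm.add (memLp_const lam)
      refine ContinuousMap.hasFiniteIntegral_mkD_of_bound _ _ hWc _
        ((hβ.integrable_rpow hp hadd).const_mul C).2 ?_
      filter_upwards [hβ.abs_le] with x hx η
      refine (hx _).trans (mul_le_mul_of_nonneg_left (Real.rpow_le_rpow ?_ ?_ ?_)
        hβ.const_nonneg)
      · have := hβ.pos x; positivity
      · have h1 := norm_add_le (ζ x) (η : Mat n)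
        have h2 : ‖(η : Mat n)‖ ≤ lam := mem_closedBall_zero_iff.1 η.2
        have h3 := le_abs_self (‖ζ x‖ + lam)
        rw [Real.norm_eq_abs]
        linarith
      · linarith
  have hΦ : Integrable Φ volume := hΨ.indicator_of_normed hΩ
  have hval : ∀ F : Vec n → K, ∫ x, Φ x (F x) = ∫ x in Ω, W x (ζ x + F x) := by
    intro F
    have h1 : (fun x => Φ x (F x)) = Ω.indicator fun x => Ψ x (F x) := by
      funext x
      by_cases hx : x ∈ Ω <;> simp [Φ, hx]
    rw [h1, integral_indicator hΩ]
    refine integral_congr_ae ?_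
    filter_upwards [hWc] with x hx
    simp [Ψ, ContinuousMap.mkD_apply_of_continuous hx]
  let E : ℕ → Vec n → K := fun m x => ⟨jacobian (g m) x, by simpa [K] using hlam m x⟩
  have hE : ∀ m, Continuous (E m) := fun m => (hg m).continuous_jacobian.subtype_mk _
  let z : K := ⟨0, by simpa [K] using hlam0⟩
  obtain ⟨r, hr, hr'⟩ := hΦ.exists_translate_sub_le (half_pos hε)
  set B := Metric.ball (0 : Vec n) r with hB
  have hV : 0 < volume.real B :=
    ENNReal.toReal_pos (Metric.measure_ball_pos volume 0 hr).ne' measure_ball_lt_top.ne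
  let A : ℕ → Vec n → ℝ := fun m x => ∫ h in B, Φ x (E m (x + h))
  have hA := fun m => integral_pairing_translate_le hΦ (hE m) hr'
  have hAb : ∀ m x, |A m x| ≤ volume.real B * ‖Φ x‖ := by
    intro m x
    have := norm_setIntegral_le_of_norm_le_const (μ := volume) (s := B)
      (f := fun h => Φ x (E m (x + h))) measure_ball_lt_top
      (fun h _ => (Φ x).norm_coe_le_norm _)
    rwa [mul_comm]
  have hz : Integrable fun x => Φ x z :=
    (ContinuousMap.evalCLM ℝ z).integrable_comp hΦ
  -- Only the deficit in the quasiconvexity inequality has to vanish; it is dominated by `2|B|‖Φ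
  -- x‖`.
  let d : ℕ → Vec n → ℝ := fun m x => max (volume.real B * Φ x z - A m x) 0
  have hdi : ∀ m, Integrable (d m) := fun m => ((hz.const_mul _).sub (hA m).1).pos_part
  have hpt : ∀ᵐ x, Tendsto (fun m => d m x) atTop (𝓝 0) := by
    have h1 := (ae_restrict_iff' hΩ).1 (hW.differentiable.and hW.isQuasiconvex)
    filter_upwards [h1] with x hx
    by_cases hxΩ : x ∈ Ω
    · obtain ⟨hd, hq⟩ := hx hxΩ
      have hΦx : ∀ η : K, Φ x η = W x (ζ x + η) := fun η => by
        have : Continuous fun η : K => W x (ζ x + η) := by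
          have := hd.continuous
          fun_prop
        simp [Φ, Ψ, hxΩ, ContinuousMap.mkD_apply_of_continuous this]
      refine Metric.tendsto_nhds.2 fun δ hδ => ?_
      obtain ⟨t, ht, H⟩ := hq.le_integral_ball hd.continuous (ζ x) lam hr (half_pos hδ)
      filter_upwards [hs.eventually_le_const ht] with m hm
      have h2 := H (fun y => g m (x + y)) ((hg m).comp (contDiff_const.add contDiff_id))
        (fun y => by rw [jacobian_comp_add_left]; exact hlam m _)
        (fun y => (hgs m _).trans hm)
      simp only [jacobian_comp_add_left] at h2
      have h3 : A m x = ∫ y in B, W x (ζ x + jacobian (g m) (x + y)) := by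
        simp only [A, hΦx, E]
      have h4 : Φ x z = W x (ζ x) := by simp [hΦx, z]
      rw [Real.dist_eq, sub_zero, abs_of_nonneg (le_max_right _ _)]
      refine max_lt ?_ hδ
      rw [h3, h4]
      linarith
    · have h2 : Φ x = 0 := by simp [Φ, hxΩ]
      simp [d, A, h2]
  have hlim : Tendsto (fun m => ∫ x, d m x) atTop (𝓝 0) := by
    have := tendsto_integral_of_dominated_convergence
      (fun x => 2 * (volume.real B * ‖Φ x‖)) (fun m => (hdi m).1)
      ((hΦ.norm.const_mul _).const_mul _) (fun m => ae_of_all _ fun x => ?_) hpt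
    · simpa using this
    · rw [Real.norm_of_nonneg (le_max_right _ _)]
      refine max_le ?_ (by positivity)
      have h1 := (abs_le.1 (hAb m x)).1
      have h2 : volume.real B * Φ x z ≤ volume.real B * ‖Φ x‖ :=
        mul_le_mul_of_nonneg_left ((le_abs_self _).trans ((Φ x).norm_coe_le_norm z)) hV.le
      linarith
  filter_upwards [hlim.eventually_lt_const (show 0 < volume.real B * (ε / 2) by positivity)]
    with m hm
  have h1 : volume.real B * (∫ x, Φ x z) - ∫ x, A m x ≤ ∫ x, d m x := by
    rw [← integral_const_mul, ← integral_sub (hz.const_mul _) (hA m).1]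
    exact integral_mono ((hz.const_mul _).sub (hA m).1) (hdi m) fun x => le_max_left _ _
  have h2 := (hA m).2
  have h3 : ∫ x, Φ x z = ∫ x in Ω, W x (ζ x) := by
    rw [hval fun _ => z]
    simp [z]
  rw [hval (E m)] at h2
  rw [h3] at h1
  have h4 : volume.real B * (∫ x in Ω, W x (ζ x))
      ≤ volume.real B * ((∫ x in Ω, W x (ζ x + jacobian (g m) x)) + ε) := by
    change (∫ x, A m x) ≤ volume.real B * ((∫ x in Ω, W x (ζ x + jacobian (g m) x)) + ε / 2) at h2
    have : volume.real B * ((∫ x in Ω, W x (ζ x + jacobian (g m) x)) + ε)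
      = volume.real B * ((∫ x in Ω, W x (ζ x + jacobian (g m) x)) + ε / 2)
        + volume.real B * (ε / 2) := by ring
    linarith
  linarith [le_of_mul_le_mul_left h4 hV]

/-! ### A weak-type inequality for the maximal function -/

/-- Vitali covering: disjoint balls on which the average of `h` exceeds `a`, enlarged five times,
cover the set. -/
theorem volume_exists_average_gt_le {n : ℕ} (h : Vec n → ENNReal) (a : ENNReal) (R : ℝ) :
    a * volume {x : Vec n | ∃ ρ, 0 < ρ ∧ ρ ≤ R ∧
      a * volume (Metric.ball x ρ) < ∫⁻ y in Metric.ball x ρ, h y} ≤ 5 ^ n * ∫⁻ y, h y := by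
  set S := {x : Vec n | ∃ ρ, 0 < ρ ∧ ρ ≤ R ∧
      a * volume (Metric.ball x ρ) < ∫⁻ y in Metric.ball x ρ, h y} with hS
  have hex : ∀ x, ∃ ρ, x ∈ S → 0 < ρ ∧ ρ ≤ R ∧
      a * volume (Metric.ball x ρ) < ∫⁻ y in Metric.ball x ρ, h y := fun x => by
    by_cases hx : x ∈ S
    · obtain ⟨ρ, hρ⟩ := hx
      exact ⟨ρ, fun _ => hρ⟩
    · exact ⟨0, fun h => absurd h hx⟩
  choose ρ hρ using hex
  obtain ⟨u, huS, hdisj, hcov⟩ := Vitali.exists_disjoint_subfamily_covering_enlargement_ball S id ρ R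
    (fun x hx => (hρ x hx).2.1) 5 (by norm_num)
  have hu : u.Countable := hdisj.countable_of_isOpen (fun _ _ => Metric.isOpen_ball)
    fun x hx => Metric.nonempty_ball.2 (hρ x (huS hx)).1
  have hsub : S ⊆ ⋃ b ∈ u, Metric.ball b (5 * ρ b) := by
    intro x hx
    obtain ⟨b, hb, hxb⟩ := hcov x hx
    exact Set.mem_biUnion hb (hxb (Metric.mem_ball_self (hρ x hx).1))
  have := hu.to_subtype
  calc a * volume S ≤ a * ∑' b : u, volume (Metric.ball (b : Vec n) (5 * ρ b)) := by
        gcongr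
        exact (measure_mono hsub).trans (measure_biUnion_le _ hu _)
    _ = ∑' b : u, 5 ^ n * (a * volume (Metric.ball (b : Vec n) (ρ b))) := by
        rw [← ENNReal.tsum_mul_left]
        refine tsum_congr fun b => ?_
        rw [Measure.addHaar_ball_mul_of_pos volume (b : Vec n) (by norm_num : (0 : ℝ) < 5),
          Measure.addHaar_ball_center volume (b : Vec n) (ρ b), finrank_euclideanSpace_fin,
          ENNReal.ofReal_pow (by norm_num), ENNReal.ofReal_ofNat]
        ring
    _ ≤ ∑' b : u, 5 ^ n * ∫⁻ y in Metric.ball (b : Vec n) (ρ b), h y :=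
        ENNReal.tsum_le_tsum fun b => by
          gcongr
          exact (hρ b (huS b.2)).2.2.le
    _ = 5 ^ n * ∫⁻ y in ⋃ b ∈ u, Metric.ball b (ρ b), h y := by
        rw [ENNReal.tsum_mul_left, ← lintegral_biUnion (t := u) (s := fun b => Metric.ball b (ρ b))
          hu (fun b _ => Metric.isOpen_ball.measurableSet) hdisj]
    _ ≤ 5 ^ n * ∫⁻ y, h y := by
        gcongr
        exact Measure.restrict_le_self

/-- If the average of `‖G‖` exceeds `2a`, then that of `(‖G‖ - a)⁺` exceeds `a`. Keeping only this
excess on the right is what allows a gain by choice of level. -/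
theorem volume_exists_average_norm_gt_le {n : ℕ} {F : Type*} [NormedAddCommGroup F]
    (G : Vec n → F) {a : ℝ} (ha : 0 < a) (R : ℝ) :
    ENNReal.ofReal a * volume {x : Vec n | ∃ ρ, 0 < ρ ∧ ρ ≤ R ∧
      ENNReal.ofReal (2 * a) * volume (Metric.ball x ρ) < ∫⁻ y in Metric.ball x ρ, ‖G y‖ₑ}
      ≤ 5 ^ n * ∫⁻ y, ENNReal.ofReal (‖G y‖ - a) := by
  refine le_trans ?_ (volume_exists_average_gt_le _ (ENNReal.ofReal a) R)
  refine mul_le_mul' le_rfl (measure_mono ?_)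
  rintro x ⟨ρ, hρ, hρR, hlt⟩
  refine ⟨ρ, hρ, hρR, ?_⟩
  have h1 : ∫⁻ y in Metric.ball x ρ, ‖G y‖ₑ
      ≤ (∫⁻ y in Metric.ball x ρ, ENNReal.ofReal (‖G y‖ - a))
        + ENNReal.ofReal a * volume (Metric.ball x ρ) := by
    rw [← setLIntegral_const, ← lintegral_add_right _ measurable_const]
    refine lintegral_mono fun y => ?_
    rw [← ofReal_norm]
    refine le_trans (ENNReal.ofReal_le_ofReal ?_) ENNReal.ofReal_add_le
    linarith
  have h2 := hlt.trans_le h1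
  rw [two_mul, ENNReal.ofReal_add ha.le ha.le, add_mul] at h2
  exact lt_of_add_lt_add_right h2

/-! ### Lipschitz estimates from averages of the derivative -/

theorem norm_sub_le_integral_fderiv {n : ℕ} {z : Vec n → Vec n} (hz : ContDiff ℝ 1 z)
    (x y : Vec n) :
    ‖z (x + y) - z x‖ ≤ ‖y‖ * ∫ t in Set.Ioc (0 : ℝ) 1, ‖fderiv ℝ z (x + t • y)‖ := by
  have hc := hz.continuous_fderiv one_ne_zero
  have hder : ∀ t ∈ Set.uIcc (0 : ℝ) 1,
      HasDerivAt (fun t : ℝ => z (x + t • y)) (fderiv ℝ z (x + t • y) y) t := by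
    intro t _
    have h1 : HasDerivAt (fun t : ℝ => x + t • y) y t := by
      simpa using ((hasDerivAt_id t).smul_const y).const_add x
    exact ((hz.differentiable one_ne_zero) _).hasFDerivAt.comp_hasDerivAt t h1
  have hcd : Continuous fun t : ℝ => fderiv ℝ z (x + t • y) y := by fun_prop
  have := intervalIntegral.integral_eq_sub_of_hasDerivAt hder (hcd.intervalIntegrable 0 1)
  simp only [one_smul, zero_smul, add_zero] at this
  rw [← this, intervalIntegral.integral_of_le zero_le_one, ← integral_const_mul]
  refine norm_integral_le_of_norm_le ?_ (ae_of_all _ fun t => ?_)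
  · have hcn : Continuous fun t : ℝ => ‖y‖ * ‖fderiv ℝ z (x + t • y)‖ := by fun_prop
    exact (hcn.continuousOn.integrableOn_compact isCompact_Icc).mono_set Set.Ioc_subset_Icc_self
  · rw [mul_comm]
    exact (fderiv ℝ z (x + t • y)).le_opNorm y

theorem setIntegral_ball_zero_add {n : ℕ} {F : Type*} [NormedAddCommGroup F] [NormedSpace ℝ F]
    (f : Vec n → F) (x : Vec n) (r : ℝ) :
    ∫ y in Metric.ball (0 : Vec n) r, f (x + y) = ∫ y in Metric.ball x r, f y := by
  have h := (measurePreserving_add_left (volume : Measure (Vec n)) x).setIntegral_preimage_emb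
    (MeasurableEquiv.addLeft x).measurableEmbedding f (Metric.ball x r)
  rw [← h]
  congr 2
  ext y
  simp [Metric.mem_ball, dist_eq_norm]

theorem volume_real_ball {n : ℕ} (x : Vec n) {t : ℝ} (ht : 0 < t) :
    volume.real (Metric.ball x t) = t ^ n * volume.real (Metric.ball (0 : Vec n) 1) := by
  simp only [measureReal_def, Measure.addHaar_ball_of_pos (volume : Measure (Vec n)) x ht,
    ENNReal.toReal_mul, finrank_euclideanSpace_fin]
  rw [ENNReal.toReal_ofReal (by positivity)]

theorem volume_real_ball_pos {n : ℕ} (x : Vec n) {t : ℝ} (ht : 0 < t) :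
    0 < volume.real (Metric.ball x t) :=
  ENNReal.toReal_pos (Metric.measure_ball_pos volume x ht).ne' measure_ball_lt_top.ne

/-- Integrate the derivative along the segments from `x` and exchange integrals; the slice at
parameter `t` is an average over the ball of radius `tρ`, to which the hypothesis applies. -/
theorem integral_ball_norm_sub_le {n : ℕ} {z : Vec n → Vec n} (hz : ContDiff ℝ 1 z) {x : Vec n}
    {ρ lam : ℝ} (hρ : 0 < ρ)
    (H : ∀ t, 0 < t → t ≤ ρ →
      ∫ y in Metric.ball x t, ‖fderiv ℝ z y‖ ≤ lam * volume.real (Metric.ball x t)) :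
    ∫ y in Metric.ball x ρ, ‖z y - z x‖ ≤ ρ * lam * volume.real (Metric.ball x ρ) := by
  have hc := hz.continuous_fderiv one_ne_zero
  have hz0 := hz.continuous
  let D : Vec n → ℝ := fun y => ‖fderiv ℝ z (x + y)‖
  have hD : Continuous D := by fun_prop
  set B := Metric.ball (0 : Vec n) ρ with hB
  have hprod : Integrable (Function.uncurry fun (y : Vec n) (t : ℝ) => D (t • y))
      ((volume.restrict B).prod (volume.restrict (Set.Ioc (0 : ℝ) 1))) := by
    rw [Measure.prod_restrict]
    have hcu : Continuous (Function.uncurry fun (y : Vec n) (t : ℝ) => D (t • y)) := by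
      unfold Function.uncurry; fun_prop
    exact (hcu.continuousOn.integrableOn_compact
      ((isCompact_closedBall (0 : Vec n) ρ).prod (isCompact_Icc (a := (0 : ℝ)) (b := 1)))).mono_set
      (Set.prod_mono Metric.ball_subset_closedBall Set.Ioc_subset_Icc_self)
  have hscale : ∀ t ∈ Set.Ioc (0 : ℝ) 1, ∫ y in B, D (t • y) ≤ lam * volume.real B := by
    intro t ht
    rw [Measure.setIntegral_comp_smul_of_pos volume D B ht.1, finrank_euclideanSpace_fin, hB,
      smul_ball ht.1.ne', smul_zero, Real.norm_of_nonneg ht.1.le, smul_eq_mul,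
      setIntegral_ball_zero_add (fun y => ‖fderiv ℝ z y‖) x,
      inv_mul_le_iff₀ (pow_pos ht.1 n)]
    refine (H _ (mul_pos ht.1 hρ) (mul_le_of_le_one_left hρ.le ht.2)).trans_eq ?_
    rw [volume_real_ball x (mul_pos ht.1 hρ), volume_real_ball 0 hρ]
    ring
  have hvol : volume.real (Metric.ball x ρ) = volume.real B := by
    rw [volume_real_ball x hρ, volume_real_ball 0 hρ]
  rw [← setIntegral_ball_zero_add (fun y => ‖z y - z x‖) x ρ, hvol]
  have hi1 : IntegrableOn (fun y => ‖z (x + y) - z x‖) B :=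
    Continuous.integrableOn_ball (by fun_prop) 0 ρ
  calc ∫ y in B, ‖z (x + y) - z x‖
      ≤ ∫ y in B, ρ * ∫ t in Set.Ioc (0 : ℝ) 1, D (t • y) := by
        refine setIntegral_mono_on hi1 (hprod.integral_prod_left.const_mul ρ)
          Metric.isOpen_ball.measurableSet fun y hy => ?_
        refine (norm_sub_le_integral_fderiv hz x y).trans
          (mul_le_mul_of_nonneg_right ?_ (integral_nonneg fun t => norm_nonneg _))
        exact (mem_ball_zero_iff.1 hy).le
    _ = ρ * ∫ t in Set.Ioc (0 : ℝ) 1, ∫ y in B, D (t • y) := by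
        rw [integral_const_mul, integral_integral_swap hprod]
    _ ≤ ρ * ∫ _ in Set.Ioc (0 : ℝ) 1, lam * volume.real B := by
        refine mul_le_mul_of_nonneg_left ?_ hρ.le
        exact setIntegral_mono_on hprod.integral_prod_right (integrableOn_const (by simp))
          measurableSet_Ioc hscale
    _ = ρ * lam * volume.real B := by simp; ring

/-- Both values are compared with `z` on the ball of radius `d = dist x y` around `x`, which lies in
the ball of radius `2d` around `y`; the volume ratio `2ⁿ` and the doubled radius give `2^(n+1)`. -/
theorem norm_sub_le_of_average_fderiv_le {n : ℕ} {z : Vec n → Vec n} (hz : ContDiff ℝ 1 z)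
    {x y : Vec n} {lam : ℝ}
    (Hx : ∀ t, 0 < t → t ≤ 2 * dist x y →
      ∫ w in Metric.ball x t, ‖fderiv ℝ z w‖ ≤ lam * volume.real (Metric.ball x t))
    (Hy : ∀ t, 0 < t → t ≤ 2 * dist x y →
      ∫ w in Metric.ball y t, ‖fderiv ℝ z w‖ ≤ lam * volume.real (Metric.ball y t)) :
    ‖z x - z y‖ ≤ (1 + 2 ^ (n + 1)) * lam * dist x y := by
  rcases (dist_nonneg (x := x) (y := y)).eq_or_lt with h0 | hd
  · have : x = y := dist_eq_zero.1 h0.symm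
    simp [this]
  set d := dist x y
  have hz0 := hz.continuous
  have hv := volume_real_ball_pos x hd
  have hsub : Metric.ball x d ⊆ Metric.ball y (2 * d) :=
    Metric.ball_subset_ball' (by linarith)
  have i1 : IntegrableOn (fun w => ‖z w - z x‖) (Metric.ball x d) :=
    Continuous.integrableOn_ball (by fun_prop) x d
  have i2 : IntegrableOn (fun w => ‖z w - z y‖) (Metric.ball y (2 * d)) :=
    Continuous.integrableOn_ball (by fun_prop) y (2 * d)
  have h1 := integral_ball_norm_sub_le hz hd fun t ht htd => Hx t ht (by linarith)
  have h2 := integral_ball_norm_sub_le hz (by positivity : 0 < 2 * d) Hy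
  have h3 : volume.real (Metric.ball y (2 * d)) = 2 ^ n * volume.real (Metric.ball x d) := by
    rw [volume_real_ball y (by positivity), volume_real_ball x hd]
    ring
  have h4 : ∫ w in Metric.ball x d, ‖z w - z y‖ ≤ ∫ w in Metric.ball y (2 * d), ‖z w - z y‖ :=
    setIntegral_mono_set i2 (ae_of_all _ fun w => norm_nonneg _) hsub.eventuallyLE
  have h5 : volume.real (Metric.ball x d) * ‖z x - z y‖
      ≤ (∫ w in Metric.ball x d, ‖z w - z x‖) + ∫ w in Metric.ball x d, ‖z w - z y‖ := by
    rw [← integral_add i1 (i2.mono_set hsub), ← smul_eq_mul, ← setIntegral_const]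
    refine integral_mono (integrableOn_const measure_ball_lt_top.ne)
      (i1.add (i2.mono_set hsub)) fun w => ?_
    have := norm_sub_le_norm_sub_add_norm_sub (z x) (z w) (z y)
    rwa [norm_sub_rev (z x) (z w)] at this
  rw [h3] at h2
  refine le_of_mul_le_mul_left ?_ hv
  calc _ ≤ _ := h5
    _ ≤ d * lam * volume.real (Metric.ball x d)
        + 2 * d * lam * (2 ^ n * volume.real (Metric.ball x d)) := add_le_add h1 (h4.trans h2)
    _ = _ := by ring

/-- Turns smallness of a ball average, which weak convergence provides, into smallness at the point.
-/
theorem norm_le_of_average_fderiv_le {n : ℕ} {z : Vec n → Vec n} (hz : ContDiff ℝ 1 z)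
    {x : Vec n} {ρ lam : ℝ} (hρ : 0 < ρ)
    (H : ∀ t, 0 < t → t ≤ ρ →
      ∫ y in Metric.ball x t, ‖fderiv ℝ z y‖ ≤ lam * volume.real (Metric.ball x t)) :
    ‖z x‖ ≤ ‖∫ y in Metric.ball x ρ, z y‖ / volume.real (Metric.ball x ρ) + ρ * lam := by
  have hv := volume_real_ball_pos x hρ
  have hz0 := hz.continuous
  have h1 := integral_ball_norm_sub_le hz hρ H
  have i0 : IntegrableOn z (Metric.ball x ρ) :=
    (hz0.continuousOn.integrableOn_compact (isCompact_closedBall x ρ)).mono_set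
      Metric.ball_subset_closedBall
  have h2 : volume.real (Metric.ball x ρ) • z x
      = (∫ y in Metric.ball x ρ, z y) - ∫ y in Metric.ball x ρ, (z y - z x) := by
    rw [integral_sub i0 (integrableOn_const measure_ball_lt_top.ne), setIntegral_const,
      sub_sub_cancel]
  have h3 : volume.real (Metric.ball x ρ) * ‖z x‖
      ≤ ‖∫ y in Metric.ball x ρ, z y‖ + ρ * lam * volume.real (Metric.ball x ρ) := by
    rw [← Real.norm_of_nonneg hv.le, ← norm_smul, Real.norm_of_nonneg hv.le, h2]
    exact (norm_sub_le _ _).trans (add_le_add_right ((norm_integral_le_integral_norm _).trans h1) _)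
  rw [← sub_le_iff_le_add, le_div_iff₀ hv]
  linarith

/-- Pairs at distance above `R/2` lie outside the range of the averages; for them `‖z‖ ≤ s` and `4s
≤ λR` suffice. -/
theorem lipschitzOnWith_of_average_fderiv_le {n : ℕ} {z : Vec n → Vec n} (hz : ContDiff ℝ 1 z)
    {S : Set (Vec n)} {R lam s : ℝ} (hlam : 0 ≤ lam) (hs : 4 * s ≤ lam * R)
    (H : ∀ x ∈ S, ∀ t, 0 < t → t ≤ R →
      ∫ y in Metric.ball x t, ‖fderiv ℝ z y‖ ≤ lam * volume.real (Metric.ball x t))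
    (hzs : ∀ x ∈ S, ‖z x‖ ≤ s) :
    LipschitzOnWith (Real.toNNReal ((1 + 2 ^ (n + 1)) * lam)) z S := by
  refine LipschitzOnWith.of_dist_le_mul fun x hx y hy => ?_
  rw [Real.coe_toNNReal _ (by positivity), dist_eq_norm]
  rcases le_or_gt (2 * dist x y) R with h | h
  · exact norm_sub_le_of_average_fderiv_le hz (fun t ht htd => H x hx t ht (htd.trans h))
      fun t ht htd => H y hy t ht (htd.trans h)
  · have h1 : ‖z x - z y‖ ≤ 2 * s := (norm_sub_le _ _).trans (by linarith [hzs x hx, hzs y hy])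
    have h2 : lam * R ≤ lam * (2 * dist x y) := mul_le_mul_of_nonneg_left h.le hlam
    have h3 : 1 * (lam * dist x y) ≤ (1 + 2 ^ (n + 1)) * (lam * dist x y) := by
      refine mul_le_mul_of_nonneg_right ?_ (by positivity)
      have : (0 : ℝ) < 2 ^ (n + 1) := by positivity
      linarith
    linarith

/-! ### Mollification -/

/-- The convolution of `f` with the normalized bump function `φ`. -/
noncomputable def mollify {n : ℕ} {F : Type*} [NormedAddCommGroup F] [NormedSpace ℝ F]
    (φ : ContDiffBump (0 : Vec n)) (f : Vec n → F) : Vec n → F :=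
  convolution (φ.normed volume) f (ContinuousLinearMap.lsmul ℝ ℝ) volume

section

variable {n : ℕ} {F : Type*} [NormedAddCommGroup F] [NormedSpace ℝ F]

theorem mollify_apply (φ : ContDiffBump (0 : Vec n)) (f : Vec n → F) (x : Vec n) :
    mollify φ f x = ∫ t, φ.normed volume t • f (x - t) := rfl

theorem mollify_apply' (φ : ContDiffBump (0 : Vec n)) (f : Vec n → F) (x : Vec n) :
    mollify φ f x = ∫ t, φ.normed volume (x - t) • f t := by
  rw [mollify, convolution_eq_swap]; rfl

theorem contDiff_mollify [CompleteSpace F] (φ : ContDiffBump (0 : Vec n)) {f : Vec n → F}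
    (hf : LocallyIntegrable f) : ContDiff ℝ ∞ (mollify φ f) :=
  φ.hasCompactSupport_normed.contDiff_convolution_left _ φ.contDiff_normed hf

theorem norm_mollify_le (φ : ContDiffBump (0 : Vec n)) {f : Vec n → F} {s : ℝ}
    (hf : ∀ x, ‖f x‖ ≤ s) (x : Vec n) : ‖mollify φ f x‖ ≤ s := by
  have h : ∫ t, φ.normed volume t * s = s := by
    rw [integral_mul_const, φ.integral_normed, one_mul]
  rw [mollify_apply, ← h]
  refine norm_integral_le_of_norm_le (φ.integrable_normed.mul_const s) (ae_of_all _ fun t => ?_)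
  rw [norm_smul, Real.norm_of_nonneg (φ.nonneg_normed t)]
  exact mul_le_mul_of_nonneg_left (hf _) (φ.nonneg_normed t)

/-- Rademacher's theorem and the Lipschitz bound justify differentiating under the integral with the
derivative falling on `g`. -/
theorem fderiv_mollify_of_lipschitz [FiniteDimensional ℝ F] (φ : ContDiffBump (0 : Vec n))
    {g : Vec n → F} {K : NNReal} (hg : LipschitzWith K g) (x : Vec n) :
    fderiv ℝ (mollify φ g) x = mollify φ (fderiv ℝ g) x := by
  have : CompleteSpace F := FiniteDimensional.complete ℝ F
  have hgc := hg.continuous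
  have hφc : Continuous (φ.normed volume) := φ.continuous_normed
  have hcs : HasCompactSupport (φ.normed (volume : Measure (Vec n))) :=
    φ.hasCompactSupport_normed
  have hmeas : ∀ y, Continuous fun t => φ.normed volume t • g (y - t) := fun y => by fun_prop
  have hdiff : ∀ᵐ t : Vec n, DifferentiableAt ℝ g (x - t) :=
    (quasiMeasurePreserving_sub_left_of_right_invariant volume x).ae
      (hg.ae_differentiableAt (μ := volume))
  have hm : Measurable (fderiv ℝ g) := measurable_fderiv ℝ g
  have := hasFDerivAt_integral_of_dominated_loc_of_lip (𝕜 := ℝ) (μ := volume) (s := Set.univ)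
    (F := fun y t => φ.normed volume t • g (y - t)) (x₀ := x)
    (F' := fun t => φ.normed volume t • fderiv ℝ g (x - t))
    (bound := fun t => φ.normed volume t * K) univ_mem
    (Eventually.of_forall fun y => (hmeas y).aestronglyMeasurable)
    ((hmeas x).integrable_of_hasCompactSupport hcs.smul_right)
    (AEStronglyMeasurable.smul hφc.aestronglyMeasurable
      (hm.comp (measurable_const.sub measurable_id)).aestronglyMeasurable)
    (ae_of_all _ fun t => ?_) (φ.integrable_normed.mul_const _) ?_
  · exact this.2.fderiv
  · refine LipschitzOnWith.of_dist_le_mul fun y _ y' _ => ?_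
    rw [dist_smul₀, Real.norm_of_nonneg (φ.nonneg_normed t), Real.coe_nnabs,
      abs_of_nonneg (mul_nonneg (φ.nonneg_normed _) K.coe_nonneg), mul_assoc]
    refine mul_le_mul_of_nonneg_left ?_ (φ.nonneg_normed t)
    simpa using hg.dist_le_mul (y - t) (y' - t)
  · filter_upwards [hdiff] with t ht
    have h1 : HasFDerivAt (fun y : Vec n => g (y - t)) (fderiv ℝ g (x - t)) x := by
      have h2 : HasFDerivAt (fun y : Vec n => y - t) (ContinuousLinearMap.id ℝ (Vec n)) x :=
        (hasFDerivAt_id x).sub_const t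
      exact ht.hasFDerivAt.comp x h2
    exact h1.const_smul _

theorem enorm_mollify_sub_le (φ : ContDiffBump (0 : Vec n)) (f : Vec n → F) {a : ℝ} (ha : 0 ≤ a)
    (x : Vec n) : ENNReal.ofReal (‖mollify φ f x‖ - a)
      ≤ ∫⁻ t, ENNReal.ofReal (φ.normed volume t) * ENNReal.ofReal (‖f (x - t)‖ - a) := by
  have hφm : Measurable fun t : Vec n => ENNReal.ofReal (φ.normed volume t) :=
    φ.continuous_normed.measurable.ennreal_ofReal
  have h1 : ∫⁻ t : Vec n, ENNReal.ofReal (φ.normed volume t) = 1 := by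
    rw [← ofReal_integral_eq_lintegral_ofReal φ.integrable_normed
      (ae_of_all _ fun t => φ.nonneg_normed t), φ.integral_normed, ENNReal.ofReal_one]
  rw [ENNReal.ofReal_sub _ ha, tsub_le_iff_right, ofReal_norm, mollify_apply]
  calc ‖∫ t, φ.normed volume t • f (x - t)‖ₑ
      ≤ ∫⁻ t, ‖φ.normed volume t • f (x - t)‖ₑ := enorm_integral_le_lintegral_enorm _
    _ ≤ ∫⁻ t, (ENNReal.ofReal (φ.normed volume t) * ENNReal.ofReal (‖f (x - t)‖ - a)
          + ENNReal.ofReal (φ.normed volume t) * ENNReal.ofReal a) := by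
        refine lintegral_mono fun t => ?_
        simp only []
        rw [enorm_smul, Real.enorm_of_nonneg (φ.nonneg_normed t), ← mul_add]
        gcongr
        rw [← ofReal_norm]
        refine le_trans (ENNReal.ofReal_le_ofReal ?_) ENNReal.ofReal_add_le
        linarith
    _ = _ := by
        rw [lintegral_add_right _ (hφm.mul_const _), lintegral_mul_const _ hφm, h1, one_mul]

/-- Jensen's inequality for the convex function `(‖·‖ - a)⁺`: mollification does not increase the
total excess over the level `a`. -/
theorem lintegral_mollify_sub_le (φ : ContDiffBump (0 : Vec n)) {f : Vec n → F}
    (hf : AEStronglyMeasurable f) {a : ℝ} (ha : 0 ≤ a) :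
    ∫⁻ x, ENNReal.ofReal (‖mollify φ f x‖ - a) ≤ ∫⁻ x, ENNReal.ofReal (‖f x‖ - a) := by
  have hφm : Measurable fun t : Vec n => ENNReal.ofReal (φ.normed volume t) :=
    φ.continuous_normed.measurable.ennreal_ofReal
  have h1 : ∫⁻ t : Vec n, ENNReal.ofReal (φ.normed volume t) = 1 := by
    rw [← ofReal_integral_eq_lintegral_ofReal φ.integrable_normed
      (ae_of_all _ fun t => φ.nonneg_normed t), φ.integral_normed, ENNReal.ofReal_one]
  have hfm : AEMeasurable (fun x => ENNReal.ofReal (‖f x‖ - a)) :=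
    (hf.norm.aemeasurable.sub_const a).ennreal_ofReal
  have hprod : AEMeasurable (Function.uncurry fun x t : Vec n =>
      ENNReal.ofReal (φ.normed volume t) * ENNReal.ofReal (‖f (x - t)‖ - a))
      ((volume : Measure (Vec n)).prod volume) := by
    refine (hφm.comp measurable_snd).aemeasurable.mul ?_
    exact hfm.comp_quasiMeasurePreserving
      (quasiMeasurePreserving_sub_of_right_invariant volume volume)
  refine (lintegral_mono fun x => enorm_mollify_sub_le φ f ha x).trans ?_
  rw [lintegral_lintegral_swap hprod]
  have h2 : ∀ t : Vec n, ∫⁻ x, ENNReal.ofReal (φ.normed volume t) * ENNReal.ofReal (‖f (x - t)‖ - a)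
      = ENNReal.ofReal (φ.normed volume t) * ∫⁻ x, ENNReal.ofReal (‖f x‖ - a) := fun t => by
    rw [lintegral_const_mul' _ _ ENNReal.ofReal_ne_top,
      lintegral_sub_right_eq_self (fun x => ENNReal.ofReal (‖f x‖ - a)) t]
  simp only [h2]
  rw [lintegral_mul_const _ hφm, h1, one_mul]

theorem integral_norm_mollify_sub_le [CompleteSpace F] (φ : ContDiffBump (0 : Vec n))
    {f : Vec n → F} (hf : Integrable f) {ε : ℝ}
    (hε : ∀ h : Vec n, ‖h‖ < φ.rOut → ∫ x, ‖f (x + h) - f x‖ ≤ ε) :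
    Integrable (mollify φ f) ∧ ∫ x, ‖mollify φ f x - f x‖ ≤ ε := by
  have i1 : Integrable (fun z : Vec n × Vec n => φ.normed volume z.2 • f (z.1 - z.2))
      (volume.prod volume) :=
    φ.integrable_normed.convolution_integrand (ContinuousLinearMap.lsmul ℝ ℝ) hf
  have i2 : Integrable (fun z : Vec n × Vec n => φ.normed volume z.2 • f z.1)
      (volume.prod volume) :=
    (φ.integrable_normed.smul_prod hf).swap
  have i3 : Integrable (fun z : Vec n × Vec n => ‖φ.normed volume z.2 • (f (z.1 - z.2) - f z.1)‖)
      (volume.prod volume) := by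
    refine (i1.sub i2).norm.congr (ae_of_all _ fun z => ?_)
    simp [smul_sub]
  have im : Integrable (mollify φ f) := i1.integral_prod_left
  refine ⟨im, ?_⟩
  have hpt : ∀ᵐ x, ‖mollify φ f x - f x‖
      ≤ ∫ t, ‖φ.normed volume t • (f (x - t) - f x)‖ := by
    filter_upwards [i1.prod_right_ae] with x hx
    have h1 : f x = ∫ t, φ.normed volume t • f x := by
      rw [integral_smul_const, φ.integral_normed, one_smul]
    have h2 : mollify φ f x - f x = ∫ t, φ.normed volume t • (f (x - t) - f x) := by
      conv_lhs => rw [h1]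
      rw [mollify_apply, ← integral_sub hx (φ.integrable_normed.smul_const _)]
      simp only [smul_sub]
    rw [h2]
    exact norm_integral_le_integral_norm _
  calc ∫ x, ‖mollify φ f x - f x‖
      ≤ ∫ x, ∫ t, ‖φ.normed volume t • (f (x - t) - f x)‖ :=
        integral_mono_ae (im.sub hf).norm i3.integral_prod_left hpt
    _ = ∫ t, ∫ x, ‖φ.normed volume t • (f (x - t) - f x)‖ := integral_integral_swap i3
    _ ≤ ∫ t, φ.normed volume t * ε := by
        refine integral_mono i3.integral_prod_right (φ.integrable_normed.mul_const ε) fun t => ?_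
        simp only [norm_smul, Real.norm_of_nonneg (φ.nonneg_normed t)]
        rw [integral_const_mul]
        by_cases ht : ‖t‖ < φ.rOut
        · refine mul_le_mul_of_nonneg_left ?_ (φ.nonneg_normed t)
          simpa [sub_eq_add_neg] using hε (-t) (by simpa using ht)
        · have : φ.normed volume t = 0 := by
            rw [← Function.notMem_support, φ.support_normed_eq]
            simpa using ht
          simp [this]
    _ = ε := by rw [integral_mul_const, φ.integral_normed, one_mul]

end

/-- The reflected kernel `t ↦ ρ(x - t)` is an admissible test function exactly because its support
stays in `Ω`; extension by zero creates no boundary term at such `x`. -/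
theorem jacobian_mollify {n : ℕ} {Ω : Set (Vec n)} (hΩ : MeasurableSet Ω) {w : Vec n → Vec n}
    {H : Vec n → Mat n} (hw : IntegrableOn w Ω) (hH : IntegrableOn H Ω)
    (hwH : IsWeakGradient Ω w H) (φ : ContDiffBump (0 : Vec n)) {x : Vec n}
    (hx : Metric.closedBall x φ.rOut ⊆ Ω) :
    jacobian (mollify φ (Ω.indicator w)) x = mollify φ (Ω.indicator H) x := by
  set ρ := φ.normed (volume : Measure (Vec n)) with hρ
  have hρs : ContDiff ℝ ∞ ρ := φ.contDiff_normed
  have hcs : HasCompactSupport ρ := φ.hasCompactSupport_normed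
  have hwi : Integrable (Ω.indicator w) := hw.indicator_of_normed hΩ
  have hHi : Integrable (Ω.indicator H) := hH.indicator_of_normed hΩ
  have hder := hcs.hasFDerivAt_convolution_left (ContinuousLinearMap.lsmul ℝ ℝ)
    (hρs.of_le (by simp)) hwi.locallyIntegrable x
  let L := (ContinuousLinearMap.lsmul ℝ ℝ : ℝ →L[ℝ] Vec n →L[ℝ] Vec n).precompL (Vec n)
  have hint : Integrable fun t => L (fderiv ℝ ρ (x - t)) (Ω.indicator w t) := by
    have := (hcs.fderiv ℝ).convolutionExists_left L (hρs.continuous_fderiv (by simp))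
      hwi.locallyIntegrable x
    exact (convolutionExistsAt_iff_integrable_swap (L := L)).1 this
  let ψ : Vec n → ℝ := fun t => ρ (x - t)
  have hψ : ContDiff ℝ ∞ ψ := hρs.comp (contDiff_const.sub contDiff_id)
  have hψt : tsupport ψ ⊆ Metric.closedBall x φ.rOut := by
    refine closure_minimal (fun t ht => ?_) Metric.isClosed_closedBall
    have : x - t ∈ Function.support ρ := ht
    rw [hρ, φ.support_normed_eq, mem_ball_zero_iff, ← dist_eq_norm, dist_comm] at this
    exact this.le
  have hψc : HasCompactSupport ψ :=
    (isCompact_closedBall x φ.rOut).of_isClosed_subset (isClosed_tsupport ψ) hψt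
  have hψd : ∀ t v, fderiv ℝ ψ t v = -fderiv ℝ ρ (x - t) v := by
    intro t v
    have h2 : HasFDerivAt (fun t : Vec n => x - t) (-ContinuousLinearMap.id ℝ (Vec n)) t :=
      (hasFDerivAt_id t).const_sub x
    have : HasFDerivAt ψ _ t := ((hρs.differentiable (by simp)) (x - t)).hasFDerivAt.comp t h2
    rw [this.fderiv]
    simp
  ext ⟨i, j⟩
  have hfd : fderiv ℝ (mollify φ (Ω.indicator w)) x
      = ∫ t, L (fderiv ℝ ρ (x - t)) (Ω.indicator w t) := by
    refine hder.fderiv.trans ?_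
    rw [convolution_eq_swap]
  have hR : mollify φ (Ω.indicator H) x (i, j) = ∫ t in Ω, H t (i, j) * ψ t := by
    rw [mollify_apply']
    have hi : Integrable fun t => ρ (x - t) • Ω.indicator H t :=
      (convolutionExistsAt_iff_integrable_swap (L := ContinuousLinearMap.lsmul ℝ ℝ)).1
        (hcs.convolutionExists_left _ hρs.continuous hHi.locallyIntegrable x)
    have := (EuclideanSpace.proj (i, j) : Mat n →L[ℝ] ℝ).integral_comp_comm hi
    refine this.symm.trans ?_
    rw [← integral_indicator hΩ]
    refine integral_congr_ae (ae_of_all _ fun t => ?_)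
    by_cases ht : t ∈ Ω <;> simp [ht, ψ, mul_comm]
  have hLft : jacobian (mollify φ (Ω.indicator w)) x (i, j)
      = -∫ t in Ω, w t i * fderiv ℝ ψ t (EuclideanSpace.single j 1) := by
    rw [jacobian_eq_matrixOf, matrixOf_apply, hfd, ContinuousLinearMap.integral_apply hint]
    have := (EuclideanSpace.proj i : Vec n →L[ℝ] ℝ).integral_comp_comm
      (hint.apply_continuousLinearMap (EuclideanSpace.single j 1))
    refine this.symm.trans ?_
    rw [← integral_indicator hΩ, ← integral_neg]
    refine integral_congr_ae (ae_of_all _ fun t => ?_)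
    by_cases ht : t ∈ Ω <;> simp [ht, hψd, L, ContinuousLinearMap.precompL_apply, mul_comm]
  rw [hLft, hR, hwH ψ hψ hψc (hψt.trans hx) i j, neg_neg]

/-! ### Smooth Lipschitz truncation -/

/-- Coordinatewise truncation of a vector at height `s`. -/
noncomputable def clampVec {n : ℕ} (s : ℝ) (y : Vec n) : Vec n :=
  WithLp.toLp 2 fun i => max (-s) (min s (y i))

theorem lipschitzWith_clampVec {n : ℕ} (s : ℝ) : LipschitzWith 1 (clampVec (n := n) s) := by
  refine LipschitzWith.of_dist_le_mul fun y y' => ?_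
  rw [NNReal.coe_one, one_mul, EuclideanSpace.dist_eq, EuclideanSpace.dist_eq]
  refine Real.sqrt_le_sqrt (Finset.sum_le_sum fun i _ => ?_)
  refine pow_le_pow_left₀ dist_nonneg ?_ 2
  have h : LipschitzWith 1 fun t : ℝ => max (-s) (min s t) :=
    (LipschitzWith.id.const_min s).const_max (-s)
  simpa [clampVec] using h.dist_le_mul (y i) (y' i)

theorem norm_clampVec_le {n : ℕ} {s : ℝ} (hs : 0 ≤ s) (y : Vec n) : ‖clampVec s y‖ ≤ n * s := by
  refine (norm_le_sum_abs _).trans ?_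
  calc ∑ i, |clampVec s y i| ≤ ∑ _i : Fin n, s := Finset.sum_le_sum fun i _ => by
        refine abs_le.2 ⟨le_max_left _ _, max_le (by linarith) (min_le_left _ _)⟩
    _ = n * s := by simp

theorem clampVec_of_norm_le {n : ℕ} {s : ℝ} {y : Vec n} (hy : ‖y‖ ≤ s) : clampVec s y = y := by
  ext i
  have h := abs_le.1 (((PiLp.norm_apply_le y i).trans hy : ‖y i‖ ≤ s))
  simp [clampVec, min_eq_right h.2, max_eq_right h.1]

/-- On the coincidence set the difference `g - z` is approximated by the zero map with constant `0`,
so its derivative vanishes at almost every point of that set. -/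
theorem ae_fderiv_eq_of_eq {n : ℕ} {g z : Vec n → Vec n} {K : NNReal} (hg : LipschitzWith K g)
    (hz : ContDiff ℝ 1 z) : ∀ᵐ x, g x = z x → fderiv ℝ g x = fderiv ℝ z x := by
  have hcl : IsClosed {x | g x = z x} := isClosed_eq hg.continuous hz.continuous
  have hrad := hg.ae_differentiableAt (μ := volume)
  let Z := {x | g x = z x} ∩ {x | DifferentiableAt ℝ g x}
  have hZ : MeasurableSet Z :=
    hcl.measurableSet.inter (measurableSet_of_differentiableAt ℝ g)
  have happ : ApproximatesLinearOn (fun x => g x - z x) (0 : Vec n →L[ℝ] Vec n) Z 0 := by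
    intro x hx y hy
    have h1 : g x = z x := hx.1
    have h2 : g y = z y := hy.1
    simp [h1, h2]
  have h := happ.norm_fderiv_sub_le volume hZ (fun x => fderiv ℝ g x - fderiv ℝ z x)
    fun x hx => ((DifferentiableAt.hasFDerivAt hx.2).sub
      ((hz.differentiable one_ne_zero) x).hasFDerivAt).hasFDerivWithinAt
  filter_upwards [(ae_restrict_iff' hZ).1 h, hrad] with x h1 h2 h3
  have := h1 ⟨h3, h2⟩
  rw [sub_zero, nonpos_iff_eq_zero, nnnorm_eq_zero, sub_eq_zero] at this
  exact this

/-- A sequence of bump functions whose supports shrink to the origin. -/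
noncomputable def shrinkingBump (n j : ℕ) : ContDiffBump (0 : Vec n) :=
  ⟨1 / ((j : ℝ) + 1), 2 / ((j : ℝ) + 1), by positivity, by gcongr; norm_num⟩

theorem tendsto_shrinkingBump_rOut (n : ℕ) :
    Tendsto (fun j => (shrinkingBump n j).rOut) atTop (𝓝 0) := by
  have := (tendsto_one_div_add_atTop_nhds_zero_nat (𝕜 := ℝ)).const_mul 2
  simpa [shrinkingBump, div_eq_mul_inv] using this

/-- On the good set `S` the function `z` is Lipschitz. It is extended to the whole space, clamped at
height `s` (which leaves it unchanged on `S`), and mollified; mollified gradients converge in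
measure on `A`. -/
theorem exists_smooth_lipschitz_truncation (n : ℕ) :
    ∃ c : ℝ, 1 ≤ c ∧ ∀ (z : Vec n → Vec n), ContDiff ℝ 1 z → ∀ (S : Set (Vec n)) (R lam s : ℝ),
      0 ≤ lam → 0 ≤ s → 4 * s ≤ lam * R →
      (∀ x ∈ S, ∀ t, 0 < t → t ≤ R →
        ∫ y in Metric.ball x t, ‖fderiv ℝ z y‖ ≤ lam * volume.real (Metric.ball x t)) →
      (∀ x ∈ S, ‖z x‖ ≤ s) → ∀ (A : Set (Vec n)), volume A ≠ ⊤ → ∀ δ > 0, ∀ τ > 0,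
      ∃ g : Vec n → Vec n, ContDiff ℝ ∞ g ∧ (∀ x, ‖fderiv ℝ g x‖ ≤ c * lam) ∧
        (∀ x, ‖g x‖ ≤ c * s) ∧
        volume {x | x ∈ A ∧ x ∈ S ∧ τ < ‖fderiv ℝ g x - fderiv ℝ z x‖} ≤ ENNReal.ofReal δ := by
  let k : ℝ := lipschitzExtensionConstant (Vec n)
  have hk : 0 ≤ k := NNReal.coe_nonneg _
  have h2n : (0 : ℝ) ≤ 1 + 2 ^ (n + 1) := by positivity
  refine ⟨k * (1 + 2 ^ (n + 1)) + n + 1, ?_, ?_⟩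
  · have : 0 ≤ k * (1 + 2 ^ (n + 1)) := by positivity
    linarith [Nat.cast_nonneg (α := ℝ) n]
  intro z hz S R lam s hlam hs hsR H hzs A hA δ hδ τ hτ
  have hlip := lipschitzOnWith_of_average_fderiv_le hz hlam hsR H hzs
  obtain ⟨g₀, hg₀, hg₀S⟩ := hlip.extend_finite_dimension
  let g₁ : Vec n → Vec n := fun x => clampVec s (g₀ x)
  have hg₁ : LipschitzWith (lipschitzExtensionConstant (Vec n) *
      Real.toNNReal ((1 + 2 ^ (n + 1)) * lam)) g₁ := by
    have := (lipschitzWith_clampVec s).comp hg₀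
    rw [one_mul] at this
    exact this
  have hg₁S : ∀ x ∈ S, g₁ x = z x := fun x hx => by
    simp only [g₁, ← hg₀S hx]
    exact clampVec_of_norm_le (hzs x hx)
  have hg₁s : ∀ x, ‖g₁ x‖ ≤ n * s := fun x => norm_clampVec_le hs _
  have hD : ∀ x, ‖fderiv ℝ g₁ x‖ ≤ k * ((1 + 2 ^ (n + 1)) * lam) := fun x => by
    have := norm_fderiv_le_of_lipschitz ℝ hg₁ (x₀ := x)
    rwa [NNReal.coe_mul, Real.coe_toNNReal _ (by positivity)] at this
  have hDloc : LocallyIntegrable (fderiv ℝ g₁) := by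
    refine (locallyIntegrable_const (k * ((1 + 2 ^ (n + 1)) * lam))).mono
      (measurable_fderiv ℝ g₁).aestronglyMeasurable (ae_of_all _ fun x => ?_)
    exact (hD x).trans (le_abs_self _)
  have hlim := ContDiffBump.ae_convolution_tendsto_right_of_locallyIntegrable (K := 2)
    (φ := shrinkingBump n) (μ := volume) (tendsto_shrinkingBump_rOut n)
    (Eventually.of_forall fun j => by simp [shrinkingBump, div_eq_mul_inv]) hDloc
  have : IsFiniteMeasure (volume.restrict A) := ⟨by simpa using hA.lt_top⟩
  have hfd : ∀ j, fderiv ℝ (mollify (shrinkingBump n j) g₁)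
      = mollify (shrinkingBump n j) (fderiv ℝ g₁) := fun j =>
    funext fun x => fderiv_mollify_of_lipschitz _ hg₁ x
  have hmeas : TendstoInMeasure (volume.restrict A)
      (fun j => fderiv ℝ (mollify (shrinkingBump n j) g₁)) atTop (fderiv ℝ g₁) := by
    refine tendstoInMeasure_of_tendsto_ae
      (fun j => (measurable_fderiv ℝ _).aestronglyMeasurable) ?_
    filter_upwards [ae_restrict_of_ae hlim] with x hx
    simp only [hfd]
    exact hx
  rw [tendstoInMeasure_iff_norm] at hmeas
  obtain ⟨j, hj⟩ := ((hmeas τ hτ).eventually_le_const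
    (ENNReal.ofReal_pos.2 hδ)).exists
  refine ⟨mollify (shrinkingBump n j) g₁, contDiff_mollify _ hg₁.continuous.locallyIntegrable,
    fun x => ?_, fun x => ?_, ?_⟩
  · rw [hfd]
    refine (norm_mollify_le _ hD x).trans ?_
    have : 0 ≤ (n + 1 : ℝ) * lam := by positivity
    linarith
  · refine (norm_mollify_le _ hg₁s x).trans ?_
    have : 0 ≤ (k * (1 + 2 ^ (n + 1)) + 1) * s := by positivity
    linarith
  -- A point of the exceptional set either sees a large mollification error or lies in the null set
  -- where the gradients of `g₁` and `z` differ despite `g₁ = z`.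
  · have hnull := ae_iff.1 (ae_fderiv_eq_of_eq hg₁ hz)
    refine le_trans (measure_mono fun x hx => ?_)
      ((measure_union_le ({x | τ ≤ ‖fderiv ℝ (mollify (shrinkingBump n j) g₁) x
        - fderiv ℝ g₁ x‖} ∩ A) _).trans
        (add_le_add ((Measure.le_restrict_apply _ _).trans hj) hnull.le) |>.trans_eq (add_zero _))
    obtain ⟨hxA, hxS, hxτ⟩ := hx
    by_cases h : fderiv ℝ g₁ x = fderiv ℝ z x
    · left
      refine ⟨?_, hxA⟩
      simp only [Set.mem_ofPred_eq]
      rw [h]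
      exact hxτ.le
    · right
      simp only [Set.mem_ofPred_eq, Classical.not_imp]
      exact ⟨hg₁S x hxS, h⟩

/-! ### Selection of a dyadic truncation level -/

theorem sum_ite_pow_le {r q t : ℝ} (hq : 0 < q) (hr : r = (2 : ℝ) ^ q) (ht : 0 ≤ t) (N : ℕ) :
    ∑ j ∈ Finset.range N, (if (2 : ℝ) ^ j < t then r ^ j else 0) ≤ r / (r - 1) * t ^ q := by
  have hr1 : 1 < r := by rw [hr]; exact Real.one_lt_rpow one_lt_two hq
  have hr0 : 0 < r - 1 := by linarith
  induction N with
  | zero => simp; positivity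
  | succ N ih =>
    by_cases h : (2 : ℝ) ^ N < t
    · have h1 : r ^ N ≤ t ^ q := by
        rw [hr, ← Real.rpow_natCast, ← Real.rpow_mul zero_le_two, mul_comm,
          Real.rpow_mul zero_le_two, Real.rpow_natCast]
        exact Real.rpow_le_rpow (by positivity) h.le hq.le
      calc ∑ j ∈ Finset.range (N + 1), (if (2 : ℝ) ^ j < t then r ^ j else 0)
          ≤ ∑ j ∈ Finset.range (N + 1), r ^ j := by
            refine Finset.sum_le_sum fun j _ => ?_
            split_ifs
            · exact le_rfl
            · positivity
        _ = (r ^ (N + 1) - 1) / (r - 1) := geom_sum_eq hr1.ne' _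
        _ ≤ r ^ (N + 1) / (r - 1) := by gcongr; linarith
        _ = r / (r - 1) * r ^ N := by ring
        _ ≤ r / (r - 1) * t ^ q := by gcongr
    · rw [Finset.sum_range_succ, if_neg h, add_zero]
      exact ih

theorem sum_pow_mul_max_sub_le {p t : ℝ} (hp : 1 < p) (ht : 0 ≤ t) (N : ℕ) :
    ∑ j ∈ Finset.range N, ((2 : ℝ) ^ (p - 1)) ^ j * max (t - 2 ^ j) 0
      ≤ (2 : ℝ) ^ (p - 1) / ((2 : ℝ) ^ (p - 1) - 1) * t ^ p := by
  set r := (2 : ℝ) ^ (p - 1)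
  have hr0 : 0 < r := by positivity
  calc ∑ j ∈ Finset.range N, r ^ j * max (t - 2 ^ j) 0
      ≤ ∑ j ∈ Finset.range N, (if (2 : ℝ) ^ j < t then r ^ j else 0) * t := by
        refine Finset.sum_le_sum fun j _ => ?_
        have h2 : (0 : ℝ) < 2 ^ j := by positivity
        split_ifs with h
        · rw [max_eq_left (by linarith)]
          gcongr
          linarith
        · rw [max_eq_right (by linarith)]
          simp
    _ ≤ r / (r - 1) * t ^ (p - 1) * t := by
        rw [← Finset.sum_mul]
        exact mul_le_mul_of_nonneg_right (sum_ite_pow_le (by linarith) rfl ht N) ht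
    _ = r / (r - 1) * t ^ p := by
        rw [mul_assoc]
        congr 1
        rcases ht.eq_or_lt with rfl | h
        · rw [mul_zero, Real.zero_rpow (by linarith)]
        · rw [← Real.rpow_add_one h.ne', sub_add_cancel]

/-- The weighted excesses `r^j (‖H‖ - 2^j)⁺` sum over `j` to at most a multiple of `‖H‖^p`, so one
of `N` levels carries at most a share `1/N`. With `a = 2^j` this makes `a^(p-1) ∫ (‖H‖ - a)⁺` small,
whereas a single fixed level would only give boundedness. -/
theorem exists_dyadic_level {α F : Type*} [MeasurableSpace α] {μ : Measure α}
    [NormedAddCommGroup F] {p M : ℝ} (hp : 1 < p) {H : α → F}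
    (hH : MemLp H (ENNReal.ofReal p) μ) (hM : ∫ x, ‖H x‖ ^ p ∂μ ≤ M) {N : ℕ} (hN : 0 < N) :
    ∃ j < N, ENNReal.ofReal (((2 : ℝ) ^ (p - 1)) ^ j) * ∫⁻ x, ENNReal.ofReal (‖H x‖ - 2 ^ j) ∂μ
      ≤ ENNReal.ofReal ((2 : ℝ) ^ (p - 1) / ((2 : ℝ) ^ (p - 1) - 1) * M / N) := by
  set r := (2 : ℝ) ^ (p - 1) with hr
  have hr1 : 1 < r := by rw [hr]; exact Real.one_lt_rpow one_lt_two (by linarith)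
  have hr0 : 0 < r - 1 := by linarith
  have hint := (memLp_ofReal_iff_integrable_rpow hH.1 (by linarith : 0 < p)).1 hH
  have hNr : (0 : ℝ) < N := by exact_mod_cast hN
  have hm : ∀ j : ℕ, AEMeasurable (fun x => ENNReal.ofReal (‖H x‖ - 2 ^ j)) μ := fun j =>
    (hH.1.norm.aemeasurable.sub_const _).ennreal_ofReal
  have hsum : ∑ j ∈ Finset.range N, ENNReal.ofReal (r ^ j) *
      ∫⁻ x, ENNReal.ofReal (‖H x‖ - 2 ^ j) ∂μ
      ≤ ∑ _j ∈ Finset.range N, ENNReal.ofReal (r / (r - 1) * M / N) := by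
    calc ∑ j ∈ Finset.range N, ENNReal.ofReal (r ^ j) *
          ∫⁻ x, ENNReal.ofReal (‖H x‖ - 2 ^ j) ∂μ
        = ∫⁻ x, ∑ j ∈ Finset.range N, ENNReal.ofReal (r ^ j) *
            ENNReal.ofReal (‖H x‖ - 2 ^ j) ∂μ := by
          rw [lintegral_finsetSum' _ fun j _ => (hm j).const_mul _]
          refine Finset.sum_congr rfl fun j _ => ?_
          rw [lintegral_const_mul' _ _ ENNReal.ofReal_ne_top]
      _ ≤ ∫⁻ x, ENNReal.ofReal (r / (r - 1) * ‖H x‖ ^ p) ∂μ := by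
          refine lintegral_mono fun x => ?_
          refine le_trans ?_ (ENNReal.ofReal_le_ofReal
            (sum_pow_mul_max_sub_le hp (norm_nonneg (H x)) N))
          rw [ENNReal.ofReal_sum_of_nonneg fun j _ => by positivity]
          refine Finset.sum_le_sum fun j _ => ?_
          rw [ENNReal.ofReal_mul (by positivity)]
          gcongr
          exact le_max_left _ _
      _ = ENNReal.ofReal (r / (r - 1) * ∫ x, ‖H x‖ ^ p ∂μ) := by
          rw [← integral_const_mul, ofReal_integral_eq_lintegral_ofReal (hint.const_mul _)
            (ae_of_all _ fun x => by simp only [Pi.zero_apply]; positivity)]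
      _ ≤ ENNReal.ofReal (r / (r - 1) * M) := by gcongr
      _ = _ := by
          rw [Finset.sum_const, Finset.card_range, nsmul_eq_mul, ← ENNReal.ofReal_natCast,
            ← ENNReal.ofReal_mul hNr.le, mul_div_cancel₀ _ hNr.ne']
  by_contra! hcon
  exact (ENNReal.sum_lt_sum_of_nonempty (Finset.nonempty_range_iff.2 hN.ne')
    fun j hj => hcon j (Finset.mem_range.1 hj)).not_ge hsum

/-! ### Truncation of weakly differentiable functions -/

theorem exists_mollify_close {n : ℕ} {F F' : Type*} [NormedAddCommGroup F] [NormedSpace ℝ F]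
    [CompleteSpace F] [NormedAddCommGroup F'] [NormedSpace ℝ F'] [CompleteSpace F']
    {f : Vec n → F} {h : Vec n → F'} (hf : Integrable f) (hh : Integrable h) {R ε : ℝ}
    (hR : 0 < R) (hε : 0 < ε) :
    ∃ φ : ContDiffBump (0 : Vec n), φ.rOut ≤ R ∧
      (Integrable (mollify φ f) ∧ ∫ x, ‖mollify φ f x - f x‖ ≤ ε) ∧
      (Integrable (mollify φ h) ∧ ∫ x, ‖mollify φ h x - h x‖ ≤ ε) := by
  obtain ⟨r₁, hr₁, h₁⟩ := hf.exists_translate_sub_le hε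
  obtain ⟨r₂, hr₂, h₂⟩ := hh.exists_translate_sub_le hε
  have hr : 0 < min R (min r₁ r₂) := lt_min hR (lt_min hr₁ hr₂)
  let φ : ContDiffBump (0 : Vec n) :=
    ⟨min R (min r₁ r₂) / 2, min R (min r₁ r₂), half_pos hr, half_lt_self hr⟩
  exact ⟨φ, min_le_left _ _,
    integral_norm_mollify_sub_le φ hf fun x hx =>
      h₁ x (hx.trans_le ((min_le_right _ _).trans (min_le_left _ _))),
    integral_norm_mollify_sub_le φ hh fun x hx =>
      h₂ x (hx.trans_le ((min_le_right _ _).trans (min_le_right _ _)))⟩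

/-- The terms on the right are the ways a point can be bad: near the boundary, large maximal
function, large ball average of the mollified `w`, large mollification error of `H`, and the
smoothing error `η`. Elsewhere the truncation applies to the mollification of `w`. -/
theorem exists_truncation_at_level (n : ℕ) :
    ∃ c D : ℝ, 1 ≤ c ∧ 1 ≤ D ∧ ∃ b : ℝ, 0 < b ∧
      ∀ (Ω : Set (Vec n)), MeasurableSet Ω → volume Ω ≠ ⊤ →
      ∀ (w : Vec n → Vec n) (H : Vec n → Mat n), IntegrableOn w Ω → IntegrableOn H Ω →
      IsWeakGradient Ω w H → ∀ (K : Set (Vec n)) (R : ℝ), 0 < R →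
      (∀ x ∈ K, Metric.closedBall x (2 * R) ⊆ Ω) →
      ∀ φ : ContDiffBump (0 : Vec n), φ.rOut ≤ R → ∀ a > 0, ∀ s₀ > 0, 4 * s₀ ≤ b * a * R →
      ∀ ρ > 0, ρ ≤ R → ρ * (b * a) ≤ s₀ / 2 → ∀ s > 0, ∀ η > 0,
      ∃ g : Vec n → Vec n, ContDiff ℝ ∞ g ∧ (∀ x, ‖jacobian g x‖ ≤ D * a) ∧
        (∀ x, ‖g x‖ ≤ c * s₀) ∧
        volume {x | x ∈ Ω ∧ s < ‖jacobian g x - H x‖} ≤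
          volume (Ω \ K)
          + volume {x : Vec n | ∃ t, 0 < t ∧ t ≤ R ∧ ENNReal.ofReal (2 * a) *
              volume (Metric.ball x t) <
                ∫⁻ y in Metric.ball x t, ‖mollify φ (Ω.indicator H) y‖ₑ}
          + volume {x | x ∈ Ω ∧ s₀ / 2 < ‖∫ y in Metric.ball x ρ, mollify φ (Ω.indicator w) y‖
              / volume.real (Metric.ball x ρ)}
          + volume {x | x ∈ Ω ∧ s / 2 < ‖mollify φ (Ω.indicator H) x - Ω.indicator H x‖}
          + ENNReal.ofReal η := by
  obtain ⟨c, hc, hcut⟩ := exists_smooth_lipschitz_truncation n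
  obtain ⟨c₂, hc₂, hmat⟩ := exists_norm_le_matrixOf n
  -- Averages of the mollified Jacobian are at most `2a`, and `c₂` converts Jacobian norms to
  -- operator norms. The added `1` ensures `D ≥ 1`, so that the final `λ = D a` is at least `1`.
  refine ⟨c, ‖matrixOf n‖ * (c * (2 * c₂)) + 1, hc, ?_, 2 * c₂, by positivity, ?_⟩
  · have : 0 ≤ ‖matrixOf n‖ * (c * (2 * c₂)) := by positivity
    linarith
  intro Ω hΩ hΩf w H hw hH hwH K R hR hK φ hφ a ha s₀ hs₀ hsR ρ hρ hρR hρs s hs η hη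
  set z := mollify φ (Ω.indicator w) with hz_def
  set G := mollify φ (Ω.indicator H) with hG_def
  have hwi : Integrable (Ω.indicator w) := hw.indicator_of_normed hΩ
  have hHi : Integrable (Ω.indicator H) := hH.indicator_of_normed hΩ
  have hz : ContDiff ℝ ∞ z := contDiff_mollify φ hwi.locallyIntegrable
  have hG : Continuous G := (contDiff_mollify φ hHi.locallyIntegrable).continuous
  have hJ : ∀ x ∈ K, ∀ y ∈ Metric.closedBall x R, jacobian z y = G y := by
    intro x hx y hy
    refine jacobian_mollify hΩ hw hH hwH φ ((Metric.closedBall_subset_closedBall' ?_).trans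
      (hK x hx))
    have := Metric.mem_closedBall.1 hy
    linarith
  set S₁ := {x : Vec n | ∃ t, 0 < t ∧ t ≤ R ∧ ENNReal.ofReal (2 * a) *
    volume (Metric.ball x t) < ∫⁻ y in Metric.ball x t, ‖G y‖ₑ} with hS₁
  set S₂ := {x | x ∈ Ω ∧ s₀ / 2 < ‖∫ y in Metric.ball x ρ, z y‖
    / volume.real (Metric.ball x ρ)} with hS₂
  set S₃ := {x | x ∈ Ω ∧ s / 2 < ‖G x - Ω.indicator H x‖} with hS₃
  let S : Set (Vec n) := {x | x ∈ K ∧ x ∈ Ω ∧ x ∉ S₁ ∧ x ∉ S₂}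
  have hz1 : ContDiff ℝ 1 z := hz.of_le (by simp)
  have hzc := hz1.continuous_fderiv one_ne_zero
  have hav : ∀ x ∈ S, ∀ t, 0 < t → t ≤ R → ∫ y in Metric.ball x t, ‖fderiv ℝ z y‖
      ≤ 2 * c₂ * a * volume.real (Metric.ball x t) := by
    intro x hx t ht htR
    have h1 : ∫⁻ y in Metric.ball x t, ‖G y‖ₑ ≤ ENNReal.ofReal (2 * a) *
        volume (Metric.ball x t) := by
      by_contra hcon
      exact hx.2.2.1 ⟨t, ht, htR, not_le.1 hcon⟩
    have h2 : ∫ y in Metric.ball x t, ‖G y‖ ≤ 2 * a * volume.real (Metric.ball x t) := by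
      rw [integral_norm_eq_lintegral_enorm hG.aestronglyMeasurable]
      refine (ENNReal.toReal_mono (ENNReal.mul_ne_top ENNReal.ofReal_ne_top
        measure_ball_lt_top.ne) h1).trans_eq ?_
      rw [ENNReal.toReal_mul, ENNReal.toReal_ofReal (by positivity)]
      rfl
    have h3 : ∫ y in Metric.ball x t, ‖fderiv ℝ z y‖ ≤ ∫ y in Metric.ball x t, c₂ * ‖G y‖ := by
      refine setIntegral_mono_on (Continuous.integrableOn_ball (by fun_prop) x t)
        (Continuous.integrableOn_ball (by fun_prop) x t) Metric.isOpen_ball.measurableSet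
        fun y hy => ?_
      rw [← hJ x hx.1 y (Metric.closedBall_subset_closedBall htR
        (Metric.ball_subset_closedBall hy))]
      exact hmat _
    rw [integral_const_mul] at h3
    calc _ ≤ _ := h3
      _ ≤ c₂ * (2 * a * volume.real (Metric.ball x t)) := by gcongr
      _ = _ := by ring
  have hzs : ∀ x ∈ S, ‖z x‖ ≤ s₀ := by
    intro x hx
    have h1 := norm_le_of_average_fderiv_le hz1 hρ fun t ht htρ => hav x hx t ht (htρ.trans hρR)
    have h2 : ‖∫ y in Metric.ball x ρ, z y‖ / volume.real (Metric.ball x ρ) ≤ s₀ / 2 := by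
      by_contra hcon
      exact hx.2.2.2 ⟨hx.2.1, not_le.1 hcon⟩
    linarith
  obtain ⟨g, hg, hgd, hgs, hgm⟩ := hcut z hz1 S R (2 * c₂ * a) s₀ (by positivity) hs₀.le hsR hav hzs
    Ω hΩf η hη (s / (2 * (‖matrixOf n‖ + 1))) (by positivity)
  refine ⟨g, hg, fun x => ?_, hgs, ?_⟩
  · refine (norm_jacobian_le g x).trans ?_
    calc ‖matrixOf n‖ * ‖fderiv ℝ g x‖ ≤ ‖matrixOf n‖ * (c * (2 * c₂ * a)) := by
          gcongr; exact hgd x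
      _ ≤ _ := by
          rw [add_mul]
          linarith
  · have hsub : {x | x ∈ Ω ∧ s < ‖jacobian g x - H x‖} ⊆ (Ω \ K) ∪ S₁ ∪ S₂ ∪ S₃ ∪
        {x | x ∈ Ω ∧ x ∈ S ∧ s / (2 * (‖matrixOf n‖ + 1)) <
          ‖fderiv ℝ g x - fderiv ℝ z x‖} := by
      rintro x ⟨hxΩ, hxs⟩
      by_cases hxK : x ∈ K
      swap; · exact Or.inl (Or.inl (Or.inl (Or.inl ⟨hxΩ, hxK⟩)))
      by_cases hx1 : x ∈ S₁
      · exact Or.inl (Or.inl (Or.inl (Or.inr hx1)))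
      by_cases hx2 : x ∈ S₂
      · exact Or.inl (Or.inl (Or.inr hx2))
      by_cases hx3 : x ∈ S₃
      · exact Or.inl (Or.inr hx3)
      refine Or.inr ⟨hxΩ, ⟨hxK, hxΩ, hx1, hx2⟩, ?_⟩
      have h3 : ‖G x - H x‖ ≤ s / 2 := by
        by_contra hcon
        refine hx3 ⟨hxΩ, ?_⟩
        rw [Set.indicator_of_mem hxΩ]
        exact not_le.1 hcon
      rw [← hJ x hxK x (Metric.mem_closedBall_self hR.le)] at h3
      have h4 := norm_sub_le_norm_sub_add_norm_sub (jacobian g x) (jacobian z x) (H x)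
      have h5 : ‖jacobian g x - jacobian z x‖
          ≤ ‖matrixOf n‖ * ‖fderiv ℝ g x - fderiv ℝ z x‖ := by
        rw [jacobian_eq_matrixOf, jacobian_eq_matrixOf, ← map_sub]
        exact (matrixOf n).le_opNorm _
      rw [div_lt_iff₀ (by positivity)]
      have h6 := norm_nonneg (fderiv ℝ g x - fderiv ℝ z x)
      nlinarith [norm_nonneg (matrixOf n)]
    refine (measure_mono hsub).trans ?_
    refine (measure_union_le _ _).trans (add_le_add ?_ hgm)
    refine (measure_union_le _ _).trans (add_le_add ?_ le_rfl)
    refine (measure_union_le _ _).trans (add_le_add ?_ le_rfl)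
    exact measure_union_le _ _

/-- Pointwise convergence of averages at a fixed radius gives convergence in measure on the
finite-measure set `Ω`; this takes the place of compact embedding. -/
theorem tendsto_volume_integral_ball {n : ℕ} {Ω : Set (Vec n)} (hΩf : volume Ω ≠ ⊤)
    {f : ℕ → Vec n → Vec n} (hf : ∀ k, Integrable (f k)) {ρ : ℝ}
    (hlim : ∀ x, Tendsto (fun k => ∫ y in Metric.ball x ρ, f k y) atTop (𝓝 0)) {b : ℝ}
    (hb : 0 < b) :
    Tendsto (fun k => volume {x | x ∈ Ω ∧ b ≤ ‖∫ y in Metric.ball x ρ, f k y‖}) atTop (𝓝 0) := by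
  have : IsFiniteMeasure (volume.restrict Ω) := ⟨by simpa using hΩf.lt_top⟩
  have hm : ∀ k, AEStronglyMeasurable (fun x => ∫ y in Metric.ball x ρ, f k y)
      (volume.restrict Ω) := by
    intro k
    have hset : MeasurableSet {q : Vec n × Vec n | dist q.2 q.1 < ρ} :=
      (isOpen_lt (by fun_prop) continuous_const).measurableSet
    have h1 : AEStronglyMeasurable ({q : Vec n × Vec n | dist q.2 q.1 < ρ}.indicator
        fun q => f k q.2) ((volume.restrict Ω).prod volume) :=
      ((hf k).1.comp_snd).indicator hset
    refine h1.integral_prod_right'.congr (ae_of_all _ fun x => ?_)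
    simp only []
    rw [← integral_indicator Metric.isOpen_ball.measurableSet]
    rfl
  have h := tendstoInMeasure_of_tendsto_ae hm (g := fun _ => 0) (ae_of_all _ hlim)
  rw [tendstoInMeasure_iff_norm] at h
  refine tendsto_of_tendsto_of_tendsto_of_le_of_le tendsto_const_nhds (h b hb)
    (fun _ => zero_le) fun k => ?_
  refine le_trans (measure_mono ?_) (Measure.le_restrict_apply _ _)
  rintro x ⟨hx, hxb⟩
  exact ⟨by simpa using hxb, hx⟩

theorem volume_lt_norm_le {n : ℕ} {F : Type*} [NormedAddCommGroup F] {f : Vec n → F}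
    (hf : Integrable f) {b ε : ℝ} (hb : 0 < b) (hε : ∫ x, ‖f x‖ ≤ ε) :
    volume {x | b < ‖f x‖} ≤ ENNReal.ofReal (ε / b) := by
  have h := mul_meas_ge_le_lintegral₀ hf.1.enorm (ENNReal.ofReal b)
  rw [← ofReal_integral_norm_eq_lintegral_enorm hf] at h
  rw [ENNReal.ofReal_div_of_pos hb, ENNReal.le_div_iff_mul_le
    (Or.inl (by simpa using hb)) (Or.inl ENNReal.ofReal_ne_top), mul_comm]
  refine le_trans ?_ (h.trans (ENNReal.ofReal_le_ofReal hε))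
  refine mul_le_mul' le_rfl (measure_mono fun x hx => ?_)
  simp only [Set.mem_ofPred_eq] at hx ⊢
  rw [← ofReal_norm]
  exact ENNReal.ofReal_le_ofReal hx.le

/-- The order of quantifiers matters: `λ` must not depend on `s`, for the truncations have to tend
to zero with a fixed gradient bound. The good level depends on `k` but ranges over a finite set, so
one level recurs infinitely often; hence "frequently", which is enough for an argument by
contradiction. -/
theorem exists_truncation_frequently {n : ℕ} {p : ℝ} (hp : 1 < p) {Ω : Set (Vec n)}
    (hΩ : IsOpen Ω) (hΩf : volume Ω ≠ ⊤) {w : ℕ → Vec n → Vec n} {H : ℕ → Vec n → Mat n}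
    (hw : ∀ k, IntegrableOn (w k) Ω)
    (hH : ∀ k, MemLp (H k) (ENNReal.ofReal p) (volume.restrict Ω))
    (hwH : ∀ k, IsWeakGradient Ω (w k) (H k)) {M : ℝ} (hM : ∀ k, ∫ x in Ω, ‖H k x‖ ^ p ≤ M)
    (hlim : ∀ x ρ, Tendsto (fun k => ∫ y in Metric.ball x ρ, Ω.indicator (w k) y) atTop (𝓝 0))
    {ε : ℝ} (hε : 0 < ε) :
    ∃ lam : ℝ, 1 ≤ lam ∧ ∀ s > 0, ∃ᶠ k in atTop, ∃ g : Vec n → Vec n, ContDiff ℝ ∞ g ∧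
      (∀ x, ‖jacobian g x‖ ≤ lam) ∧ (∀ x, ‖g x‖ ≤ s) ∧
      volume {x | x ∈ Ω ∧ s < ‖jacobian g x - H k x‖} ≤ ENNReal.ofReal (ε / lam ^ p) := by
  have hfin : IsFiniteMeasure (volume.restrict Ω) := ⟨by simpa using hΩf.lt_top⟩
  have hHi : ∀ k, IntegrableOn (H k) Ω := fun k =>
    (hH k).integrable (by rw [← ENNReal.ofReal_one]; exact ENNReal.ofReal_le_ofReal hp.le)
  have hM0 : 0 ≤ M := (integral_nonneg fun x => by positivity).trans (hM 0)
  obtain ⟨c, D, hc, hD, b, hb, htr⟩ := exists_truncation_at_level n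
  set r := (2 : ℝ) ^ (p - 1) with hr
  have hr1 : 1 < r := by rw [hr]; exact Real.one_lt_rpow one_lt_two (by linarith)
  have hr0 : 0 < r - 1 := by linarith
  -- Large enough that the maximal-function set has measure at most `ε / (2 (D a)^p)`, whichever
  -- level `a` is selected.
  obtain ⟨N, hN⟩ := exists_nat_gt (2 * D ^ p * 5 ^ n * (r / (r - 1) * M) / ε)
  have hD0 : 0 < D := by linarith
  have hN0 : 0 < N := by
    have : (0 : ℝ) < N := lt_of_le_of_lt (by positivity) hN
    exact_mod_cast this
  have hNr : (0 : ℝ) < N := by exact_mod_cast hN0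
  -- Bounds each of the four remaining bad sets; using the top level `2^N` allows `K` and `R` to be
  -- fixed before the actual level is known.
  set η := ε / (8 * (D * 2 ^ N) ^ p) with hη
  have hη0 : 0 < η := by positivity
  obtain ⟨K, hKΩ, hKc, hKv⟩ := hΩ.measurableSet.exists_isCompact_sdiff_lt hΩf
    (ENNReal.ofReal_pos.2 hη0).ne'
  obtain ⟨R₂, hR₂, hKR⟩ := hKc.exists_cthickening_subset_open hΩ hKΩ
  have hR : 0 < R₂ / 2 := half_pos hR₂
  set R := R₂ / 2 with hRdef
  have hKball : ∀ x ∈ K, Metric.closedBall x (2 * R) ⊆ Ω := fun x hx => by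
    rw [hRdef, mul_div_cancel₀ _ two_ne_zero]
    exact (Metric.closedBall_subset_cthickening hx _).trans hKR
  have hex : ∀ k : ℕ, _ := fun k => exists_mollify_close
    ((hw k).indicator_of_normed hΩ.measurableSet) ((hHi k).indicator_of_normed hΩ.measurableSet)
    hR (Nat.one_div_pos_of_nat (α := ℝ) (n := k))
  choose φ hφR hφw hφH using hex
  have hlev : ∀ k, _ := fun k => exists_dyadic_level hp (hH k) (hM k) hN0
  choose j hjN hj using hlev
  obtain ⟨j₀, hj₀⟩ : ∃ j₀, ∃ᶠ k in atTop, j k = j₀ := by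
    by_contra! hcon
    have h1 : ∀ᶠ k in atTop, ∀ i ∈ Finset.range N, j k ≠ i :=
      (Filter.eventually_all_finset _).2 fun i _ => hcon i
    obtain ⟨k, hk⟩ := h1.exists
    exact hk (j k) (Finset.mem_range.2 (hjN k)) rfl
  have hj₀N : j₀ < N := by
    obtain ⟨k, hk⟩ := hj₀.exists
    exact hk ▸ hjN k
  set a : ℝ := 2 ^ j₀ with ha_def
  have ha : 0 < a := by positivity
  have ha1 : 1 ≤ a := one_le_pow₀ one_le_two
  have hlam : 1 ≤ D * a := one_le_mul_of_one_le_of_one_le hD ha1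
  have hηle : η ≤ ε / (8 * (D * a) ^ p) := by
    rw [hη]
    have : a ≤ 2 ^ N := pow_le_pow_right₀ one_le_two hj₀N.le
    gcongr
  refine ⟨D * a, hlam, fun s hs => ?_⟩
  -- The first entry yields `‖g‖ ≤ s`, the second the condition for the Lipschitz estimate between
  -- distant points.
  set s₀ := min (s / c) (b * a * R / 4) with hs₀_def
  have hc0 : 0 < c := by linarith
  have hs₀ : 0 < s₀ := lt_min (by positivity) (by positivity)
  have hs₀1 : 4 * s₀ ≤ b * a * R := by
    have := min_le_right (s / c) (b * a * R / 4)
    rw [← hs₀_def] at this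
    linarith
  have hs₀2 : c * s₀ ≤ s := by
    have := min_le_left (s / c) (b * a * R / 4)
    rw [← hs₀_def, le_div_iff₀ hc0] at this
    linarith
  set ρ := min R (s₀ / (2 * (b * a))) with hρ_def
  have hρ : 0 < ρ := lt_min hR (by positivity)
  have hρR : ρ ≤ R := min_le_left _ _
  have hρs : ρ * (b * a) ≤ s₀ / 2 := by
    have := min_le_right R (s₀ / (2 * (b * a)))
    rw [← hρ_def, le_div_iff₀ (by positivity)] at this
    linarith
  set V := volume.real (Metric.ball (0 : Vec n) ρ) with hV_def
  have hV : 0 < V := volume_real_ball_pos 0 hρ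
  have hVx : ∀ x : Vec n, volume.real (Metric.ball x ρ) = V := fun x => by
    rw [hV_def, volume_real_ball x hρ, volume_real_ball 0 hρ]
  have hone : Tendsto (fun k : ℕ => 1 / ((k : ℝ) + 1)) atTop (𝓝 0) :=
    tendsto_one_div_add_atTop_nhds_zero_nat
  have e1 : ∀ᶠ k : ℕ in atTop, 1 / ((k : ℝ) + 1) ≤ V * s₀ / 4 :=
    hone.eventually_le_const (by positivity)
  have e2 : ∀ᶠ k : ℕ in atTop, 1 / ((k : ℝ) + 1) ≤ η * (s / 2) :=
    hone.eventually_le_const (by positivity)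
  have e3 : ∀ᶠ k in atTop, volume {x | x ∈ Ω ∧ V * s₀ / 4 ≤
      ‖∫ y in Metric.ball x ρ, Ω.indicator (w k) y‖} ≤ ENNReal.ofReal η :=
    (tendsto_volume_integral_ball hΩf
      (fun k => (hw k).indicator_of_normed hΩ.measurableSet) (fun x => hlim x ρ)
      (by positivity)).eventually_le_const (ENNReal.ofReal_pos.2 hη0)
  refine (hj₀.and_eventually (e1.and (e2.and e3))).mono ?_
  rintro k ⟨hjk, hk1, hk2, hk3⟩
  obtain ⟨g, hg, hgJ, hgs, hgm⟩ := htr Ω hΩ.measurableSet hΩf (w k) (H k) (hw k) (hHi k) (hwH k)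
    K R hR hKball (φ k) (hφR k) a ha s₀ hs₀ hs₀1 ρ hρ hρR hρs s hs η hη0
  refine ⟨g, hg, hgJ, fun x => (hgs x).trans hs₀2, hgm.trans ?_⟩
  have b2 : volume {x : Vec n | ∃ t, 0 < t ∧ t ≤ R ∧ ENNReal.ofReal (2 * a) *
      volume (Metric.ball x t) < ∫⁻ y in Metric.ball x t, ‖mollify (φ k) (Ω.indicator (H k)) y‖ₑ}
      ≤ ENNReal.ofReal (ε / (2 * (D * a) ^ p)) := by
    set S := {x : Vec n | ∃ t, 0 < t ∧ t ≤ R ∧ ENNReal.ofReal (2 * a) *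
      volume (Metric.ball x t) < ∫⁻ y in Metric.ball x t, ‖mollify (φ k) (Ω.indicator (H k)) y‖ₑ}
    have h1 := volume_exists_average_norm_gt_le (mollify (φ k) (Ω.indicator (H k))) ha R
    have h2 := lintegral_mollify_sub_le (φ k)
      ((hHi k).indicator_of_normed hΩ.measurableSet).1 ha.le
    have h3 : ∫⁻ x, ENNReal.ofReal (‖Ω.indicator (H k) x‖ - a)
        = ∫⁻ x in Ω, ENNReal.ofReal (‖H k x‖ - a) := by
      rw [← lintegral_indicator hΩ.measurableSet]
      refine lintegral_congr fun x => ?_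
      by_cases hx : x ∈ Ω
      · simp [hx]
      · simp [hx, ha.le]
    have h4 := hj k
    rw [hjk, ← ha_def] at h4
    -- The weak-type inequality supplies the one factor `a` missing from the weight `a^(p-1)`.
    have hap : r ^ j₀ * a = a ^ p := by
      rw [hr, ha_def, ← Real.rpow_natCast, ← Real.rpow_mul zero_le_two, ← Real.rpow_natCast,
        ← Real.rpow_mul zero_le_two, ← Real.rpow_add two_pos]
      congr 1
      ring
    have h5 : ENNReal.ofReal (a ^ p) * volume S
        ≤ ENNReal.ofReal (5 ^ n * (r / (r - 1) * M / N)) := by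
      rw [← hap, ENNReal.ofReal_mul (by positivity), mul_assoc, ENNReal.ofReal_mul (by positivity),
        show ENNReal.ofReal ((5 : ℝ) ^ n) = 5 ^ n by
          rw [ENNReal.ofReal_pow (by norm_num), ENNReal.ofReal_ofNat]]
      calc ENNReal.ofReal (r ^ j₀) * (ENNReal.ofReal a * volume S)
          ≤ ENNReal.ofReal (r ^ j₀) * (5 ^ n * ∫⁻ x in Ω, ENNReal.ofReal (‖H k x‖ - a)) := by
            rw [← h3]
            exact mul_le_mul' le_rfl (h1.trans (mul_le_mul' le_rfl h2))
        _ = 5 ^ n * (ENNReal.ofReal (r ^ j₀) * ∫⁻ x in Ω, ENNReal.ofReal (‖H k x‖ - a)) := by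
            ring
        _ ≤ _ := mul_le_mul' le_rfl h4
    have h6 : 5 ^ n * (r / (r - 1) * M / N) ≤ a ^ p * (ε / (2 * (D * a) ^ p)) := by
      rw [div_lt_iff₀ hε] at hN
      rw [Real.mul_rpow hD0.le ha.le, ← mul_div_assoc, ← mul_div_assoc, div_le_div_iff₀ hNr
        (by positivity)]
      have : 0 < a ^ p := by positivity
      nlinarith
    have h7 := h5.trans (ENNReal.ofReal_le_ofReal h6)
    rw [ENNReal.ofReal_mul (by positivity)] at h7
    exact (ENNReal.mul_le_mul_iff_right (by simp only [ne_eq, ENNReal.ofReal_eq_zero, not_le]; positivity)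
      ENNReal.ofReal_ne_top).1 h7
  have b3 : volume {x | x ∈ Ω ∧ s₀ / 2 < ‖∫ y in Metric.ball x ρ,
      mollify (φ k) (Ω.indicator (w k)) y‖ / volume.real (Metric.ball x ρ)}
      ≤ ENNReal.ofReal η := by
    refine (measure_mono ?_).trans hk3
    rintro x ⟨hx, hxs⟩
    refine ⟨hx, ?_⟩
    rw [hVx, lt_div_iff₀ hV] at hxs
    obtain ⟨him, hie⟩ := hφw k
    have hif := (hw k).indicator_of_normed hΩ.measurableSet
    have h1 : ‖(∫ y in Metric.ball x ρ, mollify (φ k) (Ω.indicator (w k)) y)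
        - ∫ y in Metric.ball x ρ, Ω.indicator (w k) y‖ ≤ V * s₀ / 4 := by
      rw [← integral_sub him.integrableOn hif.integrableOn]
      refine (norm_integral_le_integral_norm _).trans ?_
      refine (setIntegral_le_integral (him.sub hif).norm
        (ae_of_all _ fun y => norm_nonneg _)).trans (hie.trans hk1)
    have h2 := norm_sub_norm_le (∫ y in Metric.ball x ρ, mollify (φ k) (Ω.indicator (w k)) y)
      (∫ y in Metric.ball x ρ, Ω.indicator (w k) y)
    linarith
  have b4 : volume {x | x ∈ Ω ∧ s / 2 < ‖mollify (φ k) (Ω.indicator (H k)) x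
      - Ω.indicator (H k) x‖} ≤ ENNReal.ofReal η := by
    obtain ⟨him, hie⟩ := hφH k
    have hif := (hHi k).indicator_of_normed hΩ.measurableSet
    refine (measure_mono (fun x hx => hx.2)).trans
      ((volume_lt_norm_le (him.sub hif) (half_pos hs) hie).trans (ENNReal.ofReal_le_ofReal ?_))
    rw [div_le_iff₀ (half_pos hs)]
    exact hk2
  calc _ ≤ ENNReal.ofReal η + ENNReal.ofReal (ε / (2 * (D * a) ^ p)) + ENNReal.ofReal η
        + ENNReal.ofReal η + ENNReal.ofReal η := by
        gcongr
    _ = ENNReal.ofReal (ε / (2 * (D * a) ^ p) + 4 * η) := by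
        rw [← ENNReal.ofReal_add hη0.le (by positivity), ← ENNReal.ofReal_add (by positivity) hη0.le,
          ← ENNReal.ofReal_add (by positivity) hη0.le, ← ENNReal.ofReal_add (by positivity) hη0.le]
        congr 1
        ring
    _ ≤ ENNReal.ofReal (ε / (D * a) ^ p) := by
        refine ENNReal.ofReal_le_ofReal ?_
        have h1 : ε / (2 * (D * a) ^ p) + 4 * (ε / (8 * (D * a) ^ p)) = ε / (D * a) ^ p := by
          have : (0 : ℝ) < (D * a) ^ p := by positivity
          field_simp
          norm_num
        linarith

/-! ### Lower semicontinuity -/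

theorem Continuous.exists_norm_sub_le {V F : Type*} [NormedAddCommGroup V] [ProperSpace V]
    [NormedAddCommGroup F] {f : V → F} (hf : Continuous f) (R : ℝ) {δ : ℝ} (hδ : 0 < δ) :
    ∃ s > 0, ∀ a b, ‖a‖ ≤ R → ‖b - a‖ ≤ s → ‖f b - f a‖ ≤ δ := by
  have h := (isCompact_closedBall (0 : V) (R + 1)).uniformContinuousOn_of_continuous
    hf.continuousOn
  obtain ⟨r, hr, H⟩ := Metric.uniformContinuousOn_iff.1 h δ hδ
  refine ⟨min (r / 2) 1, by positivity, fun a b ha hb => ?_⟩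
  have h1 := hb.trans (min_le_left _ _)
  have h2 := hb.trans (min_le_right _ _)
  have h3 := norm_le_norm_add_norm_sub' b a
  have := H b (by rw [mem_closedBall_zero_iff]; linarith) a
    (by rw [mem_closedBall_zero_iff]; linarith) (by rw [dist_eq_norm]; linarith)
  rw [dist_eq_norm] at this
  exact this.le

theorem Real.add_rpow_le_two_rpow_mul {a b p : ℝ} (ha : 0 ≤ a) (hb : 0 ≤ b) (hp : 0 ≤ p) :
    (a + b) ^ p ≤ 2 ^ p * (a ^ p + b ^ p) := by
  have h1 : a + b ≤ 2 * max a b := by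
    linarith [le_max_left a b, le_max_right a b]
  have h0 : 0 ≤ max a b := ha.trans (le_max_left _ _)
  refine (Real.rpow_le_rpow (by positivity) h1 hp).trans ?_
  rw [Real.mul_rpow zero_le_two h0]
  refine mul_le_mul_of_nonneg_left ?_ (by positivity)
  rcases max_choice a b with h | h <;> rw [h]
  · linarith [Real.rpow_nonneg hb p]
  · linarith [Real.rpow_nonneg ha p]

/-- Young's inequality with a small parameter, by comparing `b` with `δa`. -/
theorem Real.rpow_sub_one_mul_le {a b p δ : ℝ} (ha : 0 < a) (hb : 0 ≤ b) (hp : 1 < p)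
    (hδ : 0 < δ) : a ^ (p - 1) * b ≤ δ * a ^ p + δ ^ (1 - p) * b ^ p := by
  rcases le_total b (δ * a) with h | h
  · have h1 : a ^ (p - 1) * b ≤ a ^ (p - 1) * (δ * a) :=
      mul_le_mul_of_nonneg_left h (by positivity)
    have h2 : a ^ (p - 1) * (δ * a) = δ * a ^ p := by
      have : a ^ (p - 1) * a = a ^ p := by rw [← Real.rpow_add_one ha.ne', sub_add_cancel]
      rw [← this]
      ring
    have : 0 ≤ δ ^ (1 - p) * b ^ p := by positivity
    linarith
  · have hb0 : 0 < b := lt_of_lt_of_le (by positivity) h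
    have h1 : a ≤ b / δ := by rw [le_div_iff₀ hδ]; linarith
    have h2 : a ^ (p - 1) * b ≤ (b / δ) ^ (p - 1) * b :=
      mul_le_mul_of_nonneg_right (Real.rpow_le_rpow ha.le h1 (by linarith)) hb
    have h3 : (b / δ) ^ (p - 1) * b = δ ^ (1 - p) * b ^ p := by
      have : b ^ (p - 1) * b = b ^ p := by rw [← Real.rpow_add_one hb0.ne', sub_add_cancel]
      rw [Real.div_rpow hb hδ.le, ← this, show 1 - p = -(p - 1) by ring, Real.rpow_neg hδ.le]
      field_simp
    have : 0 ≤ δ * a ^ p := by positivity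
    linarith

theorem Integrable.exists_setIntegral_le {α : Type*} [MeasurableSpace α] {μ : Measure α}
    {f : α → ℝ} (hf : Integrable f μ) (hf0 : ∀ x, 0 ≤ f x) {ε : ℝ} (hε : 0 < ε) :
    ∃ τ > 0, ∀ s, μ s ≤ ENNReal.ofReal τ → ∫ x in s, f x ∂μ ≤ ε := by
  have h1 : ∫⁻ x, ENNReal.ofReal (f x) ∂μ ≠ ⊤ := by
    rw [← ofReal_integral_eq_lintegral_ofReal hf (ae_of_all _ hf0)]
    exact ENNReal.ofReal_ne_top
  obtain ⟨δ, hδ, H⟩ := exists_pos_setLIntegral_lt_of_measure_lt h1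
    (ENNReal.ofReal_pos.2 hε).ne'
  obtain ⟨τ, hτ, hτδ⟩ : ∃ τ : ℝ, 0 < τ ∧ ENNReal.ofReal τ < δ := by
    obtain ⟨q, hq0, hq⟩ := ENNReal.lt_iff_exists_nnreal_btwn.1 hδ
    exact ⟨q, by exact_mod_cast hq0, by simpa using hq⟩
  refine ⟨τ, hτ, fun s hs => ?_⟩
  have h2 := H s (hs.trans_lt hτδ)
  rw [← ofReal_integral_eq_lintegral_ofReal hf.restrict (ae_of_all _ hf0)] at h2
  exact ((ENNReal.ofReal_lt_ofReal_iff hε).1 h2).le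

/-- Where `G` and `H` are close, `G` is bounded by `λ` and dominated convergence applies. Elsewhere
only an upper bound for `W(x, ζ + G)`, of order `λ^p` plus an integrable function, and the lower
bound for `W(x, ζ + H)` are used. The factor `λ^p` cancels against the measure bound, so `τ` can be
chosen before `λ`; no bound on `H` in `L^p` is required. -/
theorem IsBulkEnergy.eventually_integral_add_sub_le {n : ℕ} {p : ℝ} (hp : 1 < p)
    {Ω : Set (Vec n)} (hΩ : MeasurableSet Ω) (hΩf : volume Ω ≠ ⊤)
    {W : Vec n → Mat n → ℝ} (hW : IsBulkEnergy p Ω W) {C : ℝ} {β : Vec n → ℝ}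
    (hβ : IsGrowthWeight p Ω W C β) {ζ : Vec n → Mat n}
    (hζ : MemLp ζ (ENNReal.ofReal p) (volume.restrict Ω)) {ε : ℝ} (hε : 0 < ε) :
    ∃ τ > 0, ∀ lam : ℝ, 1 ≤ lam → ∀ G H : ℕ → Vec n → Mat n,
      (∀ m, AEStronglyMeasurable (G m) (volume.restrict Ω)) → (∀ m x, ‖G m x‖ ≤ lam) →
      (∀ m, MemLp (H m) (ENNReal.ofReal p) (volume.restrict Ω)) →
      ∀ s : ℕ → ℝ, Tendsto s atTop (𝓝 0) →
      (∀ m, volume {x | x ∈ Ω ∧ s m < ‖G m x - H m x‖} ≤ ENNReal.ofReal (τ / lam ^ p)) →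
      ∀ᶠ m in atTop, (∫ x in Ω, W x (ζ x + G m x)) - ε ≤ ∫ x in Ω, W x (ζ x + H m x) := by
  have : IsFiniteMeasure (volume.restrict Ω) := ⟨by simpa using hΩf.lt_top⟩
  have hp0 : 0 < p := by linarith
  have hC := hβ.const_nonneg
  set μ := volume.restrict Ω with hμ
  let c : ℝ := C * 2 ^ p
  have hc : 0 ≤ c := by positivity
  -- The coefficient `c` comes from the upper bound for `W` at `ζ + G`, and `C` from the lower bound
  -- at `ζ + H`.
  let h : Vec n → ℝ := fun x => (C + c) * (‖ζ x‖ + β x) ^ p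
  have hh0 : ∀ x, 0 ≤ h x := fun x => by
    have := hβ.pos x
    positivity
  have hh : Integrable h μ := (hβ.integrable_rpow hp hζ).const_mul _
  obtain ⟨τ₀, hτ₀, Hτ⟩ := Integrable.exists_setIntegral_le hh hh0 (show 0 < ε / 4 by positivity)
  refine ⟨min τ₀ (ε / (4 * (c + 1))), by positivity, fun lam hlam G H hG hGlam hH s hs hT => ?_⟩
  set τ := min τ₀ (ε / (4 * (c + 1)))
  have hτ0 : 0 < τ := by positivity
  have hlamp : 1 ≤ lam ^ p := Real.one_le_rpow hlam hp0.le
  let T : ℕ → Set (Vec n) := fun m => {x | s m < ‖G m x - H m x‖}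
  have hTm : ∀ m, NullMeasurableSet (T m) μ := fun m =>
    nullMeasurableSet_lt aemeasurable_const ((hG m).sub (hH m).1).norm.aemeasurable
  have hTμ : ∀ m, μ (T m) ≤ ENNReal.ofReal (τ / lam ^ p) := fun m => by
    rw [hμ, Measure.restrict_apply' hΩ]
    exact (measure_mono (fun x hx => ⟨hx.2, hx.1⟩ :
      T m ∩ Ω ⊆ {x | x ∈ Ω ∧ s m < ‖G m x - H m x‖})).trans (hT m)
  have hGp : ∀ m, MemLp (G m) (ENNReal.ofReal p) μ := fun m =>
    MemLp.of_bound (hG m) lam (ae_of_all _ (hGlam m))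
  have iG : ∀ m, Integrable (fun x => W x (ζ x + G m x)) μ := fun m =>
    hW.integrable hp hβ (hζ.add (hGp m))
  have iH : ∀ m, Integrable (fun x => W x (ζ x + H m x)) μ := fun m =>
    hW.integrable hp hβ (hζ.add (hH m))
  let q : ℕ → Vec n → ℝ := fun m =>
    (T m)ᶜ.indicator fun x => |W x (ζ x + H m x) - W x (ζ x + G m x)|
  have hqm : ∀ m, AEStronglyMeasurable (q m) μ := fun m =>
    ((iH m).sub (iG m)).abs.1.indicator₀ (hTm m).compl
  have hqlim : Tendsto (fun m => ∫ x, q m x ∂μ) atTop (𝓝 0) := by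
    have hadd : MemLp (fun x => ‖ζ x‖ + (lam + 1)) (ENNReal.ofReal p) μ :=
      hζ.norm.add (memLp_const _)
    have hs1 : ∀ᶠ m in atTop, s m ≤ 1 := hs.eventually_le_const one_pos
    have := tendsto_integral_filter_of_dominated_convergence (μ := μ) (l := atTop)
      (F := q) (f := fun _ => 0) (fun x => 2 * (C * (‖‖ζ x‖ + (lam + 1)‖ + β x) ^ p))
      (Eventually.of_forall hqm) ?_ (((hβ.integrable_rpow hp hadd).const_mul C).const_mul 2) ?_
    · simpa using this
    · filter_upwards [hs1] with m hm
      filter_upwards [hβ.abs_le] with x hx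
      have hβx := hβ.pos x
      rw [Real.norm_of_nonneg (by positivity : 0 ≤ ‖ζ x‖ + (lam + 1))]
      by_cases hxT : x ∈ T m
      · simp only [q, Set.indicator_of_notMem (Set.notMem_compl_iff.2 hxT), norm_zero]
        positivity
      · have h2 : ‖G m x - H m x‖ ≤ s m := not_lt.1 hxT
        simp only [q, Set.indicator_of_mem (Set.mem_compl hxT)]
        have h3 : ∀ ξ : Mat n, ‖ξ‖ ≤ ‖ζ x‖ + (lam + 1) →
            |W x ξ| ≤ C * (‖ζ x‖ + (lam + 1) + β x) ^ p := fun ξ hξ =>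
          (hx ξ).trans (mul_le_mul_of_nonneg_left
            (Real.rpow_le_rpow (by positivity) (by linarith) hp0.le) hC)
        have h4 := h3 (ζ x + H m x) (by
          have e1 := norm_add_le (ζ x) (H m x)
          have e2 := norm_le_norm_add_norm_sub' (H m x) (G m x)
          rw [norm_sub_rev] at e2
          linarith [hGlam m x])
        have h5 := h3 (ζ x + G m x) (by
          have e1 := norm_add_le (ζ x) (G m x)
          linarith [hGlam m x])
        rw [Real.norm_eq_abs, abs_abs]
        exact (abs_sub _ _).trans (by linarith)
    · filter_upwards [hW.differentiable] with x hx
      refine Metric.tendsto_nhds.2 fun δ hδ => ?_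
      obtain ⟨r, hr, Hr⟩ := hx.continuous.exists_norm_sub_le (‖ζ x‖ + lam) (half_pos hδ)
      filter_upwards [hs.eventually_le_const hr] with m hm
      rw [dist_zero_right]
      refine lt_of_le_of_lt ?_ (half_lt_self hδ)
      by_cases hxT : x ∈ T m
      · simp only [q, Set.indicator_of_notMem (Set.notMem_compl_iff.2 hxT), norm_zero]
        positivity
      · have h2 : ‖G m x - H m x‖ ≤ s m := not_lt.1 hxT
        simp only [q, Set.indicator_of_mem (Set.mem_compl hxT)]
        rw [Real.norm_eq_abs, abs_abs]
        refine Hr (ζ x + G m x) (ζ x + H m x) ((norm_add_le _ _).trans (by linarith [hGlam m x])) ?_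
        rw [add_sub_add_left_eq_sub, norm_sub_rev]
        exact h2.trans hm
  filter_upwards [hqlim.eventually_le_const (show 0 < ε / 4 by positivity)]
    with m hm
  have hqi : Integrable (q m) μ := ((iH m).sub (iG m)).abs.indicator₀ (hTm m).compl
  let e : Vec n → ℝ := (T m).indicator fun x => h x + c * lam ^ p
  have hei : Integrable e μ := (hh.add (integrable_const _)).indicator₀ (hTm m)
  have hpt : ∀ᵐ x ∂μ, W x (ζ x + G m x) ≤ W x (ζ x + H m x) + (q m x + e x) := by
    filter_upwards [hβ.abs_le, hβ.neg_le] with x hx hx'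
    have hβx := hβ.pos x
    by_cases hxT : x ∈ T m
    · simp only [q, e, Set.indicator_of_notMem (Set.notMem_compl_iff.2 hxT),
        Set.indicator_of_mem hxT]
      have h1 := (le_abs_self _).trans (hx (ζ x + G m x))
      have h2 := hx' (ζ x + H m x)
      have h3 : (‖ζ x + G m x‖ + β x) ^ p ≤ 2 ^ p * ((‖ζ x‖ + β x) ^ p + lam ^ p) := by
        refine le_trans (Real.rpow_le_rpow (by positivity) ?_ hp0.le)
          (Real.add_rpow_le_two_rpow_mul (by positivity) (by linarith) hp0.le)
        linarith [norm_add_le (ζ x) (G m x), hGlam m x]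
      have h4 : β x ^ p ≤ (‖ζ x‖ + β x) ^ p :=
        Real.rpow_le_rpow hβx.le (by linarith [norm_nonneg (ζ x)]) hp0.le
      have h5 := mul_le_mul_of_nonneg_left h3 hC
      have h6 := mul_le_mul_of_nonneg_left h4 hC
      simp only [h, c]
      linarith
    · simp only [q, e, Set.indicator_of_mem (Set.mem_compl hxT), Set.indicator_of_notMem hxT]
      linarith [neg_abs_le (W x (ζ x + H m x) - W x (ζ x + G m x))]
  have hint := integral_mono_ae (iG m) ((iH m).add (hqi.add hei)) hpt
  have he : ∫ x, e x ∂μ ≤ ε / 2 := by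
    rw [integral_indicator₀ (hTm m), integral_add hh.restrict (integrable_const _),
      setIntegral_const, smul_eq_mul]
    have h1 := Hτ (T m) ((hTμ m).trans (ENNReal.ofReal_le_ofReal
      ((div_le_self hτ0.le hlamp).trans (min_le_left _ _))))
    have h2 : μ.real (T m) ≤ τ / lam ^ p := ENNReal.toReal_le_of_le_ofReal (by positivity) (hTμ m)
    have h3 : μ.real (T m) * (c * lam ^ p) ≤ τ * c := by
      refine (mul_le_mul_of_nonneg_right h2 (by positivity)).trans_eq ?_
      field_simp
    have h4 : τ * c ≤ ε / 4 := by
      have h5 : τ ≤ ε / (4 * (c + 1)) := min_le_right _ _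
      rw [le_div_iff₀ (by positivity)] at h5
      linarith
    linarith
  have hsum := hint.trans_eq ((integral_add (iH m) (hqi.add hei)).trans
    (congrArg ((∫ x, W x (ζ x + H m x) ∂μ) + ·) (integral_add hqi hei)))
  linarith

/-- Along a subsequence violating the inequality, truncations with a common gradient bound and sup
norm tending to zero have asymptotically at least the energy of `ζ` and at most that of `H k`, up to
`ε/2` each. -/
theorem IsBulkEnergy.eventually_le_integral_add {n : ℕ} {p : ℝ} (hp : 1 < p)
    {Ω : Set (Vec n)} (hΩ : IsOpen Ω) (hΩf : volume Ω ≠ ⊤)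
    {W : Vec n → Mat n → ℝ} (hW : IsBulkEnergy p Ω W) {ζ : Vec n → Mat n}
    (hζ : MemLp ζ (ENNReal.ofReal p) (volume.restrict Ω))
    {w : ℕ → Vec n → Vec n} {H : ℕ → Vec n → Mat n} (hw : ∀ k, IntegrableOn (w k) Ω)
    (hH : ∀ k, MemLp (H k) (ENNReal.ofReal p) (volume.restrict Ω))
    (hwH : ∀ k, IsWeakGradient Ω (w k) (H k)) {M : ℝ} (hM : ∀ k, ∫ x in Ω, ‖H k x‖ ^ p ≤ M)
    (hlim : ∀ x ρ, Tendsto (fun k => ∫ y in Metric.ball x ρ, Ω.indicator (w k) y) atTop (𝓝 0))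
    {ε : ℝ} (hε : 0 < ε) :
    ∀ᶠ k in atTop, (∫ x in Ω, W x (ζ x)) - ε ≤ ∫ x in Ω, W x (ζ x + H k x) := by
  by_contra hcon
  obtain ⟨σ, hσ, hbad⟩ := extraction_of_frequently_atTop (not_eventually.1 hcon)
  obtain ⟨C, β, hβ⟩ := hW.exists_isGrowthWeight hp hΩf
  obtain ⟨τ, hτ, Hτ⟩ := hW.eventually_integral_add_sub_le hp hΩ.measurableSet hΩf hβ hζ
    (half_pos hε)
  obtain ⟨lam, hlam, Hlam⟩ := exists_truncation_frequently hp hΩ hΩf (fun k => hw (σ k))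
    (fun k => hH (σ k)) (fun k => hwH (σ k)) (fun k => hM (σ k))
    (fun x ρ => (hlim x ρ).comp hσ.tendsto_atTop) hτ
  have hex := fun m : ℕ => (Hlam (1 / ((m : ℝ) + 1)) Nat.one_div_pos_of_nat).exists
  choose k g hg hgJ hgs hgT using hex
  have hone : Tendsto (fun k : ℕ => 1 / ((k : ℝ) + 1)) atTop (𝓝 0) :=
    tendsto_one_div_add_atTop_nhds_zero_nat
  have h1 := hW.eventually_le_integral_add_jacobian hp hΩ.measurableSet hΩf hβ hζ hg hgJ hone hgs
    (half_pos hε)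
  have h2 := Hτ lam hlam (fun m => jacobian (g m)) (fun m => H (σ (k m)))
    (fun m => (hg m).continuous_jacobian.aestronglyMeasurable) hgJ (fun m => hH _) _ hone hgT
  obtain ⟨m, hm1, hm2⟩ := (h1.and h2).exists
  exact hbad (k m) (by linarith)

/-! ### Difference quotients -/

theorem exists_inner_partialXi_eq {n : ℕ} {W : Vec n → Mat n → ℝ} {x : Vec n}
    (hd : Differentiable ℝ (W x)) (ξ A : Mat n) :
    ∃ θ ∈ Set.Ioo (0 : ℝ) 1, W x (ξ + A) - W x ξ = inner ℝ (partialXi W x (ξ + θ • A)) A := by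
  have hder : ∀ t : ℝ, HasDerivAt (fun t : ℝ => W x (ξ + t • A))
      (inner ℝ (partialXi W x (ξ + t • A)) A) t := fun t => by
    rw [inner_partialXi hd]
    have h1 : HasDerivAt (fun t : ℝ => ξ + t • A) A t := by
      simpa using ((hasDerivAt_id t).smul_const A).const_add ξ
    exact (hd _).hasFDerivAt.comp_hasDerivAt t h1
  obtain ⟨θ, hθ, h⟩ := exists_hasDerivAt_eq_slope (fun t : ℝ => W x (ξ + t • A)) _ one_pos
    (fun t _ => (hder t).continuousAt.continuousWithinAt) fun t _ => hder t
  refine ⟨θ, hθ, ?_⟩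
  rw [h]
  simp

theorem volume_lt_norm_le_rpow {α F : Type*} [MeasurableSpace α] {μ : Measure α}
    [NormedAddCommGroup F] {f : α → F} {p L M : ℝ} (hp : 0 < p)
    (hf : Integrable (fun x => ‖f x‖ ^ p) μ) (hM : ∫ x, ‖f x‖ ^ p ∂μ ≤ M) (hL : 0 < L) :
    μ {x | L < ‖f x‖} ≤ ENNReal.ofReal (M / L ^ p) := by
  have hLp : 0 < L ^ p := by positivity
  have h := mul_meas_ge_le_lintegral₀ hf.aemeasurable.ennreal_ofReal (ENNReal.ofReal (L ^ p))
  rw [← ofReal_integral_eq_lintegral_ofReal hf (ae_of_all _ fun x => by positivity)] at h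
  rw [ENNReal.ofReal_div_of_pos hLp, ENNReal.le_div_iff_mul_le
    (Or.inl (by simpa using hLp)) (Or.inl ENNReal.ofReal_ne_top), mul_comm]
  refine le_trans ?_ (h.trans (ENNReal.ofReal_le_ofReal hM))
  refine mul_le_mul' le_rfl (measure_mono fun x hx => ?_)
  simp only [Set.mem_ofPred_eq] at hx ⊢
  exact ENNReal.ofReal_le_ofReal (Real.rpow_le_rpow hL.le hx.le hp.le)

theorem IsBulkEnergy.integrable_inner_partialXi {n : ℕ} {p : ℝ} (hp : 1 < p) {Ω : Set (Vec n)}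
    {W : Vec n → Mat n → ℝ} (hW : IsBulkEnergy p Ω W) {C : ℝ} {β : Vec n → ℝ}
    (hβ : IsGrowthWeight p Ω W C β) {ζ Ψ : Vec n → Mat n}
    (hζ : MemLp ζ (ENNReal.ofReal p) (volume.restrict Ω))
    (hΨ : MemLp Ψ (ENNReal.ofReal p) (volume.restrict Ω)) :
    Integrable (fun x => inner ℝ (partialXi W x (ζ x)) (Ψ x)) (volume.restrict Ω) := by
  have hm := hW.aestronglyMeasurable_partialXi hζ.1
  refine ((hβ.integrable_rpow hp (hζ.norm.add hΨ.norm)).const_mul C).mono' (hm.inner hΨ.1) ?_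
  filter_upwards [hβ.norm_partialXi_le] with x hx
  have hβx := hβ.pos x
  have h0 : 0 < ‖ζ x‖ + ‖Ψ x‖ + β x := by positivity
  simp only [Pi.add_apply]
  rw [Real.norm_of_nonneg (by positivity : 0 ≤ ‖ζ x‖ + ‖Ψ x‖)]
  have h1 : (‖ζ x‖ + ‖Ψ x‖ + β x) ^ (p - 1) * (‖ζ x‖ + ‖Ψ x‖ + β x)
      = (‖ζ x‖ + ‖Ψ x‖ + β x) ^ p := by
    rw [← Real.rpow_add_one h0.ne', sub_add_cancel]
  rw [← h1, ← mul_assoc]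
  refine (norm_inner_le_norm _ _).trans (mul_le_mul ((hx _).trans (mul_le_mul_of_nonneg_left
    (Real.rpow_le_rpow (by positivity) (by linarith [norm_nonneg (Ψ x)]) (by linarith))
    hβ.const_nonneg)) (by linarith [norm_nonneg (ζ x)]) (norm_nonneg _) ?_)
  have := hβ.const_nonneg
  positivity

-- By the mean value theorem the remainder is a difference of stresses at two nearby points, paired
-- with `Ψ`. Where `‖ζ m‖ ≤ L` it tends to zero by continuity and domination. On the small set `‖ζ
-- m‖ > L`, Young's inequality splits it into a small multiple of `L^p`-bounded quantities and
-- `κ‖Ψ‖^p` integrated over a small set.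
set_option maxHeartbeats 800000 in
theorem IsBulkEnergy.eventually_abs_integral_sub_le {n : ℕ} {p : ℝ} (hp : 1 < p)
    {Ω : Set (Vec n)} (hΩf : volume Ω ≠ ⊤)
    {W : Vec n → Mat n → ℝ} (hW : IsBulkEnergy p Ω W) {C : ℝ} {β : Vec n → ℝ}
    (hβ : IsGrowthWeight p Ω W C β) {Ψ : Vec n → Mat n}
    (hΨ : MemLp Ψ (ENNReal.ofReal p) (volume.restrict Ω)) {ζ : ℕ → Vec n → Mat n}
    (hζ : ∀ m, MemLp (ζ m) (ENNReal.ofReal p) (volume.restrict Ω))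
    {M : ℝ} (hM : ∀ m, ∫ x in Ω, ‖ζ m x‖ ^ p ≤ M) {t : ℕ → ℝ} (ht0 : ∀ m, 0 < t m)
    (ht : Tendsto t atTop (𝓝 0)) {ε : ℝ} (hε : 0 < ε) :
    ∀ᶠ m in atTop, |(∫ x in Ω, W x (ζ m x + t m • Ψ x)) - (∫ x in Ω, W x (ζ m x))
      - t m * ∫ x in Ω, inner ℝ (partialXi W x (ζ m x)) (Ψ x)| ≤ ε * t m := by
  have : IsFiniteMeasure (volume.restrict Ω) := ⟨by simpa using hΩf.lt_top⟩
  have hp0 : 0 < p := by linarith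
  have hC := hβ.const_nonneg
  set μ := volume.restrict Ω with hμ
  have hMi : ∀ m, Integrable (fun x => ‖ζ m x‖ ^ p) μ := fun m =>
    (memLp_ofReal_iff_integrable_rpow (hζ m).1 hp0).1 (hζ m)
  have hΨi : Integrable (fun x => ‖Ψ x‖ ^ p) μ :=
    (memLp_ofReal_iff_integrable_rpow hΨ.1 hp0).1 hΨ
  have hM0 : 0 ≤ M := (integral_nonneg fun x => by positivity).trans (hM 0)
  let B : Vec n → ℝ := fun x => (‖Ψ x‖ + β x) ^ p
  have hB : Integrable B μ := hβ.integrable_rpow hp hΨ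
  have hB0 : 0 ≤ ∫ x, B x ∂μ := integral_nonneg fun x => by
    have := hβ.pos x
    positivity
  set N := 2 ^ p * (M + ∫ x, B x ∂μ) with hN
  have hN0 : 0 ≤ N := by positivity
  -- The Young parameter: `N` bounds the `p`-th powers uniformly in `m`, so their contribution is at
  -- most `ε/3`.
  set δ := ε / (3 * (2 * C * N + 1)) with hδ_def
  have hδ : 0 < δ := by positivity
  have hδN : 2 * C * δ * N ≤ ε / 3 := by
    have : δ * (3 * (2 * C * N + 1)) = ε := div_mul_cancel₀ _ (by positivity)
    linarith
  set κ := 2 * C * δ ^ (1 - p) with hκ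
  have hκ0 : 0 ≤ κ := by positivity
  obtain ⟨τ, hτ, Hτ⟩ := Integrable.exists_setIntegral_le (hΨi.const_mul κ)
    (fun x => by positivity) (show 0 < ε / 3 by positivity)
  -- By Chebyshev's inequality, the set where `‖ζ m‖ > L` then has measure at most `τ` for every
  -- `m`.
  obtain ⟨L, hL, hLτ⟩ : ∃ L : ℝ, 0 < L ∧ M / L ^ p ≤ τ := by
    have h1 := (tendsto_rpow_atTop hp0).const_div_atTop M
    obtain ⟨L, h1, h2⟩ := ((h1.eventually_le_const hτ).and (eventually_gt_atTop 0)).exists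
    exact ⟨L, h2, h1⟩
  let S : ℕ → Set (Vec n) := fun m => {x | L < ‖ζ m x‖}
  have hSm : ∀ m, NullMeasurableSet (S m) μ := fun m =>
    nullMeasurableSet_lt aemeasurable_const (hζ m).1.norm.aemeasurable
  have hSμ : ∀ m, μ (S m) ≤ ENNReal.ofReal τ := fun m =>
    (volume_lt_norm_le_rpow hp0 (hMi m) (hM m) hL).trans (ENNReal.ofReal_le_ofReal hLτ)
  have htΨ : ∀ m, MemLp (fun x => ζ m x + t m • Ψ x) (ENNReal.ofReal p) μ := fun m =>
    (hζ m).add (hΨ.const_smul (t m))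
  have i1 : ∀ m, Integrable (fun x => W x (ζ m x + t m • Ψ x)) μ := fun m =>
    hW.integrable hp hβ (htΨ m)
  have i2 : ∀ m, Integrable (fun x => W x (ζ m x)) μ := fun m => hW.integrable hp hβ (hζ m)
  have i3 : ∀ m, Integrable (fun x => inner ℝ (partialXi W x (ζ m x)) (Ψ x)) μ := fun m =>
    hW.integrable_inner_partialXi hp hβ (hζ m) hΨ
  let r : ℕ → Vec n → ℝ := fun m x => (t m)⁻¹ * (W x (ζ m x + t m • Ψ x) - W x (ζ m x))
    - inner ℝ (partialXi W x (ζ m x)) (Ψ x)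
  have hr : ∀ m, Integrable (r m) μ := fun m => (((i1 m).sub (i2 m)).const_mul _).sub (i3 m)
  have hrmean : ∀ m, ∀ᵐ x ∂μ, ∃ θ ∈ Set.Ioo (0 : ℝ) 1,
      r m x = inner ℝ (partialXi W x (ζ m x + θ • t m • Ψ x) - partialXi W x (ζ m x)) (Ψ x) := by
    intro m
    filter_upwards [hW.differentiable] with x hd
    obtain ⟨θ, hθ, h⟩ := exists_inner_partialXi_eq hd (ζ m x) (t m • Ψ x)
    refine ⟨θ, hθ, ?_⟩
    simp only [r]
    rw [h, inner_smul_right, inv_mul_cancel_left₀ (ht0 m).ne', inner_sub_left]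
  have hrle : ∀ m, t m ≤ 1 → ∀ᵐ x ∂μ,
      |r m x| ≤ 2 * C * ((‖ζ m x‖ + (‖Ψ x‖ + β x)) ^ (p - 1) * ‖Ψ x‖) := by
    intro m hm
    filter_upwards [hrmean m, hβ.norm_partialXi_le] with x ⟨θ, hθ, h⟩ hx
    have hβx := hβ.pos x
    rw [h]
    have h1 : ∀ ξ : Mat n, ‖ξ‖ ≤ ‖ζ m x‖ + ‖Ψ x‖ →
        ‖partialXi W x ξ‖ ≤ C * (‖ζ m x‖ + (‖Ψ x‖ + β x)) ^ (p - 1) := fun ξ hξ =>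
      (hx ξ).trans (mul_le_mul_of_nonneg_left
        (Real.rpow_le_rpow (by positivity) (by linarith) (by linarith)) hC)
    have h2 := h1 (ζ m x) (by linarith [norm_nonneg (Ψ x)])
    have h3 := h1 (ζ m x + θ • t m • Ψ x) (by
      refine (norm_add_le _ _).trans (add_le_add le_rfl ?_)
      rw [smul_smul, norm_smul, Real.norm_of_nonneg (mul_nonneg hθ.1.le (ht0 m).le)]
      exact mul_le_of_le_one_left (norm_nonneg _) (mul_le_one₀ hθ.2.le (ht0 m).le hm))
    refine (abs_real_inner_le_norm _ _).trans ?_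
    rw [← mul_assoc]
    refine mul_le_mul_of_nonneg_right ((norm_sub_le _ _).trans (by linarith)) (norm_nonneg _)
  let q : ℕ → Vec n → ℝ := fun m => (S m)ᶜ.indicator fun x => |r m x|
  have hqi : ∀ m, Integrable (q m) μ := fun m => (hr m).abs.indicator₀ (hSm m).compl
  have ht1 : ∀ᶠ m in atTop, t m ≤ 1 := ht.eventually_le_const one_pos
  have hqlim : Tendsto (fun m => ∫ x, q m x ∂μ) atTop (𝓝 0) := by
    have hadd : MemLp (fun x => L + ‖Ψ x‖) (ENNReal.ofReal p) μ := (memLp_const L).add hΨ.norm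
    have := tendsto_integral_filter_of_dominated_convergence (μ := μ) (l := atTop)
      (F := q) (f := fun _ => 0) (fun x => 2 * (C * (‖L + ‖Ψ x‖‖ + β x) ^ p))
      (Eventually.of_forall fun m => (hqi m).1) ?_
      (((hβ.integrable_rpow hp hadd).const_mul C).const_mul 2) ?_
    · simpa using this
    · filter_upwards [ht1] with m hm
      filter_upwards [hrle m hm] with x hx
      have hβx := hβ.pos x
      rw [Real.norm_of_nonneg (by positivity : 0 ≤ L + ‖Ψ x‖)]
      by_cases hxS : x ∈ S m
      · simp only [q, Set.indicator_of_notMem (Set.notMem_compl_iff.2 hxS), norm_zero]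
        positivity
      · have h2 : ‖ζ m x‖ ≤ L := not_lt.1 hxS
        simp only [q, Set.indicator_of_mem (Set.mem_compl hxS)]
        rw [Real.norm_eq_abs, abs_abs]
        refine hx.trans ?_
        rw [mul_assoc]
        have h0 : 0 < L + ‖Ψ x‖ + β x := by positivity
        have h3 : (L + ‖Ψ x‖ + β x) ^ (p - 1) * (L + ‖Ψ x‖ + β x) = (L + ‖Ψ x‖ + β x) ^ p := by
          rw [← Real.rpow_add_one h0.ne', sub_add_cancel]
        rw [← h3]
        exact mul_le_mul_of_nonneg_left (mul_le_mul_of_nonneg_left (mul_le_mul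
          (Real.rpow_le_rpow (by positivity) (by linarith) (by linarith))
          (by linarith) (norm_nonneg _) (by positivity)) hC) zero_le_two
    · have hall := ae_all_iff.2 hrmean
      filter_upwards [hall, hW.differentiable, hW.isQuasiconvex] with x hx hd hq
      refine Metric.tendsto_nhds.2 fun η hη => ?_
      obtain ⟨s, hs, Hs⟩ := (continuous_partialXi hd hq).exists_norm_sub_le L
        (show 0 < η / (2 * (‖Ψ x‖ + 1)) by positivity)
      have hts : ∀ᶠ m in atTop, t m ≤ s / (‖Ψ x‖ + 1) :=
        ht.eventually_le_const (by positivity)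
      filter_upwards [hts] with m hm
      rw [dist_zero_right]
      refine lt_of_le_of_lt ?_ (half_lt_self hη)
      by_cases hxS : x ∈ S m
      · simp only [q, Set.indicator_of_notMem (Set.notMem_compl_iff.2 hxS), norm_zero]
        positivity
      · have h2 : ‖ζ m x‖ ≤ L := not_lt.1 hxS
        simp only [q, Set.indicator_of_mem (Set.mem_compl hxS)]
        rw [Real.norm_eq_abs, abs_abs]
        obtain ⟨θ, hθ, h⟩ := hx m
        rw [h]
        rw [le_div_iff₀ (by positivity)] at hm
        have h3 := Hs (ζ m x) (ζ m x + θ • t m • Ψ x) h2 (by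
          rw [add_sub_cancel_left, smul_smul, norm_smul,
            Real.norm_of_nonneg (mul_nonneg hθ.1.le (ht0 m).le), mul_assoc]
          refine (mul_le_of_le_one_left (mul_nonneg (ht0 m).le (norm_nonneg _)) hθ.2.le).trans ?_
          linarith [ht0 m])
        refine (abs_real_inner_le_norm _ _).trans ((mul_le_mul_of_nonneg_right h3
          (norm_nonneg _)).trans ?_)
        rw [div_mul_eq_mul_div, div_le_div_iff₀ (by positivity) two_pos]
        linarith
  filter_upwards [hqlim.eventually_le_const (show 0 < ε / 3 by positivity), ht1] with m hm hm1
  let A : Vec n → ℝ := fun x => 2 * C * δ * (2 ^ p * (‖ζ m x‖ ^ p + B x))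
  let e : Vec n → ℝ := (S m).indicator fun x => κ * ‖Ψ x‖ ^ p
  have hA : Integrable A μ := (((hMi m).add hB).const_mul _).const_mul _
  have he : Integrable e μ := (hΨi.const_mul κ).indicator₀ (hSm m)
  have hpt : ∀ᵐ x ∂μ, |r m x| ≤ q m x + (A x + e x) := by
    filter_upwards [hrle m hm1] with x hx
    have hβx := hβ.pos x
    have hA0 : 0 ≤ A x := by positivity
    by_cases hxS : x ∈ S m
    · simp only [q, e, Set.indicator_of_notMem (Set.notMem_compl_iff.2 hxS),
        Set.indicator_of_mem hxS]
      have h1 := Real.rpow_sub_one_mul_le (a := ‖ζ m x‖ + (‖Ψ x‖ + β x)) (by positivity)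
        (norm_nonneg (Ψ x)) hp hδ
      have h2 : (‖ζ m x‖ + (‖Ψ x‖ + β x)) ^ p ≤ 2 ^ p * (‖ζ m x‖ ^ p + B x) :=
        Real.add_rpow_le_two_rpow_mul (norm_nonneg _) (by positivity) hp0.le
      have h3 := mul_le_mul_of_nonneg_left h2 hδ.le
      have h4 := mul_le_mul_of_nonneg_left (h1.trans (add_le_add h3 le_rfl))
        (show 0 ≤ 2 * C by positivity)
      simp only [A, κ]
      linarith
    · simp only [q, e, Set.indicator_of_mem (Set.mem_compl hxS), Set.indicator_of_notMem hxS]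
      linarith
  have hint := (integral_mono_ae (hr m).abs ((hqi m).add (hA.add he)) hpt).trans_eq
    ((integral_add (hqi m) (hA.add he)).trans
      (congrArg ((∫ x, q m x ∂μ) + ·) (integral_add hA he)))
  have hAle : ∫ x, A x ∂μ ≤ ε / 3 := by
    refine le_trans ?_ hδN
    simp only [A]
    rw [integral_const_mul, integral_const_mul, integral_add (hMi m) hB]
    exact mul_le_mul_of_nonneg_left (mul_le_mul_of_nonneg_left (add_le_add (hM m) le_rfl)
      (by positivity)) (by positivity)
  have hele : ∫ x, e x ∂μ ≤ ε / 3 := by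
    rw [integral_indicator₀ (hSm m)]
    exact Hτ _ (hSμ m)
  have hrint : ∫ x, r m x ∂μ = (t m)⁻¹ * ((∫ x, W x (ζ m x + t m • Ψ x) ∂μ)
      - ∫ x, W x (ζ m x) ∂μ) - ∫ x, inner ℝ (partialXi W x (ζ m x)) (Ψ x) ∂μ := by
    have i4 : Integrable (fun x => (t m)⁻¹ * (W x (ζ m x + t m • Ψ x) - W x (ζ m x))) μ :=
      ((i1 m).sub (i2 m)).const_mul _
    simp only [r]
    rw [integral_sub i4 (i3 m), integral_const_mul,
      integral_sub (i1 m) (i2 m)]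
  have habs := (abs_integral_le_integral_abs (f := r m) (μ := μ)).trans hint
  have hfin : |∫ x, r m x ∂μ| ≤ ε := by linarith
  have hmul : (∫ x, W x (ζ m x + t m • Ψ x) ∂μ) - (∫ x, W x (ζ m x) ∂μ)
      - t m * ∫ x, inner ℝ (partialXi W x (ζ m x)) (Ψ x) ∂μ = t m * ∫ x, r m x ∂μ := by
    rw [hrint, mul_sub, mul_inv_cancel_left₀ (ht0 m).ne']
  rw [hmul, abs_mul, abs_of_pos (ht0 m), mul_comm]
  exact mul_le_mul_of_nonneg_right hfin (ht0 m).le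

/-- If every step `1/(m+1)` failed for some field in the `L^p`-bounded class, these fields would
contradict the asymptotic estimate. One step `t` thus serves the whole sequence and its limit. -/
theorem IsBulkEnergy.exists_forall_abs_integral_sub_le {n : ℕ} {p : ℝ} (hp : 1 < p)
    {Ω : Set (Vec n)} (hΩf : volume Ω ≠ ⊤)
    {W : Vec n → Mat n → ℝ} (hW : IsBulkEnergy p Ω W) {Ψ : Vec n → Mat n}
    (hΨ : MemLp Ψ (ENNReal.ofReal p) (volume.restrict Ω)) (M : ℝ) {ε : ℝ} (hε : 0 < ε) :
    ∃ t > 0, ∀ ζ : Vec n → Mat n, MemLp ζ (ENNReal.ofReal p) (volume.restrict Ω) →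
      ∫ x in Ω, ‖ζ x‖ ^ p ≤ M →
      |(∫ x in Ω, W x (ζ x + t • Ψ x)) - (∫ x in Ω, W x (ζ x))
        - t * ∫ x in Ω, inner ℝ (partialXi W x (ζ x)) (Ψ x)| ≤ ε * t := by
  obtain ⟨C, β, hβ⟩ := hW.exists_isGrowthWeight hp hΩf
  by_contra! hcon
  have hex := fun m : ℕ => hcon (1 / ((m : ℝ) + 1)) Nat.one_div_pos_of_nat
  choose ζ hζ hM hbad using hex
  obtain ⟨m, hm⟩ := (hW.eventually_abs_integral_sub_le hp hΩf hβ hΨ hζ hM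
    (fun m => Nat.one_div_pos_of_nat) tendsto_one_div_add_atTop_nhds_zero_nat hε).exists
  exact absurd hm (not_le.2 (hbad m))

/-! ### Weak convergence of the stresses -/

theorem IsWeakGradient.sub {n : ℕ} {Ω : Set (Vec n)} {u v : Vec n → Vec n} {G H : Vec n → Mat n}
    (hu : IsWeakGradient Ω u G) (hv : IsWeakGradient Ω v H) (hui : IntegrableOn u Ω)
    (hvi : IntegrableOn v Ω) (hGi : IntegrableOn G Ω) (hHi : IntegrableOn H Ω) :
    IsWeakGradient Ω (fun x => u x - v x) (fun x => G x - H x) := by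
  intro φ hφ hφc hφΩ i j
  have hd : Continuous fun x => fderiv ℝ φ x (EuclideanSpace.single j 1) :=
    (hφ.continuous_fderiv (by simp)).clm_apply continuous_const
  obtain ⟨c₁, hc₁⟩ := hφ.continuous.bounded_above_of_compact_support hφc
  obtain ⟨c₂, hc₂⟩ := hd.bounded_above_of_compact_support (hφc.fderiv_apply ℝ _)
  have hvec : ∀ {ι : Type} [Fintype ι] {f : Vec n → EuclideanSpace ℝ ι} (i : ι),
      IntegrableOn f Ω → IntegrableOn (fun x => f x i) Ω := fun i hf =>
    (EuclideanSpace.proj (𝕜 := ℝ) i).integrable_comp hf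
  have hmul : ∀ {f ψ : Vec n → ℝ} {c : ℝ}, IntegrableOn f Ω → Continuous ψ → (∀ x, ‖ψ x‖ ≤ c) →
      IntegrableOn (fun x => f x * ψ x) Ω := fun hf hψ hc =>
    hf.mul_bdd hψ.aestronglyMeasurable (ae_of_all _ hc)
  simp only [PiLp.sub_apply, sub_mul]
  rw [integral_sub (hmul (hvec i hui) hd hc₂) (hmul (hvec i hvi) hd hc₂),
    integral_sub (hmul (hvec _ hGi) hφ.continuous hc₁) (hmul (hvec _ hHi) hφ.continuous hc₁),
    hu φ hφ hφc hφΩ i j, hv φ hφ hφc hφΩ i j]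
  ring

/-- Each coordinate is tested with the indicator of the ball times a basis vector. -/
theorem WeakLpTendsto.tendsto_integral_ball {n : ℕ} {ι : Type} [Fintype ι] [DecidableEq ι] {p : ℝ}
    (hp : 1 < p) {Ω : Set (Vec n)} (hΩ : MeasurableSet Ω) (hΩf : volume Ω ≠ ⊤)
    {u : ℕ → Vec n → EuclideanSpace ℝ ι} {v : Vec n → EuclideanSpace ℝ ι}
    (h : WeakLpTendsto p Ω u v) (x : Vec n) (ρ : ℝ) :
    Tendsto (fun k => ∫ y in Metric.ball x ρ, Ω.indicator (fun y => u k y - v y) y) atTop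
      (𝓝 0) := by
  have : IsFiniteMeasure (volume.restrict Ω) := ⟨by simpa using hΩf.lt_top⟩
  have hp1 : (1 : ENNReal) ≤ ENNReal.ofReal p := by
    rw [← ENNReal.ofReal_one]; exact ENNReal.ofReal_le_ofReal hp.le
  have hball : MeasurableSet (Metric.ball x ρ) := Metric.isOpen_ball.measurableSet
  have hcoord : ∀ i, Tendsto (fun k => (∫ y in Metric.ball x ρ,
      Ω.indicator (fun y => u k y - v y) y) i) atTop (𝓝 0) := by
    intro i
    let ψ : Vec n → EuclideanSpace ℝ ι :=
      (Metric.ball x ρ).indicator fun _ => EuclideanSpace.single i 1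
    have hψ : MemLp ψ (ENNReal.ofReal (p / (p - 1))) (volume.restrict Ω) :=
      (memLp_const _).indicator hball
    have hval : ∀ f : Vec n → EuclideanSpace ℝ ι,
        ∫ y in Ω, inner ℝ (f y) (ψ y) = ∫ y in Ω, (Metric.ball x ρ).indicator (fun y => f y i) y :=
      fun f => integral_congr_ae (ae_of_all _ fun y => by
        by_cases hy : y ∈ Metric.ball x ρ <;> simp [ψ, hy, EuclideanSpace.inner_single_right])
    have hint : ∀ f : Vec n → EuclideanSpace ℝ ι, IntegrableOn f Ω →
        IntegrableOn (fun y => (Metric.ball x ρ).indicator (fun y => f y i) y) Ω := fun f hf =>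
      ((EuclideanSpace.proj (𝕜 := ℝ) i).integrable_comp hf).indicator hball
    have hlim := (h.tendsto ψ hψ).sub_const (∫ y in Ω, inner ℝ (v y) (ψ y))
    rw [sub_self] at hlim
    refine hlim.congr fun k => ?_
    have hu : IntegrableOn (u k) Ω := (h.memLp k).integrable hp1
    have hv : IntegrableOn v Ω := h.memLp_lim.integrable hp1
    have huv : Integrable (Ω.indicator fun y => u k y - v y) :=
      (hu.sub hv).indicator_of_normed hΩ
    have h1 : ∫ y in Metric.ball x ρ, Ω.indicator (fun y => u k y - v y) y i
        = (∫ y in Metric.ball x ρ, Ω.indicator (fun y => u k y - v y) y) i :=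
      (EuclideanSpace.proj (𝕜 := ℝ) i).integral_comp_comm (huv.integrableOn (s := Metric.ball x ρ))
    rw [hval, hval, ← integral_sub (hint _ hu) (hint _ hv), ← h1,
      ← integral_indicator hΩ, ← integral_indicator hball]
    refine integral_congr_ae (ae_of_all _ fun y => ?_)
    by_cases hy : y ∈ Metric.ball x ρ <;> by_cases hy' : y ∈ Ω <;>
      simp [hy, hy']
  have := ((PiLp.continuous_toLp 2 fun _ : ι => ℝ).tendsto 0).comp (tendsto_pi_nhds.2 hcoord)
  simpa [Function.comp_def] using this

/-- Coercivity converts the energy bound into an `L^p` bound, so the uniform boundedness principle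
is not needed. -/
theorem IsBulkEnergy.exists_integral_rpow_le {n : ℕ} {p : ℝ} (hp : 1 < p) {Ω : Set (Vec n)}
    (hΩf : volume Ω ≠ ⊤) {W : Vec n → Mat n → ℝ} (hW : IsBulkEnergy p Ω W)
    {ζ : ℕ → Vec n → Mat n} (hζ : ∀ k, MemLp (ζ k) (ENNReal.ofReal p) (volume.restrict Ω))
    (hbdd : BddAbove (Set.range fun k => ∫ x in Ω, W x (ζ k x))) :
    ∃ M, ∀ k, ∫ x in Ω, ‖ζ k x‖ ^ p ≤ M := by
  obtain ⟨C, β, hβ⟩ := hW.exists_isGrowthWeight hp hΩf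
  obtain ⟨a₀, a₁, b₀, b₁, ha₀, hb₀, hb₁, hb⟩ := hW.growth
  obtain ⟨E, hE⟩ := hbdd
  refine ⟨(E + ∫ x in Ω, b₀ x) / a₀, fun k => ?_⟩
  have hi := (memLp_ofReal_iff_integrable_rpow (hζ k).1 (by linarith)).1 (hζ k)
  have hWi := hW.integrable hp hβ (hζ k)
  rw [le_div_iff₀ ha₀, mul_comm, ← integral_const_mul]
  refine le_trans ?_ (add_le_add (hE ⟨k, rfl⟩) le_rfl)
  rw [← integral_add hWi hb₀]
  refine integral_mono_ae (hi.const_mul _) (hWi.add hb₀) ?_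
  filter_upwards [hb] with x hx
  have := (hx (ζ k x)).1
  linarith

theorem mainTheorem2 (n : ℕ) (p : ℝ) (hp : 1 < p)
    (Ω : Set (Vec n)) (hΩ : IsOpen Ω) (hΩb : Bornology.IsBounded Ω)
    (W : Vec n → Mat n → ℝ) (hW : IsBulkEnergy p Ω W)
    (u : ℕ → Vec n → Vec n) (Du : ℕ → Vec n → Mat n)
    (v : Vec n → Vec n) (Dv : Vec n → Mat n)
    (huv : WeakSobolevTendsto p Ω u Du v Dv)
    (henergy : Tendsto (fun k => ∫ x in Ω, W x (Du k x)) atTop (𝓝 (∫ x in Ω, W x (Dv x)))) :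
    WeakLpTendsto (p / (p - 1)) Ω (fun k x => partialXi W x (Du k x))
      (fun x => partialXi W x (Dv x)) := by
  have hΩf : volume Ω ≠ ⊤ := hΩb.measure_lt_top.ne
  have : IsFiniteMeasure (volume.restrict Ω) := ⟨by simpa using hΩf.lt_top⟩
  have hp0 : 0 < p := by linarith
  have hp1 : (1 : ENNReal) ≤ ENNReal.ofReal p := by
    rw [← ENNReal.ofReal_one]; exact ENNReal.ofReal_le_ofReal hp.le
  obtain ⟨C, β, hβ⟩ := hW.exists_isGrowthWeight hp hΩf
  have hDu := huv.tendsto_grad.memLp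
  have hDv := huv.tendsto_grad.memLp_lim
  obtain ⟨M, hM⟩ := hW.exists_integral_rpow_le hp hΩf hDu henergy.bddAbove_range
  have hDui := fun k => (memLp_ofReal_iff_integrable_rpow (hDu k).1 hp0).1 (hDu k)
  have hDvi := (memLp_ofReal_iff_integrable_rpow hDv.1 hp0).1 hDv
  have hMH : ∀ k, ∫ x in Ω, ‖Du k x - Dv x‖ ^ p ≤ 2 ^ p * (M + ∫ x in Ω, ‖Dv x‖ ^ p) := by
    intro k
    have h1 : Integrable (fun x => 2 ^ p * (‖Du k x‖ ^ p + ‖Dv x‖ ^ p)) (volume.restrict Ω) :=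
      ((hDui k).add hDvi).const_mul _
    have h2 := integral_mono_ae
      ((memLp_ofReal_iff_integrable_rpow ((hDu k).sub hDv).1 hp0).1 ((hDu k).sub hDv)) h1
      (ae_of_all _ fun x => (Real.rpow_le_rpow (norm_nonneg _) (norm_sub_le (Du k x) (Dv x))
        hp0.le).trans (Real.add_rpow_le_two_rpow_mul (norm_nonneg _) (norm_nonneg _) hp0.le))
    rw [integral_const_mul, integral_add (hDui k) hDvi] at h2
    exact h2.trans (mul_le_mul_of_nonneg_left (add_le_add (hM k) le_rfl) (by positivity))
  have key : ∀ Ψ : Vec n → Mat n, MemLp Ψ (ENNReal.ofReal p) (volume.restrict Ω) → ∀ ε > 0,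
      ∀ᶠ k in atTop, (∫ x in Ω, inner ℝ (partialXi W x (Dv x)) (Ψ x)) - ε
        ≤ ∫ x in Ω, inner ℝ (partialXi W x (Du k x)) (Ψ x) := by
    intro Ψ hΨ ε hε
    -- The maximum lets the same `t` serve `Du k` and `Dv`. Four errors of size `(ε/4) t` follow:
    -- two from differentiation, one from semicontinuity, one from convergence of the energies;
    -- dividing by `t` leaves `ε`.
    obtain ⟨t, ht, Ht⟩ := hW.exists_forall_abs_integral_sub_le hp hΩf hΨ
      (max M (∫ x in Ω, ‖Dv x‖ ^ p)) (show 0 < ε / 4 by positivity)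
    have hlsc := hW.eventually_le_integral_add hp hΩ hΩf (hDv.add (hΨ.const_smul t))
      (w := fun k x => u k x - v x) (H := fun k x => Du k x - Dv x)
      (fun k => ((huv.tendsto.memLp k).integrable hp1).sub (huv.tendsto.memLp_lim.integrable hp1))
      (fun k => (hDu k).sub hDv)
      (fun k => (huv.isSobolev k).isWeakGradient.sub huv.isSobolev_lim.isWeakGradient
        ((huv.tendsto.memLp k).integrable hp1) (huv.tendsto.memLp_lim.integrable hp1)
        ((hDu k).integrable hp1) (hDv.integrable hp1))
      hMH (fun x ρ => huv.tendsto.tendsto_integral_ball hp hΩ.measurableSet hΩf x ρ)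
      (show 0 < ε / 4 * t by positivity)
    filter_upwards [hlsc, henergy.eventually_le_const
      (show (∫ x in Ω, W x (Dv x)) < (∫ x in Ω, W x (Dv x)) + ε / 4 * t by
        have : 0 < ε / 4 * t := by positivity
        linarith)] with k hk1 hk2
    have e1 := (abs_le.1 (Ht (Du k) (hDu k) ((hM k).trans (le_max_left _ _)))).2
    have e2 := (abs_le.1 (Ht Dv hDv (le_max_right _ _))).1
    have e3 : ∀ x, (Dv + t • Ψ) x + (Du k x - Dv x) = Du k x + t • Ψ x := fun x => by
      simp only [Pi.add_apply, Pi.smul_apply]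
      abel
    simp only [e3] at hk1
    simp only [Pi.add_apply, Pi.smul_apply] at hk1
    refine le_of_mul_le_mul_left ?_ ht
    rw [mul_sub]
    linarith
  refine ⟨fun k => hW.memLp_partialXi hp hβ (hDu k), hW.memLp_partialXi hp hβ hDv, ?_⟩
  intro Ψ hΨ
  -- The conjugate exponent of `p'` is `p`, so the test fields are exactly those admitted by `key`.
  have hexp : p / (p - 1) / (p / (p - 1) - 1) = p := by
    have : p - 1 ≠ 0 := by linarith
    have h2 : p / (p - 1) - 1 = 1 / (p - 1) := by field_simp; ring
    rw [h2]
    field_simp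
  rw [hexp] at hΨ
  refine Metric.tendsto_nhds.2 fun ε hε => ?_
  -- The one-sided estimate for `-Ψ` is the upper bound for `Ψ`.
  filter_upwards [key Ψ hΨ (ε / 2) (half_pos hε), key (-Ψ) hΨ.neg (ε / 2) (half_pos hε)]
    with k h1 h2
  simp only [Pi.neg_apply, inner_neg_right, integral_neg] at h2
  rw [Real.dist_eq, abs_lt]
  constructor <;> linarith
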